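/- All groupoids are \'etale and locally compact with Hausdorff object space; arrow spaces may be non-Hausdorff. Products \(x\cdot y\) are defined when \(s(x)=r(y)\). Proper maps are taken in Bourbaki's sense. \textbf{Correspondences.} Let \(G\) be a groupoid. A groupoid correspondence \(X\colon G\leftarrow G\) is a topological space with commuting (continuous) actions of \(G\) on the left (anchor map \(r\colon X\to G^0\)) and on the right (anchor map \(s\colon X\to G^0\)), such that the right action is free and proper and \(s\) is a local homeomorphism. Let \(\mathsf p\colon X\to X/G\) be the projection to the orbit space of the right action and \(r_*\colon X/G\to G^0\) the map induced by \(r\). For an open \(G\)-invariant subset \(R\subseteq G^0\), \(X\) is regular on \(R\) if the restriction \(r_*^{-1}(R)\to R\) of \(r_*\) is proper and surjective. \textbf{Groupoid model.} A \((G,X,R)\)-action on a topological space \(Y\) is a \(G\)-action on \(Y\) (anchor map \(r\)) with a continuous open map \(X\times_{s,G^0,r}Y\to Y\), \((x,y)\mapsto x\cdot y\), such that: \(r(x\cdot y)=r(x)\) and \(g\cdot(x\cdot y)=(g\cdot x)\cdot y\); \(x\cdot y=x'\cdot y'\) if and only if \(x'=x\cdot g\) and \(y=g\cdot y'\) for some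 \(g\in G\); \(r^{-1}(R)\subseteq X\cdot Y\); and for every compact \(K\subseteq X/G\), the set of all \(x\cdot y\) with \([x]\in K\) is closed in \(Y\). A map \(\varphi\colon Y_1\to Y_2\) is \((G,X)\)-equivariant if it is compatible with the anchor maps to \(G^0\), \(\varphi(g\cdot y)=g\cdot\varphi(y)\), \(\varphi(x\cdot y)=x\cdot\varphi(y)\) and \(\varphi^{-1}(X\cdot Y_2)=X\cdot Y_1\). A groupoid model of \((G,X,R)\) is a groupoid \(M\) with bijections, for all topological spaces \(Y\), between \((G,X,R)\)-actions and \(M\)-actions on \(Y\), such that a continuous map is \((G,X)\)-equivariant if and only if it is \(M\)-equivariant. \textbf{Actors.} An actor \(M\to H\) is an action of \(M\) on the arrow space of \(H\) that commutes with the right translation action of \(H\). It is proper if the map \(H^0\cong H/H\to M^0\) induced by its anchor map is proper. \textbf{Bisections.} A bisection of a groupoid is an open subset on which \(r\) and \(s\) are injective; a bisection of \(X\) is an open subset on which \(s\) and \(\mathsf p\) are injective. Let \(\mathcal B(G)\), \(\mathcal B(X)\), \(\mathcal B(H)\) be the sets of bisections. Products \(VW\) are elementwise and \(V^*=\{g^{-1}: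 g\in V\}\). For \(V,W\in\mathcal B(X)\), let \(\langle V|W\rangle\in\mathcal B(G)\) be the set of all \(g\in G\) with \(x\cdot g=y\) for some \(x\in V\), \(y\in W\). Open subsets of object spaces are viewed as bisections consisting of unit arrows. \textbf{Theorem.} Let \(G\) and \(H\) be groupoids, let \(R\subseteq G^0\) be open and \(G\)-invariant, let \(X\colon G\leftarrow G\) be a groupoid correspondence that is regular on \(R\), and let \(M\) be a groupoid model of \((G,X,R)\). There is a bijection between actors \(M\to H\) and maps \(\vartheta\colon\mathcal B(G)\sqcup\mathcal B(X)\to\mathcal B(H)\) such that \begin{enumerate} \item \(\vartheta_V\vartheta_W=\vartheta_{VW}\) if \(V\) and \(W\) are bisections of \(G\) or \(X\) and at most one of them is a bisection of \(X\); \item \(\vartheta_V^*\vartheta_W=\vartheta_{\langle V|W\rangle}\) for \(V,W\in\mathcal B(X)\); \item \(\vartheta_{G^0}=H^0\); \item the restriction of \(\vartheta\) to open subsets of \(G^0\) commutes with arbitrary unions; \item \(r(\vartheta_R)\subseteq\bigcup_{U\in\mathcal B(X)}r(\vartheta_U)\); \item if \(U\in\mathcal B(X)\) is precompact, that is, contained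 in a compact subset of \(X\), then the closure of \(r(\vartheta_U)\) in \(H^0\) is contained in \(\bigcup_{W\in\mathcal B(X)}r(\vartheta_W)\). \end{enumerate} The map \(\vartheta\) that corresponds to an actor is the unique one such that, for the \((G,X,R)\)-action on the arrow space of \(H\) that corresponds to the \(M\)-action, and for each \(V\in\mathcal B(G)\sqcup\mathcal B(X)\), left multiplication by the bisection \(\vartheta_V\) on \(H\) is the partial map \(h\mapsto v\cdot h\) for \(v\in V\) with \(s(v)\) equal to the anchor of \(h\). For each actor there is a continuous map \(\varrho\colon H^0\to G^0\) such that the anchor map \(H\to G^0\) of this \((G,X,R)\)-action is \(\varrho\circ r\); it satisfies \(\vartheta_U=\varrho^{-1}(U)\) for all open \(U\subseteq G^0\). The actor is proper if and only if \(\varrho\) is proper. If \(\vartheta\) satisfies (1)--(5), then there is a unique continuous map \(\varrho\colon H^0\to G^0\) with \(\vartheta_U=\varrho^{-1}(U)\) for all open \(U\subseteq G^0\), and if \(\varrho\) is proper, then (6) holds. -/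

import Mathlib

open Set TopologicalSpace

universe u

/-- The fibre product `A ×_{f,B,g} C`, with the subspace topology of `A × C`. -/
abbrev FibreProd {A B C : Type u} (f : A → B) (g : C → B) : Type u :=
  {p : A × C // f p.1 = g p.2}

/-- An étale, locally compact groupoid with Hausdorff object space. The arrow space need not be
Hausdorff. The product `g h` is defined if `s g = r h`. -/
structure EtaleGroupoid where
  /-- the object space `G⁰` -/
  Obj : Type u
  /-- the arrow space -/
  Arr : Type u
  [topObj : TopologicalSpace Obj]
  [topArr : TopologicalSpace Arr]
  [t2 : T2Space Obj]
  [locallyCompact : LocallyCompactSpace Obj]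
  /-- range -/
  r : Arr → Obj
  /-- source -/
  s : Arr → Obj
  /-- unit arrows -/
  one : Obj → Arr
  /-- inverses -/
  inv : Arr → Arr
  /-- multiplication of composable arrows -/
  mul : ∀ g h : Arr, s g = r h → Arr
  r_one : ∀ x, r (one x) = x
  s_one : ∀ x, s (one x) = x
  r_inv : ∀ g, r (inv g) = s g
  s_inv : ∀ g, s (inv g) = r g
  r_mul : ∀ g h e, r (mul g h e) = r g
  s_mul : ∀ g h e, s (mul g h e) = s h
  mul_assoc : ∀ g h k (e₁ : s g = r h) (e₂ : s h = r k),
    mul (mul g h e₁) k ((s_mul g h e₁).trans e₂) = mul g (mul h k e₂) (e₁.trans (r_mul h k e₂).symm)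
  one_mul : ∀ g, mul (one (r g)) g (s_one _) = g
  mul_one : ∀ g, mul g (one (s g)) (r_one _).symm = g
  inv_mul : ∀ g, mul (inv g) g (s_inv g) = one (s g)
  mul_inv : ∀ g, mul g (inv g) (r_inv g).symm = one (r g)
  continuous_one : Continuous one
  continuous_inv : Continuous inv
  continuous_mul : Continuous fun p : FibreProd s r => mul p.1.1 p.1.2 p.2
  isLocalHomeomorph_r : IsLocalHomeomorph r
  isLocalHomeomorph_s : IsLocalHomeomorph s

attribute [instance] EtaleGroupoid.topObj EtaleGroupoid.topArr EtaleGroupoid.t2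
  EtaleGroupoid.locallyCompact

/-- A (continuous) left action of a groupoid on a topological space, with anchor map `anchor`. -/
@[ext]
structure LeftAction (G : EtaleGroupoid.{u}) (Y : Type u) [TopologicalSpace Y] where
  anchor : Y → G.Obj
  act : ∀ (g : G.Arr) (y : Y), G.s g = anchor y → Y
  continuous_anchor : Continuous anchor
  continuous_act : Continuous fun p : FibreProd G.s anchor => act p.1.1 p.1.2 p.2
  anchor_act : ∀ g y e, anchor (act g y e) = G.r g
  mul_act : ∀ g h y (e₁ : G.s g = G.r h) (e₂ : G.s h = anchor y),
    act (G.mul g h e₁) y ((G.s_mul g h e₁).trans e₂) =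
      act g (act h y e₂) (e₁.trans (anchor_act h y e₂).symm)
  one_act : ∀ y, act (G.one (anchor y)) y (G.s_one _) = y

/-- A (continuous) right action of a groupoid on a topological space. -/
@[ext]
structure RightAction (K : EtaleGroupoid.{u}) (Y : Type u) [TopologicalSpace Y] where
  anchor : Y → K.Obj
  act : ∀ (y : Y) (k : K.Arr), anchor y = K.r k → Y
  continuous_anchor : Continuous anchor
  continuous_act : Continuous fun p : FibreProd anchor K.r => act p.1.1 p.1.2 p.2
  anchor_act : ∀ y k e, anchor (act y k e) = K.s k
  act_mul : ∀ y k l (e₁ : anchor y = K.r k) (e₂ : K.s k = K.r l),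
    act y (K.mul k l e₂) (e₁.trans (K.r_mul k l e₂).symm) =
      act (act y k e₁) l ((anchor_act y k e₁).trans e₂)
  act_one : ∀ y, act y (K.one (anchor y)) (K.r_one _).symm = y

/-- A map is equivariant if it is compatible with the anchor maps and with the actions. -/
def LeftAction.IsEquivariant {G : EtaleGroupoid.{u}} {Y₁ Y₂ : Type u} [TopologicalSpace Y₁]
    [TopologicalSpace Y₂] (a₁ : LeftAction G Y₁) (a₂ : LeftAction G Y₂) (f : Y₁ → Y₂) : Prop :=
  ∃ h : ∀ y, a₂.anchor (f y) = a₁.anchor y,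
    ∀ g y (e : G.s g = a₁.anchor y), f (a₁.act g y e) = a₂.act g (f y) (e.trans (h y).symm)

/-- A (locally compact, étale) groupoid correspondence `G ← K`: commuting actions of `G` on the
left and `K` on the right, the right action being free and proper with étale anchor map. -/
structure GroupoidCorrespondence (G K : EtaleGroupoid.{u}) where
  Carrier : Type u
  [top : TopologicalSpace Carrier]
  left : LeftAction G Carrier
  right : RightAction K Carrier
  left_anchor_right : ∀ x k e, left.anchor (right.act x k e) = left.anchor x
  right_anchor_left : ∀ g x e, right.anchor (left.act g x e) = right.anchor x
  commute : ∀ g x k (e₁ : G.s g = left.anchor x) (e₂ : right.anchor x = K.r k),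
    right.act (left.act g x e₁) k ((right_anchor_left g x e₁).trans e₂) =
      left.act g (right.act x k e₂) (e₁.trans (left_anchor_right x k e₂).symm)
  free : ∀ x k (e : right.anchor x = K.r k), right.act x k e = x → k = K.one (right.anchor x)
  proper : IsProperMap fun p : FibreProd right.anchor K.r =>
    (p.1.1, right.act p.1.1 p.1.2 p.2)
  etale : IsLocalHomeomorph right.anchor

attribute [instance] GroupoidCorrespondence.top

namespace RightAction

variable {K : EtaleGroupoid.{u}} {Y : Type u} [TopologicalSpace Y] (a : RightAction K Y)

/-- `y` and `y'` belong to the same orbit. -/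
def SameOrbit (y y' : Y) : Prop := ∃ k, ∃ e : a.anchor y = K.r k, a.act y k e = y'

theorem act_congr {y : Y} {k l : K.Arr} (h : k = l) (e : a.anchor y = K.r k) :
    a.act y k e = a.act y l (h ▸ e) := by subst h; rfl

theorem act_act_inv (y : Y) (k : K.Arr) (e : a.anchor y = K.r k) :
    a.act (a.act y k e) (K.inv k) ((a.anchor_act y k e).trans (K.r_inv k).symm) = y := by
  rw [← a.act_mul y k (K.inv k) e (K.r_inv k).symm, a.act_congr (K.mul_inv k)]
  have : K.one (K.r k) = K.one (a.anchor y) := by rw [e]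
  rw [a.act_congr this, a.act_one]

theorem sameOrbit_equivalence : Equivalence a.SameOrbit where
  refl y := ⟨K.one (a.anchor y), (K.r_one _).symm, a.act_one y⟩
  symm := by
    rintro y _ ⟨k, e, rfl⟩
    exact ⟨K.inv k, _, a.act_act_inv y k e⟩
  trans := by
    rintro y _ _ ⟨k, e, rfl⟩ ⟨l, e', rfl⟩
    have h : K.s k = K.r l := (a.anchor_act y k e).symm.trans e'
    exact ⟨K.mul k l h, e.trans (K.r_mul k l h).symm, a.act_mul y k l e h⟩

/-- The orbit equivalence relation. -/
def orbitSetoid : Setoid Y := ⟨a.SameOrbit, a.sameOrbit_equivalence⟩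

/-- The orbit space `Y/K`, with the quotient topology. -/
abbrev Orbits : Type u := Quotient a.orbitSetoid

/-- The orbit space projection. -/
def proj (y : Y) : a.Orbits := Quotient.mk a.orbitSetoid y

end RightAction

namespace GroupoidCorrespondence

variable {G K : EtaleGroupoid.{u}} (X : GroupoidCorrespondence G K)

/-- The map `r_* : X/K → G⁰` induced by the left anchor map. -/
def rStar : X.right.Orbits → G.Obj :=
  Quotient.lift X.left.anchor (by
    rintro x _ ⟨k, e, rfl⟩
    exact (X.left_anchor_right x k e).symm)

/-- `X` is regular on `R`: the map `r_*⁻¹(R) → R` induced by `r_*` is proper and surjective. -/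
def RegularOn (R : Opens G.Obj) : Prop :=
  IsProperMap ((R : Set G.Obj).restrictPreimage X.rStar) ∧
    Function.Surjective ((R : Set G.Obj).restrictPreimage X.rStar)

end GroupoidCorrespondence

/-- A subset of the object space is `G`-invariant. -/
def EtaleGroupoid.IsInvariant (G : EtaleGroupoid.{u}) (R : Set G.Obj) : Prop :=
  ∀ g : G.Arr, G.s g ∈ R ↔ G.r g ∈ R

/-- An action of `(G, X, R)` on a topological space `Y`: an action of `G` together with a
continuous, open map `X ×_{s,G⁰,r} Y → Y`, `(x, y) ↦ x · y`. -/
@[ext]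
structure CorrespondenceAction (G : EtaleGroupoid.{u}) (X : GroupoidCorrespondence G G)
    (R : Opens G.Obj) (Y : Type u) [TopologicalSpace Y] extends LeftAction G Y where
  xact : ∀ (x : X.Carrier) (y : Y), X.right.anchor x = anchor y → Y
  continuous_xact :
    Continuous fun p : FibreProd X.right.anchor anchor => xact p.1.1 p.1.2 p.2
  isOpenMap_xact :
    IsOpenMap fun p : FibreProd X.right.anchor anchor => xact p.1.1 p.1.2 p.2
  anchor_xact : ∀ x y e, anchor (xact x y e) = X.left.anchor x
  act_xact : ∀ g x y (e₁ : G.s g = X.left.anchor x) (e₂ : X.right.anchor x = anchor y),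
    act g (xact x y e₂) (e₁.trans (anchor_xact x y e₂).symm) =
      xact (X.left.act g x e₁) y ((X.right_anchor_left g x e₁).trans e₂)
  /-- `x · y = x' · y'` if and only if there is `g` with `x' = x · g` and `y = g · y'`. -/
  xact_eq_iff : ∀ x x' y y' (e : X.right.anchor x = anchor y) (e' : X.right.anchor x' = anchor y'),
    xact x y e = xact x' y' e' ↔
      ∃ (g : G.Arr) (h₁ : X.right.anchor x = G.r g) (h₂ : G.s g = anchor y'),
        x' = X.right.act x g h₁ ∧ y = act g y' h₂
  covers : ∀ y, anchor y ∈ R → ∃ x y', ∃ e : X.right.anchor x = anchor y', xact x y' e = y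
  isClosed_of_isCompact : ∀ C : Set X.right.Orbits, IsCompact C →
    IsClosed {z : Y | ∃ x y, ∃ e : X.right.anchor x = anchor y,
      X.right.proj x ∈ C ∧ xact x y e = z}

namespace CorrespondenceAction

variable {G : EtaleGroupoid.{u}} {X : GroupoidCorrespondence G G} {R : Opens G.Obj}

/-- The image `X · Y` of the multiplication map. -/
def image {Y : Type u} [TopologicalSpace Y] (a : CorrespondenceAction G X R Y) : Set Y :=
  {z | ∃ x y, ∃ e : X.right.anchor x = a.anchor y, a.xact x y e = z}

/-- `(G, X)`-equivariant maps. -/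
def IsEquivariant {Y₁ Y₂ : Type u} [TopologicalSpace Y₁] [TopologicalSpace Y₂]
    (a₁ : CorrespondenceAction G X R Y₁) (a₂ : CorrespondenceAction G X R Y₂)
    (f : Y₁ → Y₂) : Prop :=
  (∃ h : ∀ y, a₂.anchor (f y) = a₁.anchor y,
    (∀ g y (e : G.s g = a₁.anchor y), f (a₁.act g y e) = a₂.act g (f y) (e.trans (h y).symm)) ∧
    (∀ x y (e : X.right.anchor x = a₁.anchor y),
      f (a₁.xact x y e) = a₂.xact x (f y) (e.trans (h y).symm))) ∧
  f ⁻¹' a₂.image = a₁.image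

end CorrespondenceAction

/-- A groupoid model of `(G, X, R)`: an étale groupoid `M` with a natural bijection between the
`(G, X, R)`-actions and the `M`-actions on all topological spaces. Naturality means that a
continuous map is `(G, X)`-equivariant if and only if it is `M`-equivariant. -/
structure GroupoidModel (G : EtaleGroupoid.{u}) (X : GroupoidCorrespondence G G)
    (R : Opens G.Obj) where
  M : EtaleGroupoid.{u}
  equiv : ∀ (Y : Type u) [TopologicalSpace Y], CorrespondenceAction G X R Y ≃ LeftAction M Y
  natural : ∀ (Y₁ Y₂ : Type u) [TopologicalSpace Y₁] [TopologicalSpace Y₂]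
    (a₁ : CorrespondenceAction G X R Y₁) (a₂ : CorrespondenceAction G X R Y₂) (f : Y₁ → Y₂),
    Continuous f → (a₁.IsEquivariant a₂ f ↔ (equiv Y₁ a₁).IsEquivariant (equiv Y₂ a₂) f)

/-- An actor `M → H`: an action of `M` on the arrow space of `H` that commutes with the right
translation action of `H`. -/
@[ext]
structure Actor (M H : EtaleGroupoid.{u}) extends LeftAction M H.Arr where
  anchor_mul : ∀ h k e, anchor (H.mul h k e) = anchor h
  s_act : ∀ m h e, H.s (act m h e) = H.s h
  act_mul : ∀ m h k (e₁ : M.s m = anchor h) (e₂ : H.s h = H.r k),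
    H.mul (act m h e₁) k ((s_act m h e₁).trans e₂) =
      act m (H.mul h k e₂) (e₁.trans (anchor_mul h k e₂).symm)

/-- The actor is proper if the map `H⁰ ≅ H/H → M⁰` induced by the anchor map `H → M⁰` is proper.
Here an object of `H` corresponds to the orbit of its unit arrow. -/
def Actor.IsProper {M H : EtaleGroupoid.{u}} (a : Actor M H) : Prop :=
  IsProperMap fun ω : H.Obj => a.anchor (H.one ω)

/-! ### Bisections -/

theorem FibreProd.isOpenMap_snd {A B C : Type u} [TopologicalSpace A] [TopologicalSpace B]
    [TopologicalSpace C] {f : A → B} {g : C → B} (hf : IsOpenMap f) (hg : Continuous g) :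
    IsOpenMap fun p : FibreProd f g => p.1.2 := by
  rw [isOpenMap_iff_nhds_le]
  rintro ⟨⟨a, c⟩, h⟩ S hS
  rw [Filter.mem_map, mem_nhds_induced] at hS
  obtain ⟨T, hT, hTS⟩ := hS
  rw [mem_nhds_prod_iff] at hT
  obtain ⟨U, hU, V, hV, hUV⟩ := hT
  have h1 : f '' U ∈ nhds (g c) := by
    have := hf.image_mem_nhds hU
    rwa [show f a = g c from h] at this
  filter_upwards [hg.continuousAt h1, hV] with c' h2 h3
  obtain ⟨a', ha', e⟩ := h2
  exact hTS (a := ⟨(a', c'), e⟩) (hUV ⟨ha', h3⟩)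

namespace EtaleGroupoid

variable (G : EtaleGroupoid.{u})

/-- A bisection of `G`: an open subset on which `r` and `s` are injective. -/
@[ext]
structure Bisection where
  carrier : Set G.Arr
  isOpen : IsOpen carrier
  injOn_r : InjOn G.r carrier
  injOn_s : InjOn G.s carrier

variable {G}

theorem mul_congr {g g' h h' : G.Arr} (e₁ : g = g') (e₂ : h = h') (e : G.s g = G.r h) :
    G.mul g h e = G.mul g' h' (e₁ ▸ e₂ ▸ e) := by subst e₁; subst e₂; rfl

theorem inv_mul_cancel_left (g h : G.Arr) (e : G.s g = G.r h) :
    G.mul (G.inv g) (G.mul g h e) ((G.s_inv g).trans (G.r_mul g h e).symm) = h := by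
  rw [← G.mul_assoc _ _ _ (G.s_inv g) e, mul_congr (G.inv_mul g) rfl]
  rw [mul_congr (g' := G.one (G.r h)) (h' := h) (by rw [e]) rfl, G.one_mul]

theorem mul_inv_cancel_left (g h : G.Arr) (e : G.r g = G.r h) :
    G.mul g (G.mul (G.inv g) h ((G.s_inv g).trans e))
      ((G.r_inv g).symm.trans (G.r_mul _ _ _).symm) = h := by
  rw [← G.mul_assoc _ _ _ (G.r_inv g).symm ((G.s_inv g).trans e), mul_congr (G.mul_inv g) rfl]
  rw [mul_congr (g' := G.one (G.r h)) (h' := h) (by rw [e]) rfl, G.one_mul]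

theorem inv_inv (g : G.Arr) : G.inv (G.inv g) = g := by
  have h := inv_mul_cancel_left (G.inv g) g (G.s_inv g)
  rw [mul_congr rfl (G.inv_mul g)] at h
  rw [mul_congr (g' := G.inv (G.inv g)) (h' := G.one (G.s (G.inv (G.inv g)))) rfl
    (by rw [G.s_inv, G.r_inv]), G.mul_one] at h
  exact h

theorem isOpenMap_one (G : EtaleGroupoid.{u}) : IsOpenMap G.one := by
  have h : IsLocalHomeomorph (G.s ∘ G.one) := by
    have : G.s ∘ G.one = id := funext G.s_one
    rw [this]
    exact (Homeomorph.refl _).isLocalHomeomorph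
  exact (h.of_comp G.isLocalHomeomorph_s G.continuous_one).isOpenMap

namespace Bisection

/-- An open subset `U` of `G⁰`, viewed as a bisection consisting of unit arrows. -/
def unit (U : Opens G.Obj) : G.Bisection where
  carrier := G.one '' U
  isOpen := G.isOpenMap_one _ U.isOpen
  injOn_r := by
    rintro _ ⟨x, _, rfl⟩ _ ⟨y, _, rfl⟩ h
    rw [G.r_one, G.r_one] at h
    rw [h]
  injOn_s := by
    rintro _ ⟨x, _, rfl⟩ _ ⟨y, _, rfl⟩ h
    rw [G.s_one, G.s_one] at h
    rw [h]

/-- The inverse bisection `V* = {g⁻¹ | g ∈ V}`. -/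
def inv (V : G.Bisection) : G.Bisection where
  carrier := {g | G.inv g ∈ V.carrier}
  isOpen := V.isOpen.preimage G.continuous_inv
  injOn_r g hg g' hg' h := by
    have := V.injOn_s hg hg' (by rw [G.s_inv, G.s_inv, h])
    rw [← G.inv_inv g, this, G.inv_inv]
  injOn_s g hg g' hg' h := by
    have := V.injOn_r hg hg' (by rw [G.r_inv, G.r_inv, h])
    rw [← G.inv_inv g, this, G.inv_inv]

/-- The product bisection `V W = {g h | g ∈ V, h ∈ W, s g = r h}`. -/
def mul (V W : G.Bisection) : G.Bisection where
  carrier := {k | ∃ g h, ∃ e : G.s g = G.r h, g ∈ V.carrier ∧ h ∈ W.carrier ∧ G.mul g h e = k}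
  isOpen := by
    let f : FibreProd G.r G.r → G.Arr := fun p =>
      G.mul (G.inv p.1.1) p.1.2 ((G.s_inv _).trans p.2)
    have hf : Continuous f := G.continuous_mul.comp (Continuous.subtype_mk
      ((G.continuous_inv.comp (continuous_fst.comp continuous_subtype_val)).prodMk
        (continuous_snd.comp continuous_subtype_val)) fun p => (G.s_inv _).trans p.2)
    have hO : IsOpen ({p : FibreProd G.r G.r | p.1.1 ∈ V.carrier} ∩ f ⁻¹' W.carrier) :=
      (V.isOpen.preimage (continuous_fst.comp continuous_subtype_val)).inter (W.isOpen.preimage hf)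
    convert FibreProd.isOpenMap_snd G.isLocalHomeomorph_r.isOpenMap
      G.isLocalHomeomorph_r.continuous _ hO using 1
    ext k
    constructor
    · rintro ⟨g, h, e, hg, hh, rfl⟩
      refine ⟨⟨(g, G.mul g h e), (G.r_mul g h e).symm⟩, ⟨hg, ?_⟩, rfl⟩
      change G.mul (G.inv g) (G.mul g h e) _ ∈ W.carrier
      rw [G.inv_mul_cancel_left g h e]
      exact hh
    · rintro ⟨⟨⟨g, k⟩, e⟩, ⟨hg, hh⟩, rfl⟩
      exact ⟨g, _, _, hg, hh, G.mul_inv_cancel_left g k e⟩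
  injOn_r := by
    rintro _ ⟨g, h, e, hg, hh, rfl⟩ _ ⟨g', h', e', hg', hh', rfl⟩ H
    rw [G.r_mul, G.r_mul] at H
    obtain rfl := V.injOn_r hg hg' H
    obtain rfl := W.injOn_r hh hh' (e.symm.trans e')
    rfl
  injOn_s := by
    rintro _ ⟨g, h, e, hg, hh, rfl⟩ _ ⟨g', h', e', hg', hh', rfl⟩ H
    rw [G.s_mul, G.s_mul] at H
    obtain rfl := W.injOn_s hh hh' H
    obtain rfl := V.injOn_s hg hg' (e.trans e'.symm)
    rfl

end Bisection

end EtaleGroupoid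

theorem LeftAction.act_congr {G : EtaleGroupoid.{u}} {Y : Type u} [TopologicalSpace Y]
    (a : LeftAction G Y) {g g' : G.Arr} {y y' : Y} (h : g = g') (h' : y = y')
    (e : G.s g = a.anchor y) : a.act g y e = a.act g' y' (h ▸ h' ▸ e) := by
  subst h; subst h'; rfl

namespace LeftAction

variable {G : EtaleGroupoid.{u}} {Y : Type u} [TopologicalSpace Y] (a : LeftAction G Y)

theorem inv_act_act (g : G.Arr) (y : Y) (e : G.s g = a.anchor y) :
    a.act (G.inv g) (a.act g y e) ((G.s_inv g).trans (a.anchor_act g y e).symm) = y := by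
  rw [← a.mul_act _ _ _ (G.s_inv g) e, a.act_congr (G.inv_mul g) rfl]
  rw [a.act_congr (g' := G.one (a.anchor y)) (y' := y) (by rw [e]) rfl, a.one_act]

theorem act_inv_act (g : G.Arr) (y : Y) (e : G.r g = a.anchor y) :
    a.act g (a.act (G.inv g) y ((G.s_inv g).trans e))
      ((G.r_inv g).symm.trans (a.anchor_act _ _ _).symm) = y := by
  rw [← a.mul_act _ _ _ (G.r_inv g).symm ((G.s_inv g).trans e), a.act_congr (G.mul_inv g) rfl]
  rw [a.act_congr (g' := G.one (a.anchor y)) (y' := y) (by rw [e]) rfl, a.one_act]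

end LeftAction

namespace GroupoidCorrespondence

variable {G K : EtaleGroupoid.{u}} (X : GroupoidCorrespondence G K)

theorem act_cancel {x : X.Carrier} {k l : K.Arr} (e : X.right.anchor x = K.r k)
    (e' : X.right.anchor x = K.r l) (h : X.right.act x k e = X.right.act x l e') : k = l := by
  have hs : K.s l = K.s k := by
    rw [← X.right.anchor_act x k e, ← X.right.anchor_act x l e', h]
  have hs' : K.s l = K.r (K.inv k) := hs.trans (K.r_inv k).symm
  have h1 : X.right.act x (K.mul l (K.inv k) hs') (e'.trans (K.r_mul _ _ _).symm) = x := by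
    rw [X.right.act_mul x l (K.inv k) e' hs']
    have h2 := X.right.act_act_inv x k e
    simp only [h] at h2
    exact h2
  have h3 := X.free _ _ _ h1
  have h4 := EtaleGroupoid.mul_inv_cancel_left l k (e'.symm.trans e)
  have h5 : K.mul (K.mul l (K.inv k) hs') k ((K.s_mul _ _ _).trans (K.s_inv k)) = l := by
    rw [K.mul_assoc l (K.inv k) k hs' (K.s_inv k), EtaleGroupoid.mul_congr rfl (K.inv_mul k),
      EtaleGroupoid.mul_congr (g' := l) (h' := K.one (K.s l)) rfl (by rw [hs]), K.mul_one]
  rw [EtaleGroupoid.mul_congr h3 rfl,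
    EtaleGroupoid.mul_congr (g' := K.one (K.r k)) (h' := k) (by rw [e]) rfl, K.one_mul] at h5
  exact h5

/-- A bisection of `X`: an open subset on which the right anchor map `s` and the orbit space
projection `X → X/K` are injective. -/
@[ext]
structure Bisection where
  carrier : Set X.Carrier
  isOpen : IsOpen carrier
  injOn_s : InjOn X.right.anchor carrier
  injOn_proj : InjOn X.right.proj carrier

variable {X}

theorem proj_eq_iff {x y : X.Carrier} :
    X.right.proj x = X.right.proj y ↔ X.right.SameOrbit x y := Quotient.eq

namespace Bisection

/-- The bisection `V W = {g x | g ∈ V, x ∈ W, s g = r x}` of `X` for `V` in `G`, `W` in `X`. -/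
def leftMul (V : G.Bisection) (W : X.Bisection) : X.Bisection where
  carrier := {z | ∃ g x, ∃ e : G.s g = X.left.anchor x,
    g ∈ V.carrier ∧ x ∈ W.carrier ∧ X.left.act g x e = z}
  isOpen := by
    let f : FibreProd G.r X.left.anchor → X.Carrier := fun p =>
      X.left.act (G.inv p.1.1) p.1.2 ((G.s_inv _).trans p.2)
    have hf : Continuous f := X.left.continuous_act.comp (Continuous.subtype_mk
      ((G.continuous_inv.comp (continuous_fst.comp continuous_subtype_val)).prodMk
        (continuous_snd.comp continuous_subtype_val)) fun p => (G.s_inv _).trans p.2)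
    have hO : IsOpen ({p : FibreProd G.r X.left.anchor | p.1.1 ∈ V.carrier} ∩ f ⁻¹' W.carrier) :=
      (V.isOpen.preimage (continuous_fst.comp continuous_subtype_val)).inter (W.isOpen.preimage hf)
    convert FibreProd.isOpenMap_snd G.isLocalHomeomorph_r.isOpenMap
      X.left.continuous_anchor _ hO using 1
    ext k
    constructor
    · rintro ⟨g, h, e, hg, hh, rfl⟩
      refine ⟨⟨(g, X.left.act g h e), (X.left.anchor_act g h e).symm⟩, ⟨hg, ?_⟩, rfl⟩
      change X.left.act (G.inv g) (X.left.act g h e) _ ∈ W.carrier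
      rw [X.left.inv_act_act g h e]
      exact hh
    · rintro ⟨⟨⟨g, k⟩, e⟩, ⟨hg, hh⟩, rfl⟩
      exact ⟨g, _, _, hg, hh, X.left.act_inv_act g k e⟩
  injOn_s := by
    rintro _ ⟨g, h, e, hg, hh, rfl⟩ _ ⟨g', h', e', hg', hh', rfl⟩ H
    rw [X.right_anchor_left, X.right_anchor_left] at H
    obtain rfl := W.injOn_s hh hh' H
    obtain rfl := V.injOn_s hg hg' (e.trans e'.symm)
    rfl
  injOn_proj := by
    rintro _ ⟨g, h, e, hg, hh, rfl⟩ _ ⟨g', h', e', hg', hh', rfl⟩ H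
    rw [proj_eq_iff] at H
    obtain ⟨k, e₁, H⟩ := H
    have ek : X.right.anchor h = K.r k := (X.right_anchor_left g h e).symm.trans e₁
    rw [X.commute g h k e ek] at H
    have hr := congrArg X.left.anchor H
    rw [X.left.anchor_act, X.left.anchor_act] at hr
    obtain rfl := V.injOn_r hg hg' hr
    have H' : X.right.act h k ek = h' := by
      rw [← X.left.inv_act_act g (X.right.act h k ek) (e.trans (X.left_anchor_right h k ek).symm),
        X.left.act_congr rfl H, X.left.inv_act_act]
    obtain rfl := W.injOn_proj hh hh' (proj_eq_iff.2 ⟨k, ek, H'⟩)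
    rfl

/-- The bisection `V W = {x k | x ∈ V, k ∈ W, s x = r k}` of `X` for `V` in `X`, `W` in `K`. -/
def rightMul (V : X.Bisection) (W : K.Bisection) : X.Bisection where
  carrier := {z | ∃ x k, ∃ e : X.right.anchor x = K.r k,
    x ∈ V.carrier ∧ k ∈ W.carrier ∧ X.right.act x k e = z}
  isOpen := by
    let f : FibreProd K.s X.right.anchor → X.Carrier := fun p =>
      X.right.act p.1.2 (K.inv p.1.1) (p.2.symm.trans (K.r_inv _).symm)
    have hf : Continuous f := X.right.continuous_act.comp (Continuous.subtype_mk
      ((continuous_snd.comp continuous_subtype_val).prodMk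
        (K.continuous_inv.comp (continuous_fst.comp continuous_subtype_val)))
          fun p => p.2.symm.trans (K.r_inv _).symm)
    have hO : IsOpen ({p : FibreProd K.s X.right.anchor | p.1.1 ∈ W.carrier} ∩ f ⁻¹' V.carrier) :=
      (W.isOpen.preimage (continuous_fst.comp continuous_subtype_val)).inter (V.isOpen.preimage hf)
    convert FibreProd.isOpenMap_snd K.isLocalHomeomorph_s.isOpenMap
      X.right.continuous_anchor _ hO using 1
    ext z
    constructor
    · rintro ⟨x, k, e, hx, hk, rfl⟩
      refine ⟨⟨(k, X.right.act x k e), (X.right.anchor_act x k e).symm⟩, ⟨hk, ?_⟩, rfl⟩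
      change X.right.act (X.right.act x k e) (K.inv k) _ ∈ V.carrier
      rw [X.right.act_act_inv x k e]
      exact hx
    · rintro ⟨⟨⟨k, z⟩, e⟩, ⟨hk, hx⟩, rfl⟩
      have e₁ : X.right.anchor z = K.r (K.inv k) := e.symm.trans (K.r_inv k).symm
      refine ⟨_, k, (X.right.anchor_act z (K.inv k) e₁).trans (K.s_inv k), hx, hk, ?_⟩
      have h := X.right.act_act_inv z (K.inv k) e₁
      rw [X.right.act_congr (K.inv_inv k)] at h
      exact h
  injOn_s := by
    rintro _ ⟨x, k, e, hx, hk, rfl⟩ _ ⟨x', k', e', hx', hk', rfl⟩ H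
    rw [X.right.anchor_act, X.right.anchor_act] at H
    obtain rfl := W.injOn_s hk hk' H
    obtain rfl := V.injOn_s hx hx' (e.trans e'.symm)
    rfl
  injOn_proj := by
    rintro _ ⟨x, k, e, hx, hk, rfl⟩ _ ⟨x', k', e', hx', hk', rfl⟩ H
    have h1 : X.right.proj x = X.right.proj (X.right.act x k e) := proj_eq_iff.2 ⟨k, e, rfl⟩
    have h2 : X.right.proj x' = X.right.proj (X.right.act x' k' e') := proj_eq_iff.2 ⟨k', e', rfl⟩
    obtain rfl := V.injOn_proj hx hx' ((h1.trans H).trans h2.symm)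
    obtain rfl := W.injOn_r hk hk' (e.symm.trans e')
    rfl

/-- The bisection `⟨V | W⟩` of `K` for bisections `V`, `W` of `X`. It consists of all
`⟨x | y⟩` with `x ∈ V` and `y ∈ W` in the same orbit, where `⟨x | y⟩` is the unique arrow `k`
with `x · k = y`. -/
def bracket (V W : X.Bisection) : K.Bisection where
  carrier := {k | ∃ x ∈ V.carrier, ∃ y ∈ W.carrier, ∃ e : X.right.anchor x = K.r k,
    X.right.act x k e = y}
  isOpen := by
    let f : FibreProd X.right.anchor K.r → X.Carrier := fun p => X.right.act p.1.1 p.1.2 p.2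
    have hO : IsOpen ({p : FibreProd X.right.anchor K.r | p.1.1 ∈ V.carrier} ∩ f ⁻¹' W.carrier) :=
      (V.isOpen.preimage (continuous_fst.comp continuous_subtype_val)).inter
        (W.isOpen.preimage X.right.continuous_act)
    convert FibreProd.isOpenMap_snd X.etale.isOpenMap K.isLocalHomeomorph_r.continuous _ hO using 1
    ext k
    constructor
    · rintro ⟨x, hx, _, hy, e, rfl⟩
      exact ⟨⟨(x, k), e⟩, ⟨hx, hy⟩, rfl⟩
    · rintro ⟨⟨⟨x, k⟩, e⟩, ⟨hx, hy⟩, rfl⟩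
      exact ⟨x, hx, _, hy, e, rfl⟩
  injOn_r := by
    rintro k ⟨x, hx, _, hy, e, rfl⟩ k' ⟨x', hx', _, hy', e', rfl⟩ H
    obtain rfl := V.injOn_s hx hx' ((e.trans H).trans e'.symm)
    have h1 : X.right.proj x = X.right.proj (X.right.act x k e) := proj_eq_iff.2 ⟨k, e, rfl⟩
    have h2 : X.right.proj x = X.right.proj (X.right.act x k' e') := proj_eq_iff.2 ⟨k', e', rfl⟩
    exact X.act_cancel e e' (W.injOn_proj hy hy' (h1.symm.trans h2))
  injOn_s := by
    rintro k ⟨x, hx, _, hy, e, rfl⟩ k' ⟨x', hx', _, hy', e', rfl⟩ H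
    have h0 := W.injOn_s hy hy' (by rw [X.right.anchor_act, X.right.anchor_act, H])
    have h1 : X.right.proj x = X.right.proj (X.right.act x k e) := proj_eq_iff.2 ⟨k, e, rfl⟩
    have h2 : X.right.proj x' = X.right.proj (X.right.act x' k' e') := proj_eq_iff.2 ⟨k', e', rfl⟩
    rw [h0] at h1
    obtain rfl := V.injOn_proj hx hx' (h1.trans h2.symm)
    exact X.act_cancel e e' h0

end Bisection

end GroupoidCorrespondence

/-! ### Maps on bisections -/

section

open GroupoidCorrespondence.Bisection EtaleGroupoid.Bisection

/-- Maps `ϑ` that send bisections of `G` and of `X` to bisections of `H`. -/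
abbrev BisectionMap (G : EtaleGroupoid.{u}) (X : GroupoidCorrespondence G G)
    (H : EtaleGroupoid.{u}) : Type u :=
  G.Bisection ⊕ X.Bisection → H.Bisection

namespace BisectionMap

variable {G : EtaleGroupoid.{u}} {X : GroupoidCorrespondence G G} {H : EtaleGroupoid.{u}}

/-- The first five conditions on the map `ϑ`. -/
structure IsMultiplicativeCovering (R : Opens G.Obj) (ϑ : BisectionMap G X H) : Prop where
  mul_GG : ∀ V W : G.Bisection, (ϑ (.inl V)).mul (ϑ (.inl W)) = ϑ (.inl (V.mul W))
  mul_GX : ∀ (V : G.Bisection) (W : X.Bisection),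
    (ϑ (.inl V)).mul (ϑ (.inr W)) = ϑ (.inr (leftMul V W))
  mul_XG : ∀ (V : X.Bisection) (W : G.Bisection),
    (ϑ (.inr V)).mul (ϑ (.inl W)) = ϑ (.inr (rightMul V W))
  bracket : ∀ V W : X.Bisection, (ϑ (.inr V)).inv.mul (ϑ (.inr W)) = ϑ (.inl (bracket V W))
  map_units : ϑ (.inl (unit ⊤)) = unit ⊤
  map_union : ∀ S : Set (Opens G.Obj),
    (ϑ (.inl (unit (sSup S)))).carrier = ⋃ U ∈ S, (ϑ (.inl (unit U))).carrier
  covering : H.r '' (ϑ (.inl (unit R))).carrier ⊆ ⋃ U : X.Bisection, H.r '' (ϑ (.inr U)).carrier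

/-- The closure condition on the map `ϑ`: if `U` is a bisection of `X` that is precompact (that
is, contained in a compact subset of the possibly non-Hausdorff space `X`), then the closure of
`r(ϑ_U)` is contained in the union of all `r(ϑ_W)`. -/
def ClosureCondition (ϑ : BisectionMap G X H) : Prop :=
  ∀ U : X.Bisection, (∃ C : Set X.Carrier, IsCompact C ∧ U.carrier ⊆ C) →
    closure (H.r '' (ϑ (.inr U)).carrier) ⊆ ⋃ W : X.Bisection, H.r '' (ϑ (.inr W)).carrier

/-- `ϑ` describes the `(G, X, R)`-action `c` on the arrow space of `H`: for each bisection `V` of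
`G` or `X`, left multiplication by the bisection `ϑ_V` of `H` is the partial map
`h ↦ v · h` with `v ∈ V`, `s(v) = anchor(h)`. -/
def Describes {R : Opens G.Obj} (ϑ : BisectionMap G X H)
    (c : CorrespondenceAction G X R H.Arr) : Prop :=
  (∀ (V : G.Bisection) (h k : H.Arr),
    (∃ t ∈ (ϑ (.inl V)).carrier, ∃ e : H.s t = H.r h, H.mul t h e = k) ↔
      ∃ g ∈ V.carrier, ∃ e : G.s g = c.anchor h, c.act g h e = k) ∧
  (∀ (V : X.Bisection) (h k : H.Arr),
    (∃ t ∈ (ϑ (.inr V)).carrier, ∃ e : H.s t = H.r h, H.mul t h e = k) ↔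
      ∃ x ∈ V.carrier, ∃ e : X.right.anchor x = c.anchor h, c.xact x h e = k)

/-- The map `ϱ : H⁰ → G⁰` is dual to the restriction of `ϑ` to open subsets of `G⁰`:
`ϑ_U = ϱ⁻¹(U)` as sets of unit arrows of `H`. -/
def HasBaseMap (ϑ : BisectionMap G X H) (ρ : C(H.Obj, G.Obj)) : Prop :=
  ∀ U : Opens G.Obj, ϑ (.inl (unit U)) = unit (U.comap ρ)

end BisectionMap

end

/-- The `(G, X, R)`-action on the arrow space of `H` that corresponds to an actor `M → H` out of
the groupoid model `M`. -/
def GroupoidModel.actionOfActor {G : EtaleGroupoid.{u}} {X : GroupoidCorrespondence G G}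
    {R : Opens G.Obj} (m : GroupoidModel G X R) {H : EtaleGroupoid.{u}} (a : Actor m.M H) :
    CorrespondenceAction G X R H.Arr :=
  (m.equiv H.Arr).symm a.toLeftAction

/-!
An actor `M → H` is an action of the model `M` on the arrow space of `H` that commutes with right
translations. By the universal property of `M`, it is the same as a `(G, X, R)`-action on the
arrow space of `H` that commutes with right translations
(`GroupoidModel.isTranslationInvariant_iff`). Naturality of the model speaks only about
equivariant maps, but a continuous map is invariant if and only if its graph is equivariant. So
`s : H → H⁰` is invariant for both actions or for neither. Commuting with right translations means
that the multiplication map is equivariant for the action on the first factor of `H ×_{s,r} H`.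

A translation invariant action is described by bisections: `v · h = (v · 1_{r(h)}) h`, and the
arrows `v · 1_ω` for `v ∈ V` form the bisection `ϑ_V`
(`CorrespondenceAction.IsTranslationInvariant.bisectionMap`). Conversely, the conditions on `ϑ`
give the base map `ϱ : H⁰ → G⁰`, because the restriction of `ϑ` to open subsets preserves finite
intersections and arbitrary unions and `G⁰` is Hausdorff
(`BisectionMap.IsMultiplicativeCovering.existsUnique_baseMap`). They also show that the arrow `t`
in `ϑ_V` with source `ω` depends only on `ω` and on the point `v ∈ V` with `s(v) = ϱ(ω)`
(`IsBisectionAssignment`), so that `v · h = t h` defines an action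
(`BisectionMap.IsMultiplicativeCovering.action`). The closure condition gives that `C · H` is
closed for compact `C ⊆ X/G` because `X/G` is Hausdorff
(`GroupoidCorrespondence.isClosed_of_closure_subset`).

For properness, the map `ϱ` is the composite of the map `H⁰ → M⁰` induced by the actor and the
anchor map `M⁰ → G⁰` of the universal `(G, X, R)`-action. It remains to prove that the latter is
proper if `X` is regular on `R` (`GroupoidModel.isProperMap_universalAction_anchor`). Let `Ŷ` be
the space of ultrafilters on the set `M⁰` along which the anchor map to `G⁰` converges, with the
Stone topology. Its anchor map, the limit, is proper. Bisections act on ultrafilters by taking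
images, and this gives a `(G, X, R)`-action on `Ŷ`
(`CorrespondenceAction.ConvUltrafilter.action`), where regularity is needed for `r⁻¹(R) ⊆ X · Ŷ`.
The universal property gives a map `Ŷ → M⁰` over `G⁰`. The set `M⁰` with the discrete topology
also carries a `(G, X, R)`-action because `G` and `X` are étale, and its maps to `Ŷ` by principal
ultrafilters and to `M⁰` by the identity are equivariant. Hence `Ŷ → M⁰` maps principal
ultrafilters to their points, so it is surjective, and `M⁰ → G⁰` is proper.
-/

/-! ### Local homeomorphisms -/

namespace IsLocalHomeomorph

theorem exists_isOpen_injOn {A B : Type*} [TopologicalSpace A] [TopologicalSpace B] {f : A → B}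
    (hf : IsLocalHomeomorph f) {x : A} {N : Set A} (hN : N ∈ nhds x) :
    ∃ V ⊆ N, IsOpen V ∧ x ∈ V ∧ InjOn f V := by
  obtain ⟨e, hx, rfl⟩ := hf x
  obtain ⟨T, hT, hTo, hxT⟩ := mem_nhds_iff.1 hN
  exact ⟨e.source ∩ T, fun y hy => hT hy.2, e.open_source.inter hTo, ⟨hx, hxT⟩,
    e.injOn.mono inter_subset_left⟩

theorem exists_isCompact_mem_nhds {A B : Type*} [TopologicalSpace A] [TopologicalSpace B]
    [LocallyCompactSpace B] {f : A → B} (hf : IsLocalHomeomorph f) {x : A} {N : Set A}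
    (hN : N ∈ nhds x) : ∃ C ⊆ N, IsCompact C ∧ C ∈ nhds x := by
  obtain ⟨e, hx, rfl⟩ := hf x
  have h1 : e.target ∩ e.symm ⁻¹' N ∈ nhds (e x) :=
    Filter.inter_mem (e.open_target.mem_nhds (e.map_source hx))
      ((e.tendsto_symm hx) hN)
  obtain ⟨K, hK, hKs, hKc⟩ := local_compact_nhds h1
  refine ⟨e.symm '' K, ?_, hKc.image_of_continuousOn
    (e.continuousOn_symm.mono fun y hy => (hKs hy).1), ?_⟩
  · rintro _ ⟨y, hy, rfl⟩
    exact (hKs hy).2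
  · filter_upwards [e.open_source.mem_nhds hx, e.continuousAt hx hK] with y hy hy'
    exact ⟨e y, hy', e.left_inv hy⟩

end IsLocalHomeomorph

/-! ### Bisections and orbit spaces -/

namespace EtaleGroupoid

variable (G : EtaleGroupoid.{u})

theorem exists_bisection {g : G.Arr} {N : Set G.Arr} (hN : N ∈ nhds g) :
    ∃ V : G.Bisection, g ∈ V.carrier ∧ V.carrier ⊆ N := by
  obtain ⟨V, hVN, hVo, hgV, hVi⟩ := G.isLocalHomeomorph_s.exists_isOpen_injOn hN
  obtain ⟨W, hWV, hWo, hgW, hWi⟩ :=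
    G.isLocalHomeomorph_r.exists_isOpen_injOn (hVo.mem_nhds hgV)
  exact ⟨⟨W, hWo, hWi, hVi.mono hWV⟩, hgW, hWV.trans hVN⟩

theorem exists_bisection_mem (g : G.Arr) : ∃ V : G.Bisection, g ∈ V.carrier :=
  (G.exists_bisection Filter.univ_mem).imp fun _ h => h.1

variable {G}

theorem mul_inv_cancel_right (g h : G.Arr) (e : G.s g = G.r h) :
    G.mul (G.mul g h e) (G.inv h) ((G.s_mul g h e).trans (G.r_inv h).symm) = g := by
  rw [G.mul_assoc _ _ _ e (G.r_inv h).symm, mul_congr rfl (G.mul_inv h)]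
  rw [mul_congr (g' := g) (h' := G.one (G.s g)) rfl (by rw [e]), G.mul_one]

theorem one_mul' (ω : G.Obj) (h : G.Arr) (e : G.s (G.one ω) = G.r h) :
    G.mul (G.one ω) h e = h := by
  have : ω = G.r h := (G.s_one ω).symm.trans e
  subst this
  exact G.one_mul h

theorem mul_one' (ω : G.Obj) (h : G.Arr) (e : G.s h = G.r (G.one ω)) :
    G.mul h (G.one ω) e = h := by
  have : ω = G.s h := (G.r_one ω).symm.trans e.symm
  subst this
  exact G.mul_one h

end EtaleGroupoid

theorem RightAction.act_one' {K : EtaleGroupoid.{u}} {Y : Type u} [TopologicalSpace Y]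
    (a : RightAction K Y) (y : Y) (ω : K.Obj) (e : a.anchor y = K.r (K.one ω)) :
    a.act y (K.one ω) e = y := by
  have : ω = a.anchor y := (K.r_one ω).symm.trans e.symm
  subst this
  exact a.act_one y

theorem LeftAction.one_act' {K : EtaleGroupoid.{u}} {Y : Type u} [TopologicalSpace Y]
    (a : LeftAction K Y) (y : Y) (ω : K.Obj) (e : K.s (K.one ω) = a.anchor y) :
    a.act (K.one ω) y e = y := by
  have : ω = a.anchor y := (K.s_one ω).symm.trans e
  subst this
  exact a.one_act y

theorem LeftAction.act_left_cancel {K : EtaleGroupoid.{u}} {Y : Type u} [TopologicalSpace Y]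
    (a : LeftAction K Y) {g : K.Arr} {y y' : Y} (e : K.s g = a.anchor y)
    (e' : K.s g = a.anchor y') (h : a.act g y e = a.act g y' e') : y = y' := by
  rw [← a.inv_act_act g y e, ← a.inv_act_act g y' e']
  exact a.act_congr rfl h _

namespace GroupoidCorrespondence

variable {G K : EtaleGroupoid.{u}} (X : GroupoidCorrespondence G K)

theorem act_injective : Function.Injective
    fun p : FibreProd X.right.anchor K.r => (p.1.1, X.right.act p.1.1 p.1.2 p.2) := by
  rintro ⟨⟨x, k⟩, e⟩ ⟨⟨y, l⟩, e'⟩ h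
  simp only [Prod.mk.injEq] at h
  obtain ⟨rfl, h⟩ := h
  obtain rfl := X.act_cancel e e' h
  rfl

/-- The orbit space projection is locally injective: the proper injective map
`(x, k) ↦ (x, x k)` is an embedding and the units are open in `K`, so `x k` can only be close
to `x` if `k` is a unit. -/
theorem exists_injOn_proj (x : X.Carrier) : ∃ N ∈ nhds x, InjOn X.right.proj N := by
  have hemb := Topology.IsClosedEmbedding.of_continuous_injective_isClosedMap
    X.proper.continuous X.act_injective X.proper.isClosedMap
  have hO : IsOpen {p : FibreProd X.right.anchor K.r | p.1.2 ∈ range K.one} :=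
    (K.isOpenMap_one.isOpen_range).preimage (continuous_snd.comp continuous_subtype_val)
  obtain ⟨T, hT, hTO⟩ := hemb.isInducing.isOpen_iff.1 hO
  have hxT : (x, x) ∈ T := by
    have : (⟨(x, K.one (X.right.anchor x)), (K.r_one _).symm⟩ : FibreProd X.right.anchor K.r) ∈
        {p : FibreProd X.right.anchor K.r | p.1.2 ∈ range K.one} := ⟨_, rfl⟩
    rw [← hTO, mem_preimage] at this
    rwa [X.right.act_one] at this
  obtain ⟨U, hU, V, hV, hUV⟩ := mem_nhds_prod_iff.1 (hT.mem_nhds hxT)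
  refine ⟨U ∩ V, Filter.inter_mem hU hV, fun y hy z hz h => ?_⟩
  obtain ⟨k, e, rfl⟩ := proj_eq_iff.1 h
  have hm : (⟨(y, k), e⟩ : FibreProd X.right.anchor K.r) ∈
      {p : FibreProd X.right.anchor K.r | p.1.2 ∈ range K.one} := by
    rw [← hTO]
    exact hUV ⟨hy.1, hz.2⟩
  obtain ⟨ω, hω : K.one ω = k⟩ := hm
  subst hω
  exact (X.right.act_one' _ _ _).symm

theorem exists_bisection {x : X.Carrier} {N : Set X.Carrier} (hN : N ∈ nhds x) :
    ∃ V : X.Bisection, x ∈ V.carrier ∧ V.carrier ⊆ N := by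
  obtain ⟨N', hN', hi⟩ := X.exists_injOn_proj x
  obtain ⟨V, hVN, hVo, hxV, hVi⟩ := X.etale.exists_isOpen_injOn (Filter.inter_mem hN hN')
  exact ⟨⟨V, hVo, hVi, hi.mono (hVN.trans inter_subset_right)⟩, hxV,
    hVN.trans inter_subset_left⟩

theorem exists_bisection_mem (x : X.Carrier) : ∃ V : X.Bisection, x ∈ V.carrier :=
  (X.exists_bisection Filter.univ_mem).imp fun _ h => h.1

theorem continuous_proj : Continuous X.right.proj := continuous_quotient_mk'

theorem isOpenMap_proj : IsOpenMap X.right.proj := by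
  intro U hU
  change IsOpen (X.right.proj ⁻¹' (X.right.proj '' U))
  let f : FibreProd K.s X.right.anchor → X.Carrier := fun p =>
    X.right.act p.1.2 (K.inv p.1.1) (p.2.symm.trans (K.r_inv _).symm)
  have hf : Continuous f := X.right.continuous_act.comp (Continuous.subtype_mk
    ((continuous_snd.comp continuous_subtype_val).prodMk
      (K.continuous_inv.comp (continuous_fst.comp continuous_subtype_val)))
        fun p => p.2.symm.trans (K.r_inv _).symm)
  convert FibreProd.isOpenMap_snd K.isLocalHomeomorph_s.isOpenMap
    X.right.continuous_anchor _ (hU.preimage hf) using 1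
  ext z
  constructor
  · rintro ⟨x, hx, h⟩
    obtain ⟨k, e, rfl⟩ := proj_eq_iff.1 h
    refine ⟨⟨(k, X.right.act x k e), (X.right.anchor_act x k e).symm⟩, ?_, rfl⟩
    change X.right.act (X.right.act x k e) (K.inv k) _ ∈ U
    rwa [X.right.act_act_inv x k e]
  · rintro ⟨⟨⟨k, z⟩, e⟩, h, rfl⟩
    exact ⟨_, h, (proj_eq_iff.2 ⟨K.inv k, e.symm.trans (K.r_inv _).symm, rfl⟩).symm⟩

theorem isOpenQuotientMap_proj : IsOpenQuotientMap X.right.proj :=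
  ⟨Quotient.mk_surjective, X.continuous_proj, X.isOpenMap_proj⟩

/-- The orbit relation is the image of the proper map `(x, k) ↦ (x, x k)` and hence closed. -/
instance t2Space_orbits : T2Space X.right.Orbits := by
  rw [t2Space_iff_of_isOpenQuotientMap X.isOpenQuotientMap_proj]
  convert X.proper.isClosedMap.isClosed_range using 1
  ext ⟨x, y⟩
  constructor
  · intro h
    obtain ⟨k, e, h⟩ := proj_eq_iff.1 h
    exact ⟨⟨(x, k), e⟩, Prod.ext rfl h⟩
  · rintro ⟨⟨⟨x', k⟩, e⟩, h⟩
    simp only [Prod.mk.injEq] at h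
    obtain ⟨rfl, rfl⟩ := h
    exact proj_eq_iff.2 ⟨k, e, rfl⟩

/-- Each compact set of orbits is covered by the images of finitely many open sets taken from a
family that contains a neighbourhood of every point. -/
theorem exists_finite_cover {P : Set X.Carrier → Prop} (hP : ∀ x, ∃ V ∈ nhds x, P V)
    {C : Set X.right.Orbits} (hC : IsCompact C) :
    ∃ F : Set (Set X.Carrier), F.Finite ∧ (∀ V ∈ F, P V) ∧
      C ⊆ ⋃ V ∈ F, X.right.proj '' V := by
  choose V hV hPV using hP
  obtain ⟨t, ht⟩ := hC.elim_nhds_subcover' (fun z _ => X.right.proj '' V z.out) fun z _ => by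
    have := X.isOpenMap_proj.image_mem_nhds (hV z.out)
    rwa [show X.right.proj z.out = z from Quotient.out_eq z] at this
  refine ⟨(fun z : C => V z.1.out) '' t, t.finite_toSet.image _, ?_, ?_⟩
  · rintro _ ⟨z, _, rfl⟩
    exact hPV _
  · simpa [biUnion_image] using ht

end GroupoidCorrespondence

/-! ### Closedness of the sets `C · Y` -/

namespace GroupoidCorrespondence

variable {G : EtaleGroupoid.{u}} (X : GroupoidCorrespondence G G)

/-- Criterion for the closedness axiom of a `(G, X, R)`-action: it suffices that each point of `X`
has a neighbourhood `V` for which the closure of `V · Y` is contained in `X · Y`. Then `C · Y` has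
closure inside `X · Y`, and it is closed in `X · Y` because it is the preimage of the closed set
`C` under the map `X · Y → X/G`, `x · y ↦ [x]`. -/
theorem isClosed_of_closure_subset {Y : Type u} [TopologicalSpace Y] {a : LeftAction G Y}
    {xact : ∀ (x : X.Carrier) (y : Y), X.right.anchor x = a.anchor y → Y}
    (hopen : IsOpenMap fun p : FibreProd X.right.anchor a.anchor => xact p.1.1 p.1.2 p.2)
    (heq : ∀ x x' y y' (e : X.right.anchor x = a.anchor y) (e' : X.right.anchor x' = a.anchor y'),
      xact x y e = xact x' y' e' ↔
        ∃ (g : G.Arr) (h₁ : X.right.anchor x = G.r g) (h₂ : G.s g = a.anchor y'),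
          x' = X.right.act x g h₁ ∧ y = a.act g y' h₂)
    (hcl : ∀ x, ∃ V ∈ nhds x, closure {z | ∃ x ∈ V, ∃ y e, xact x y e = z} ⊆
      {z | ∃ x y e, xact x y e = z})
    {C : Set X.right.Orbits} (hC : IsCompact C) :
    IsClosed {z : Y | ∃ x y, ∃ e : X.right.anchor x = a.anchor y,
      X.right.proj x ∈ C ∧ xact x y e = z} := by
  obtain ⟨F, hF, hFP, hFC⟩ := X.exists_finite_cover hcl hC
  rw [← closure_subset_iff_isClosed]
  intro z hz
  have h1 : {z : Y | ∃ x y, ∃ e : X.right.anchor x = a.anchor y,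
      X.right.proj x ∈ C ∧ xact x y e = z} ⊆
      ⋃ V ∈ F, {z | ∃ x ∈ V, ∃ y e, xact x y e = z} := by
    rintro _ ⟨x, y, e, hx, rfl⟩
    have h2 := hFC hx
    simp only [mem_iUnion, mem_image] at h2 ⊢
    obtain ⟨V, hV, x', hx', h2⟩ := h2
    obtain ⟨k, ek, rfl⟩ := proj_eq_iff.1 h2
    have e1 : G.s k = a.anchor y := (X.right.anchor_act x' k ek).symm.trans e
    refine ⟨V, hV, x', hx', a.act k y e1, ek.trans (a.anchor_act k y e1).symm, ?_⟩
    exact (heq _ _ _ _ _ _).2 ⟨k, ek, e1, rfl, rfl⟩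
  have h3 : z ∈ {z | ∃ x y e, xact x y e = z} := by
    have h4 := closure_mono h1 hz
    rw [hF.closure_biUnion] at h4
    simp only [mem_iUnion] at h4
    obtain ⟨V, hV, h4⟩ := h4
    exact hFP V hV h4
  obtain ⟨x, y, e, rfl⟩ := h3
  by_contra hx
  have hx : X.right.proj x ∉ C := fun h => hx ⟨x, y, e, h, rfl⟩
  have hN : IsOpen {p : FibreProd X.right.anchor a.anchor | X.right.proj p.1.1 ∉ C} :=
    hC.isClosed.isOpen_compl.preimage
      (X.continuous_proj.comp (continuous_fst.comp continuous_subtype_val))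
  obtain ⟨_, ⟨⟨⟨x₁, y₁⟩, e₁⟩, h5, rfl⟩, x₂, y₂, e₂, h6, h7⟩ :=
    mem_closure_iff.1 hz _ (hopen _ hN) ⟨⟨(x, y), e⟩, hx, rfl⟩
  obtain ⟨k, ek, e3, h8, -⟩ := (heq _ _ _ _ _ _).1 h7
  refine h5 ?_
  have : X.right.proj x₂ = X.right.proj x₁ := proj_eq_iff.2 ⟨k, ek, h8.symm⟩
  exact this ▸ h6

end GroupoidCorrespondence

/-! ### Actions that commute with right translations -/

namespace CorrespondenceAction

variable {G : EtaleGroupoid.{u}} {X : GroupoidCorrespondence G G} {R : Opens G.Obj}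

theorem xact_congr {Y : Type u} [TopologicalSpace Y] (c : CorrespondenceAction G X R Y)
    {x x' : X.Carrier} {y y' : Y} (hx : x = x') (hy : y = y')
    (e : X.right.anchor x = c.anchor y) : c.xact x y e = c.xact x' y' (hx ▸ hy ▸ e) := by
  subst hx; subst hy; rfl

theorem xact_act {Y : Type u} [TopologicalSpace Y] (c : CorrespondenceAction G X R Y)
    (x : X.Carrier) (g : G.Arr) (y : Y) (e₁ : X.right.anchor x = G.r g)
    (e₂ : G.s g = c.anchor y) :
    c.xact x (c.act g y e₂) (e₁.trans (c.anchor_act g y e₂).symm) =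
      c.xact (X.right.act x g e₁) y ((X.right.anchor_act x g e₁).trans e₂) :=
  (c.xact_eq_iff _ _ _ _ _ _).2 ⟨g, e₁, e₂, rfl, rfl⟩

variable {H : EtaleGroupoid.{u}}

/-- A `(G, X, R)`-action on the arrow space of `H` commutes with the right translation action of
`H`. -/
structure IsTranslationInvariant (c : CorrespondenceAction G X R H.Arr) : Prop where
  anchor_mul : ∀ h k e, c.anchor (H.mul h k e) = c.anchor h
  s_act : ∀ g h e, H.s (c.act g h e) = H.s h
  s_xact : ∀ x h e, H.s (c.xact x h e) = H.s h
  act_mul : ∀ g h k (e₁ : G.s g = c.anchor h) (e₂ : H.s h = H.r k),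
    H.mul (c.act g h e₁) k ((s_act g h e₁).trans e₂) =
      c.act g (H.mul h k e₂) (e₁.trans (anchor_mul h k e₂).symm)
  xact_mul : ∀ x h k (e₁ : X.right.anchor x = c.anchor h) (e₂ : H.s h = H.r k),
    H.mul (c.xact x h e₁) k ((s_xact x h e₁).trans e₂) =
      c.xact x (H.mul h k e₂) (e₁.trans (anchor_mul h k e₂).symm)

/-- The map `ϱ : H⁰ → G⁰` through which the anchor map of a translation invariant action factors.
-/
def base (c : CorrespondenceAction G X R H.Arr) (ω : H.Obj) : G.Obj := c.anchor (H.one ω)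

theorem continuous_base (c : CorrespondenceAction G X R H.Arr) : Continuous c.base :=
  c.continuous_anchor.comp H.continuous_one

namespace IsTranslationInvariant

variable {c : CorrespondenceAction G X R H.Arr} (hc : c.IsTranslationInvariant)
include hc

theorem anchor_eq (h : H.Arr) : c.anchor h = c.base (H.r h) := by
  rw [base, ← hc.anchor_mul (H.one (H.r h)) h (H.s_one _), H.one_mul]

theorem act_one_mul (g : G.Arr) (h : H.Arr) (e : G.s g = c.anchor (H.one (H.r h))) :
    H.mul (c.act g (H.one (H.r h)) e) h ((hc.s_act _ _ _).trans (H.s_one _)) =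
      c.act g h (e.trans (hc.anchor_eq h).symm) := by
  rw [hc.act_mul g _ h e (H.s_one _)]
  exact c.act_congr rfl (H.one_mul h) _

theorem xact_one_mul (x : X.Carrier) (h : H.Arr)
    (e : X.right.anchor x = c.anchor (H.one (H.r h))) :
    H.mul (c.xact x (H.one (H.r h)) e) h ((hc.s_xact _ _ _).trans (H.s_one _)) =
      c.xact x h (e.trans (hc.anchor_eq h).symm) := by
  rw [hc.xact_mul x _ h e (H.s_one _)]
  exact c.xact_congr rfl (H.one_mul h) _

/-- An arrow with the same range as `g · 1_ω` is of the form `g · k` with `r(k) = ω`. -/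
theorem exists_act_eq {g : G.Arr} {ω : H.Obj} {e : G.s g = c.anchor (H.one ω)} {h : H.Arr}
    (hr : H.r (c.act g (H.one ω) e) = H.r h) :
    ∃ k, H.r k = ω ∧ H.s k = H.s h ∧ ∃ e', c.act g k e' = h := by
  have hs : H.s (c.act g (H.one ω) e) = ω := (hc.s_act _ _ _).trans (H.s_one _)
  let k := H.mul (H.inv (c.act g (H.one ω) e)) h ((H.s_inv _).trans hr)
  have hk : H.r k = ω := (H.r_mul _ _ _).trans ((H.r_inv _).trans hs)
  refine ⟨k, hk, H.s_mul _ _ _, ?_⟩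
  have h1 : H.mul (c.act g (H.one ω) e) k (hs.trans hk.symm) = h := H.mul_inv_cancel_left _ h hr
  clear_value k
  subst hk
  exact ⟨_, (hc.act_one_mul g k e).symm.trans h1⟩

/-- An arrow with the same range as `x · 1_ω` is of the form `x · k` with `r(k) = ω`. -/
theorem exists_xact_eq {x : X.Carrier} {ω : H.Obj} {e : X.right.anchor x = c.anchor (H.one ω)}
    {h : H.Arr} (hr : H.r (c.xact x (H.one ω) e) = H.r h) :
    ∃ k, H.r k = ω ∧ H.s k = H.s h ∧ ∃ e', c.xact x k e' = h := by
  have hs : H.s (c.xact x (H.one ω) e) = ω := (hc.s_xact _ _ _).trans (H.s_one _)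
  let k := H.mul (H.inv (c.xact x (H.one ω) e)) h ((H.s_inv _).trans hr)
  have hk : H.r k = ω := (H.r_mul _ _ _).trans ((H.r_inv _).trans hs)
  refine ⟨k, hk, H.s_mul _ _ _, ?_⟩
  have h1 : H.mul (c.xact x (H.one ω) e) k (hs.trans hk.symm) = h := H.mul_inv_cancel_left _ h hr
  clear_value k
  subst hk
  exact ⟨_, (hc.xact_one_mul x k e).symm.trans h1⟩

/-- The bisection of `H` by which a bisection of `G` acts: all arrows `g · 1_ω` with `g ∈ V`. -/
def bisectionG (V : G.Bisection) : H.Bisection where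
  carrier := {t | ∃ g ∈ V.carrier, ∃ ω, ∃ e : G.s g = c.anchor (H.one ω),
    c.act g (H.one ω) e = t}
  isOpen := by
    let f : FibreProd G.r c.anchor → H.Arr := fun p =>
      c.act (G.inv p.1.1) p.1.2 ((G.s_inv _).trans p.2)
    have hf : Continuous f := c.continuous_act.comp (Continuous.subtype_mk
      ((G.continuous_inv.comp (continuous_fst.comp continuous_subtype_val)).prodMk
        (continuous_snd.comp continuous_subtype_val)) fun p => (G.s_inv _).trans p.2)
    have hO : IsOpen ({p : FibreProd G.r c.anchor | p.1.1 ∈ V.carrier} ∩ f ⁻¹' range H.one) :=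
      (V.isOpen.preimage (continuous_fst.comp continuous_subtype_val)).inter
        (H.isOpenMap_one.isOpen_range.preimage hf)
    convert FibreProd.isOpenMap_snd G.isLocalHomeomorph_r.isOpenMap
      c.continuous_anchor _ hO using 1
    ext k
    constructor
    · rintro ⟨g, hg, ω, e, rfl⟩
      refine ⟨⟨(g, c.act g (H.one ω) e), (c.anchor_act _ _ _).symm⟩, ⟨hg, ω, ?_⟩, rfl⟩
      exact (c.inv_act_act g _ e).symm
    · rintro ⟨⟨⟨g, k⟩, e⟩, ⟨hg, ω, hω⟩, rfl⟩
      have h1 := c.act_inv_act g k e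
      have h2 := c.anchor_act (G.inv g) k ((G.s_inv g).trans e)
      refine ⟨g, hg, ω, ?_, ?_⟩
      · rw [hω, h2, G.r_inv]
      · rw [c.act_congr rfl hω]
        exact h1
  injOn_s := by
    rintro _ ⟨g, hg, ω, e, rfl⟩ _ ⟨g', hg', ω', e', rfl⟩ h
    rw [hc.s_act, hc.s_act, H.s_one, H.s_one] at h
    subst h
    obtain rfl := V.injOn_s hg hg' (e.trans e'.symm)
    rfl
  injOn_r := by
    rintro _ ⟨g, hg, ω, e, rfl⟩ _ ⟨g', hg', ω', e', rfl⟩ h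
    have h1 := congrArg c.base h
    rw [← hc.anchor_eq, ← hc.anchor_eq, c.anchor_act, c.anchor_act] at h1
    obtain rfl := V.injOn_r hg hg' h1
    obtain ⟨k, hk, -, e₁, h2⟩ := hc.exists_act_eq h.symm
    have h3 : k = H.one ω := c.act_left_cancel _ _ h2
    have h4 : ω = ω' := by rw [← hk, h3, H.r_one]
    subst h4
    rfl

/-- The bisection of `H` by which a bisection of `X` acts: all arrows `x · 1_ω` with `x ∈ V`. -/
def bisectionX (V : X.Bisection) : H.Bisection where
  carrier := {t | ∃ x ∈ V.carrier, ∃ ω, ∃ e : X.right.anchor x = c.anchor (H.one ω),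
    c.xact x (H.one ω) e = t}
  isOpen := by
    have hO : IsOpen {p : FibreProd X.right.anchor c.anchor |
        p.1.1 ∈ V.carrier ∧ p.1.2 ∈ range H.one} :=
      (V.isOpen.preimage (continuous_fst.comp continuous_subtype_val)).inter
        (H.isOpenMap_one.isOpen_range.preimage (continuous_snd.comp continuous_subtype_val))
    convert c.isOpenMap_xact _ hO using 1
    ext k
    constructor
    · rintro ⟨x, hx, ω, e, rfl⟩
      exact ⟨⟨(x, H.one ω), e⟩, ⟨hx, ω, rfl⟩, rfl⟩
    · rintro ⟨⟨⟨x, _⟩, e⟩, ⟨hx, ω, rfl⟩, rfl⟩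
      exact ⟨x, hx, ω, e, rfl⟩
  injOn_s := by
    rintro _ ⟨g, hg, ω, e, rfl⟩ _ ⟨g', hg', ω', e', rfl⟩ h
    rw [hc.s_xact, hc.s_xact, H.s_one, H.s_one] at h
    subst h
    obtain rfl := V.injOn_s hg hg' (e.trans e'.symm)
    rfl
  injOn_r := by
    rintro _ ⟨x, hx, ω, e, rfl⟩ _ ⟨x', hx', ω', e', rfl⟩ h
    obtain ⟨k, hk, -, e₁, h2⟩ := hc.exists_xact_eq h.symm
    obtain ⟨g, e₂, e₃, h3, h4⟩ := (c.xact_eq_iff _ _ _ _ _ _).1 h2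
    obtain rfl := V.injOn_proj hx' hx (GroupoidCorrespondence.proj_eq_iff.2 ⟨g, e₂, h3.symm⟩)
    have h5 := X.free _ _ _ h3.symm
    subst h5
    rw [c.one_act'] at h4
    have h6 : ω = ω' := by rw [← hk, h4, H.r_one]
    subst h6
    rfl

/-- The map on bisections described by a translation invariant action. -/
def bisectionMap : BisectionMap G X H := Sum.elim hc.bisectionG hc.bisectionX

theorem describes : hc.bisectionMap.Describes c := by
  refine ⟨fun V h k => ⟨?_, ?_⟩, fun V h k => ⟨?_, ?_⟩⟩
  · rintro ⟨_, ⟨g, hg, ω, e, rfl⟩, e', rfl⟩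
    have hω : ω = H.r h := ((hc.s_act _ _ _).trans (H.s_one _)).symm.trans e'
    subst hω
    exact ⟨g, hg, _, (hc.act_one_mul g h e).symm⟩
  · rintro ⟨g, hg, e, rfl⟩
    exact ⟨_, ⟨g, hg, H.r h, e.trans (hc.anchor_eq h), rfl⟩, _, hc.act_one_mul g h _⟩
  · rintro ⟨_, ⟨g, hg, ω, e, rfl⟩, e', rfl⟩
    have hω : ω = H.r h := ((hc.s_xact _ _ _).trans (H.s_one _)).symm.trans e'
    subst hω
    exact ⟨g, hg, _, (hc.xact_one_mul g h e).symm⟩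
  · rintro ⟨g, hg, e, rfl⟩
    exact ⟨_, ⟨g, hg, H.r h, e.trans (hc.anchor_eq h), rfl⟩, _, hc.xact_one_mul g h _⟩

theorem hasBaseMap : hc.bisectionMap.HasBaseMap ⟨c.base, c.continuous_base⟩ := by
  intro U
  ext t
  constructor
  · rintro ⟨_, ⟨z, hz, rfl⟩, ω, e, rfl⟩
    rw [c.one_act']
    refine ⟨ω, ?_, rfl⟩
    rw [G.s_one] at e
    subst e
    exact hz
  · rintro ⟨ω, hω, rfl⟩
    exact ⟨_, ⟨c.base ω, hω, rfl⟩, ω, G.s_one _, c.one_act' _ _ _⟩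

end IsTranslationInvariant
end CorrespondenceAction

/-! ### An action and the map on bisections that describes it determine each other -/

namespace BisectionMap

variable {G : EtaleGroupoid.{u}} {X : GroupoidCorrespondence G G} {R : Opens G.Obj}
  {H : EtaleGroupoid.{u}} {ϑ : BisectionMap G X H}

theorem _root_.EtaleGroupoid.Bisection.mem_iff_exists_mul_one (T : H.Bisection) (t : H.Arr) :
    t ∈ T.carrier ↔
      ∃ t' ∈ T.carrier, ∃ e : H.s t' = H.r (H.one (H.s t)), H.mul t' (H.one (H.s t)) e = t := by
  constructor
  · intro h
    exact ⟨t, h, (H.r_one _).symm, H.mul_one t⟩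
  · rintro ⟨t', h, e, he⟩
    rw [H.mul_one'] at he
    rwa [← he]

theorem Describes.unique {ϑ' : BisectionMap G X H} {c : CorrespondenceAction G X R H.Arr}
    (h : ϑ.Describes c) (h' : ϑ'.Describes c) : ϑ = ϑ' := by
  funext V
  cases V with
  | inl V =>
    ext t
    rw [EtaleGroupoid.Bisection.mem_iff_exists_mul_one, h.1,
      (ϑ' (.inl V)).mem_iff_exists_mul_one, h'.1]
  | inr V =>
    ext t
    rw [EtaleGroupoid.Bisection.mem_iff_exists_mul_one, h.2,
      (ϑ' (.inr V)).mem_iff_exists_mul_one, h'.2]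

theorem Describes.anchor_mem_iff {c : CorrespondenceAction G X R H.Arr} (h : ϑ.Describes c)
    (U : Opens G.Obj) (y : H.Arr) : c.anchor y ∈ U ↔
      ∃ k, ∃ t ∈ (ϑ (.inl (EtaleGroupoid.Bisection.unit U))).carrier,
        ∃ e : H.s t = H.r y, H.mul t y e = k := by
  simp only [h.1]
  constructor
  · intro hy
    exact ⟨_, G.one (c.anchor y), ⟨_, hy, rfl⟩, G.s_one _, rfl⟩
  · rintro ⟨k, _, ⟨ω, hω, rfl⟩, e, -⟩
    rw [G.s_one] at e
    exact e ▸ hω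

/-- The anchor map is detected by the bisections of unit arrows, and the action of an arrow or of
a point of `X` by any bisection that contains it. -/
theorem Describes.unique_action {c c' : CorrespondenceAction G X R H.Arr} (h : ϑ.Describes c)
    (h' : ϑ.Describes c') : c = c' := by
  have ha : c.anchor = c'.anchor := by
    funext y
    by_contra hne
    obtain ⟨U, W, hU, -, hy, hy', hd⟩ := t2_separation hne
    have h1 := ((h.anchor_mem_iff ⟨U, hU⟩ y).trans (h'.anchor_mem_iff ⟨U, hU⟩ y).symm).1 hy
    exact disjoint_left.1 hd h1 hy'
  have h1 : ∀ g y e e', c.act g y e = c'.act g y e' := by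
    intro g y e e'
    obtain ⟨V, hV⟩ := G.exists_bisection_mem g
    obtain ⟨g', hg', e'', h2⟩ := ((h.1 V y _).symm.trans (h'.1 V y _)).1 ⟨g, hV, e, rfl⟩
    obtain rfl := V.injOn_s hV hg' (e'.trans e''.symm)
    exact h2.symm
  have h2 : ∀ g y e e', c.xact g y e = c'.xact g y e' := by
    intro g y e e'
    obtain ⟨V, hV⟩ := X.exists_bisection_mem g
    obtain ⟨g', hg', e'', h2⟩ := ((h.2 V y _).symm.trans (h'.2 V y _)).1 ⟨g, hV, e, rfl⟩
    obtain rfl := V.injOn_s hV hg' (e'.trans e''.symm)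
    exact h2.symm
  obtain ⟨⟨an, act, _, _, _, _, _⟩, xact, _, _, _, _, _, _, _⟩ := c
  obtain ⟨⟨an', act', _, _, _, _, _⟩, xact', _, _, _, _, _, _, _⟩ := c'
  dsimp only at ha h1 h2
  subst ha
  obtain rfl : act = act' := by
    funext g y e
    exact h1 g y e e
  obtain rfl : xact = xact' := by
    funext g y e
    exact h2 g y e e
  rfl

end BisectionMap

/-! ### The six conditions for the map on bisections of an action -/

theorem EtaleGroupoid.Bisection.mem_mul_iff {H : EtaleGroupoid.{u}} (A B : H.Bisection)
    (t : H.Arr) : t ∈ (A.mul B).carrier ↔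
      ∃ b ∈ B.carrier, ∃ a ∈ A.carrier, ∃ e : H.s a = H.r b, H.mul a b e = t :=
  ⟨fun ⟨a, b, e, ha, hb, h⟩ => ⟨b, hb, a, ha, e, h⟩, fun ⟨b, hb, a, ha, e, h⟩ =>
    ⟨a, b, e, ha, hb, h⟩⟩

theorem EtaleGroupoid.Bisection.mem_inv_mul_iff {H : EtaleGroupoid.{u}} (A B : H.Bisection)
    (t : H.Arr) : t ∈ (A.inv.mul B).carrier ↔
      ∃ a ∈ A.carrier, ∃ e : H.s a = H.r t, H.mul a t e ∈ B.carrier := by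
  constructor
  · rintro ⟨a, b, e, ha, hb, rfl⟩
    refine ⟨H.inv a, ha, (H.s_inv a).trans (H.r_mul _ _ _).symm, ?_⟩
    rwa [H.inv_mul_cancel_left a b e]
  · rintro ⟨a, ha, e, hb⟩
    refine ⟨H.inv a, H.mul a t e, (H.s_inv a).trans (H.r_mul _ _ _).symm, ?_, hb,
      H.inv_mul_cancel_left a t e⟩
    change H.inv (H.inv a) ∈ A.carrier
    rwa [H.inv_inv]

namespace CorrespondenceAction.IsTranslationInvariant

variable {G : EtaleGroupoid.{u}} {X : GroupoidCorrespondence G G} {R : Opens G.Obj}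
  {H : EtaleGroupoid.{u}} {c : CorrespondenceAction G X R H.Arr} (hc : c.IsTranslationInvariant)
include hc

open GroupoidCorrespondence.Bisection

theorem mul_GG (V W : G.Bisection) : (hc.bisectionG V).mul (hc.bisectionG W) =
    hc.bisectionG (V.mul W) := by
  ext t
  have hd := hc.describes.1 V
  simp only [bisectionMap, Sum.elim_inl] at hd
  simp only [EtaleGroupoid.Bisection.mem_mul_iff, hd]
  constructor
  · rintro ⟨_, ⟨w, hw, ω, e, rfl⟩, v, hv, e', rfl⟩
    have h := e'.trans (c.anchor_act w _ e)
    exact ⟨_, ⟨v, w, h, hv, hw, rfl⟩, ω, (G.s_mul v w h).trans e, c.mul_act v w _ h e⟩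
  · rintro ⟨_, ⟨v, w, h, hv, hw, rfl⟩, ω, e, rfl⟩
    have e₁ := (G.s_mul v w h).symm.trans e
    exact ⟨_, ⟨w, hw, ω, e₁, rfl⟩, v, hv, h.trans (c.anchor_act w _ e₁).symm,
      (c.mul_act v w _ h e₁).symm⟩

theorem mul_GX (V : G.Bisection) (W : X.Bisection) :
    (hc.bisectionG V).mul (hc.bisectionX W) = hc.bisectionX (leftMul V W) := by
  ext t
  have hd := hc.describes.1 V
  simp only [bisectionMap, Sum.elim_inl] at hd
  simp only [EtaleGroupoid.Bisection.mem_mul_iff, hd]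
  constructor
  · rintro ⟨_, ⟨w, hw, ω, e, rfl⟩, v, hv, e', rfl⟩
    have h := e'.trans (c.anchor_xact w _ e)
    exact ⟨_, ⟨v, w, h, hv, hw, rfl⟩, ω, (X.right_anchor_left v w h).trans e,
      (c.act_xact v w _ h e).symm⟩
  · rintro ⟨_, ⟨v, w, h, hv, hw, rfl⟩, ω, e, rfl⟩
    have e₁ := (X.right_anchor_left v w h).symm.trans e
    exact ⟨_, ⟨w, hw, ω, e₁, rfl⟩, v, hv, h.trans (c.anchor_xact w _ e₁).symm,
      c.act_xact v w _ h e₁⟩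

theorem mul_XG (V : X.Bisection) (W : G.Bisection) :
    (hc.bisectionX V).mul (hc.bisectionG W) = hc.bisectionX (rightMul V W) := by
  ext t
  have hd := hc.describes.2 V
  simp only [bisectionMap, Sum.elim_inr] at hd
  simp only [EtaleGroupoid.Bisection.mem_mul_iff, hd]
  constructor
  · rintro ⟨_, ⟨w, hw, ω, e, rfl⟩, v, hv, e', rfl⟩
    have h := e'.trans (c.anchor_act w _ e)
    exact ⟨_, ⟨v, w, h, hv, hw, rfl⟩, ω, (X.right.anchor_act v w h).trans e,
      (c.xact_act v w _ h e).symm⟩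
  · rintro ⟨_, ⟨v, w, h, hv, hw, rfl⟩, ω, e, rfl⟩
    have e₁ := (X.right.anchor_act v w h).symm.trans e
    exact ⟨_, ⟨w, hw, ω, e₁, rfl⟩, v, hv, h.trans (c.anchor_act w _ e₁).symm,
      c.xact_act v w _ h e₁⟩

theorem inv_mul_bisectionX (V W : X.Bisection) :
    (hc.bisectionX V).inv.mul (hc.bisectionX W) = hc.bisectionG (bracket V W) := by
  ext t
  have hd := hc.describes.2 V t
  simp only [bisectionMap, Sum.elim_inr] at hd
  rw [EtaleGroupoid.Bisection.mem_inv_mul_iff]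
  constructor
  · rintro ⟨a, ha, e, w, hw, ω, e₁, h⟩
    obtain ⟨v, hv, e₂, h₂⟩ := (hd _).1 ⟨a, ha, e, h.symm⟩
    obtain ⟨g, e₃, e₄, h₃, h₄⟩ := (c.xact_eq_iff _ _ _ _ _ _).1 h₂
    exact ⟨g, ⟨v, hv, w, hw, e₃, h₃.symm⟩, ω, e₄, h₄.symm⟩
  · rintro ⟨g, ⟨v, hv, _, hw, e₃, rfl⟩, ω, e, rfl⟩
    obtain ⟨a, ha, e₁, h⟩ := (hd (c.xact v _ (e₃.trans (c.anchor_act g _ e).symm))).2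
      ⟨v, hv, _, rfl⟩
    refine ⟨a, ha, e₁, _, hw, ω, (X.right.anchor_act v g e₃).trans e, ?_⟩
    rw [h, c.xact_act v g _ e₃ e]

/-- If `h = x · y`, then the range of `h` is the range of an arrow in `ϑ_V` for a bisection `V`
that contains `x`. -/
theorem r_xact_mem {V : X.Bisection} {x : X.Carrier} (hx : x ∈ V.carrier) {y : H.Arr}
    (e : X.right.anchor x = c.anchor y) :
    H.r (c.xact x y e) ∈ H.r '' (hc.bisectionX V).carrier := by
  obtain ⟨t, ht, e, h⟩ := (hc.describes.2 V y _).2 ⟨x, hx, e, rfl⟩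
  exact ⟨t, ht, by rw [← h, H.r_mul]⟩

theorem one_mem_image_iff (ω : H.Obj) : H.one ω ∈ c.image ↔
    ω ∈ ⋃ W : X.Bisection, H.r '' (hc.bisectionX W).carrier := by
  rw [mem_iUnion]
  constructor
  · rintro ⟨x, y, e, h⟩
    obtain ⟨V, hV⟩ := X.exists_bisection_mem x
    refine ⟨V, ?_⟩
    have := hc.r_xact_mem hV e
    rwa [h, H.r_one] at this
  · rintro ⟨W, _, ⟨x, hx, ω', e, rfl⟩, rfl⟩
    obtain ⟨k, -, -, e', h⟩ := hc.exists_xact_eq (e := e) (H.r_one _).symm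
    exact ⟨x, k, e', h⟩

theorem isMultiplicativeCovering : hc.bisectionMap.IsMultiplicativeCovering R where
  mul_GG := hc.mul_GG
  mul_GX := hc.mul_GX
  mul_XG := hc.mul_XG
  bracket := hc.inv_mul_bisectionX
  map_units := (hc.hasBaseMap ⊤).trans rfl
  map_union S := by
    simp only [hc.hasBaseMap _]
    ext t
    simp only [EtaleGroupoid.Bisection.unit, mem_iUnion, mem_image, SetLike.mem_coe,
      Opens.mem_comap, Opens.mem_sSup]
    constructor
    · rintro ⟨ω, ⟨U, hU, h⟩, rfl⟩
      exact ⟨U, hU, ω, h, rfl⟩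
    · rintro ⟨U, hU, ω, h, rfl⟩
      exact ⟨ω, ⟨U, hU, h⟩, rfl⟩
  covering := by
    rw [hc.hasBaseMap R]
    rintro _ ⟨_, ⟨ω, hω, rfl⟩, rfl⟩
    rw [H.r_one]
    exact (hc.one_mem_image_iff ω).1 (c.covers _ hω)

/-- The unit arrows at the ranges of arrows in `ϑ_U` lie in the set of all `x · h` with `[x]` in the
image of a compact set that contains `U`. This set is closed and contained in `X · H`. -/
theorem closureCondition : hc.bisectionMap.ClosureCondition := by
  rintro U ⟨C, hC, hUC⟩
  have hcl := c.isClosed_of_isCompact _ (hC.image X.continuous_proj)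
  refine (closure_minimal ?_ (hcl.preimage H.continuous_one)).trans fun ω hω => ?_
  · rintro _ ⟨_, ⟨x, hx, ω', e, rfl⟩, rfl⟩
    obtain ⟨k, -, -, e', h⟩ := hc.exists_xact_eq (e := e) (H.r_one _).symm
    exact ⟨x, k, e', mem_image_of_mem _ (hUC hx), h⟩
  · obtain ⟨x, y, e, -, h⟩ := hω
    exact (hc.one_mem_image_iff ω).1 ⟨x, y, e, h⟩

end CorrespondenceAction.IsTranslationInvariant

/-! ### The base map of a map on bisections -/

namespace EtaleGroupoid.Bisection

variable {G : EtaleGroupoid.{u}}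

theorem one_mem_unit {U : Opens G.Obj} {ω : G.Obj} : G.one ω ∈ (unit U).carrier ↔ ω ∈ U := by
  constructor
  · rintro ⟨ω', h, h'⟩
    have := congrArg G.r h'
    rw [G.r_one, G.r_one] at this
    exact this ▸ h
  · intro h
    exact ⟨ω, h, rfl⟩

theorem mem_mul_unit {V : G.Bisection} {U : Opens G.Obj} {g : G.Arr} :
    g ∈ (V.mul (unit U)).carrier ↔ g ∈ V.carrier ∧ G.s g ∈ U := by
  constructor
  · rintro ⟨g, _, e, hg, ⟨ω, hω, rfl⟩, rfl⟩
    rw [G.mul_one']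
    rw [G.r_one] at e
    exact ⟨hg, e ▸ hω⟩
  · rintro ⟨hg, hU⟩
    exact ⟨g, _, (G.r_one _).symm, hg, ⟨_, hU, rfl⟩, G.mul_one g⟩

theorem mem_unit_mul {V : G.Bisection} {U : Opens G.Obj} {g : G.Arr} :
    g ∈ ((unit U).mul V).carrier ↔ g ∈ V.carrier ∧ G.r g ∈ U := by
  constructor
  · rintro ⟨_, g, e, ⟨ω, hω, rfl⟩, hg, rfl⟩
    rw [G.one_mul']
    rw [G.s_one] at e
    exact ⟨hg, e ▸ hω⟩
  · rintro ⟨hg, hU⟩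
    exact ⟨_, g, G.s_one _, ⟨_, hU, rfl⟩, hg, G.one_mul g⟩

theorem unit_mul_unit (U V : Opens G.Obj) : (unit U).mul (unit V) = unit (U ⊓ V) := by
  ext g
  rw [mem_mul_unit]
  constructor
  · rintro ⟨⟨ω, hω, rfl⟩, h⟩
    rw [G.s_one] at h
    exact ⟨ω, ⟨hω, h⟩, rfl⟩
  · rintro ⟨ω, hω, rfl⟩
    exact ⟨⟨ω, hω.1, rfl⟩, by rw [G.s_one]; exact hω.2⟩

/-- The open set of sources of a bisection. -/
def source (V : G.Bisection) : Opens G.Obj := ⟨_, G.isLocalHomeomorph_s.isOpenMap _ V.isOpen⟩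

theorem inv_mul_self (V : G.Bisection) : V.inv.mul V = unit V.source := by
  ext g
  rw [mem_inv_mul_iff]
  constructor
  · rintro ⟨a, ha, e, h⟩
    refine ⟨G.s a, ⟨a, ha, rfl⟩, ?_⟩
    have h1 := V.injOn_r ha h (G.r_mul _ _ _).symm
    rw [← G.inv_mul a, ← G.inv_mul_cancel_left a g e]
    exact mul_congr rfl h1 _
  · rintro ⟨_, ⟨a, ha, rfl⟩, rfl⟩
    exact ⟨a, ha, (G.r_one _).symm, by rwa [G.mul_one]⟩

end EtaleGroupoid.Bisection

namespace GroupoidCorrespondence.Bisection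

variable {G K : EtaleGroupoid.{u}} {X : GroupoidCorrespondence G K}

open EtaleGroupoid.Bisection

theorem mem_rightMul_unit {V : X.Bisection} {U : Opens K.Obj} {x : X.Carrier} :
    x ∈ (rightMul V (unit U)).carrier ↔ x ∈ V.carrier ∧ X.right.anchor x ∈ U := by
  constructor
  · rintro ⟨g, _, e, hg, ⟨ω, hω, rfl⟩, rfl⟩
    rw [X.right.act_one']
    rw [K.r_one] at e
    exact ⟨hg, e ▸ hω⟩
  · rintro ⟨hg, hU⟩
    exact ⟨x, _, (K.r_one _).symm, hg, ⟨_, hU, rfl⟩, X.right.act_one x⟩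

theorem mem_unit_leftMul {V : X.Bisection} {U : Opens G.Obj} {x : X.Carrier} :
    x ∈ (leftMul (unit U) V).carrier ↔ x ∈ V.carrier ∧ X.left.anchor x ∈ U := by
  constructor
  · rintro ⟨_, g, e, ⟨ω, hω, rfl⟩, hg, rfl⟩
    rw [X.left.one_act']
    rw [G.s_one] at e
    exact ⟨hg, e ▸ hω⟩
  · rintro ⟨hg, hU⟩
    exact ⟨_, x, G.s_one _, ⟨_, hU, rfl⟩, hg, X.left.one_act x⟩

/-- The open set of sources of a bisection. -/
def source (V : X.Bisection) : Opens K.Obj := ⟨_, X.etale.isOpenMap _ V.isOpen⟩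

theorem bracket_self (V : X.Bisection) : bracket V V = unit V.source := by
  ext k
  constructor
  · rintro ⟨x, hx, y, hy, e, h⟩
    obtain rfl := V.injOn_proj hx hy (proj_eq_iff.2 ⟨k, e, h⟩)
    exact ⟨_, ⟨x, hx, rfl⟩, (X.free x k e h).symm⟩
  · rintro ⟨_, ⟨x, hx, rfl⟩, rfl⟩
    exact ⟨x, hx, x, hx, (K.r_one _).symm, X.right.act_one x⟩

end GroupoidCorrespondence.Bisection

namespace BisectionMap

open EtaleGroupoid.Bisection

variable {G : EtaleGroupoid.{u}} {X : GroupoidCorrespondence G G} {H : EtaleGroupoid.{u}}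
  {ϑ : BisectionMap G X H} {R : Opens G.Obj}

namespace IsMultiplicativeCovering

variable (hϑ : ϑ.IsMultiplicativeCovering R)
include hϑ

/-- `ϑ_U` is contained in `ϑ_{G⁰} = H⁰`, so it consists of unit arrows. -/
theorem exists_one_eq_of_mem {U : Opens G.Obj} {t : H.Arr} (ht : t ∈ (ϑ (.inl (unit U))).carrier) :
    ∃ ω, H.one ω = t := by
  have h := hϑ.map_union {U, ⊤}
  rw [show sSup {U, ⊤} = (⊤ : Opens G.Obj) by simp, hϑ.map_units] at h
  have h2 : t ∈ (unit (⊤ : Opens H.Obj)).carrier := by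
    rw [h]
    exact mem_biUnion (mem_insert _ _) ht
  exact h2.imp fun _ h => h.2

/-- The restriction of `ϑ` to open subsets preserves finite intersections and arbitrary unions.
Since `G⁰` is Hausdorff, the complement of the largest open set `U` with `ω ∉ ϑ_U` consists of
exactly one point. -/
theorem exists_base_point (ω : H.Obj) :
    ∃ p, ∀ U : Opens G.Obj, H.one ω ∈ (ϑ (.inl (unit U))).carrier ↔ p ∈ U := by
  set S : Set (Opens G.Obj) := {U | H.one ω ∉ (ϑ (.inl (unit U))).carrier} with hS
  have h0 : ∀ T : Set (Opens G.Obj), H.one ω ∈ (ϑ (.inl (unit (sSup T)))).carrier ↔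
      ∃ U ∈ T, H.one ω ∈ (ϑ (.inl (unit U))).carrier := by
    intro T
    rw [hϑ.map_union, mem_iUnion₂]
    simp only [exists_prop]
  have hmax : sSup S ∈ S := by
    intro h
    obtain ⟨U, hU, h⟩ := (h0 S).1 h
    exact hU h
  have hmono : ∀ {U V : Opens G.Obj}, U ≤ V → H.one ω ∈ (ϑ (.inl (unit U))).carrier →
      H.one ω ∈ (ϑ (.inl (unit V))).carrier := by
    intro U V hUV h
    have h1 := (h0 {U, V}).2 ⟨U, mem_insert _ _, h⟩
    rwa [show sSup {U, V} = V by simpa using hUV] at h1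
  have hne : ∃ p, p ∉ sSup S := by
    by_contra! h
    have h1 : sSup S = ⊤ := top_unique fun p _ => h p
    rw [h1] at hmax
    refine hmax ?_
    rw [hϑ.map_units]
    exact ⟨ω, trivial, rfl⟩
  obtain ⟨p, hp⟩ := hne
  refine ⟨p, fun U => ⟨fun h => ?_, fun h => ?_⟩⟩
  · by_contra hpU
    have hU : ∃ q ∈ U, q ∉ sSup S := by
      by_contra! h1
      exact hmax (hmono h1 h)
    obtain ⟨q, hqU, hq⟩ := hU
    have hpq : p ≠ q := fun h => hpU (h ▸ hqU)
    obtain ⟨A, B, hA, hB, hpA, hqB, hd⟩ := t2_separation hpq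
    have h1 : ∀ {V : Opens G.Obj} {z}, z ∈ V → z ∉ sSup S →
        H.one ω ∈ (ϑ (.inl (unit V))).carrier := by
      intro V z hz hz'
      by_contra h
      exact hz' (Opens.mem_sSup.2 ⟨V, h, hz⟩)
    have h2 := h1 (V := ⟨A, hA⟩) hpA hp
    have h3 := h1 (V := ⟨B, hB⟩) hqB hq
    have h4 : H.one ω ∈ (ϑ (.inl (unit (sSup ∅)))).carrier := by
      have : (⟨A, hA⟩ : Opens G.Obj) ⊓ ⟨B, hB⟩ = sSup ∅ := by
        rw [sSup_empty]
        exact Opens.ext (disjoint_iff_inter_eq_empty.1 hd)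
      rw [← this, ← unit_mul_unit, ← hϑ.mul_GG]
      exact ⟨_, _, (H.s_one _).trans (H.r_one _).symm, h2, h3, H.mul_one' _ _ _⟩
    obtain ⟨_, h, -⟩ := (h0 ∅).1 h4
    exact h
  · by_contra h1
    exact hp (Opens.mem_sSup.2 ⟨U, h1, h⟩)

theorem existsUnique_baseMap : ∃! ρ : C(H.Obj, G.Obj), ϑ.HasBaseMap ρ := by
  choose ρ hρ using hϑ.exists_base_point
  have hcont : Continuous ρ := by
    refine continuous_def.2 fun U hU => ?_
    have : ρ ⁻¹' U = H.one ⁻¹' (ϑ (.inl (unit ⟨U, hU⟩))).carrier := by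
      ext ω
      exact (hρ ω ⟨U, hU⟩).symm
    rw [this]
    exact (ϑ _).isOpen.preimage H.continuous_one
  refine ⟨⟨ρ, hcont⟩, fun U => ?_, fun ρ' h => ?_⟩
  · ext t
    constructor
    · intro ht
      obtain ⟨ω, rfl⟩ := hϑ.exists_one_eq_of_mem ht
      exact one_mem_unit.2 ((hρ ω U).1 ht)
    · rintro ⟨ω, hω, rfl⟩
      exact (hρ ω U).2 hω
  · ext ω
    by_contra hne
    obtain ⟨A, B, hA, hB, hpA, hqB, hd⟩ := t2_separation hne
    have h1 : H.one ω ∈ (ϑ (.inl (unit ⟨A, hA⟩))).carrier := by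
      rw [h]
      exact one_mem_unit.2 hpA
    exact disjoint_left.1 hd ((hρ ω ⟨A, hA⟩).1 h1) hqB

end IsMultiplicativeCovering

end BisectionMap

/-! ### Partial actions on `H` by families of bisections -/

theorem EtaleGroupoid.isOpen_setMul {H : EtaleGroupoid.{u}} {A B : Set H.Arr} (hA : IsOpen A)
    (hB : IsOpen B) :
    IsOpen {k | ∃ g h, ∃ e : H.s g = H.r h, g ∈ A ∧ h ∈ B ∧ H.mul g h e = k} := by
  rw [isOpen_iff_mem_nhds]
  rintro _ ⟨g, h, e, hg, hh, rfl⟩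
  obtain ⟨V, hgV, hVA⟩ := H.exists_bisection (hA.mem_nhds hg)
  obtain ⟨W, hhW, hWB⟩ := H.exists_bisection (hB.mem_nhds hh)
  refine Filter.mem_of_superset ((V.mul W).isOpen.mem_nhds ⟨g, h, e, hgV, hhW, rfl⟩) ?_
  rintro _ ⟨g', h', e', hg', hh', rfl⟩
  exact ⟨g', h', e', hVA hg', hWB hh', rfl⟩

/-- An étale space `σ : A → B`, a map `ρ : H⁰ → B`, and a basis of open subsets `dom i` of `A` on
which `σ` is injective, together with bisections `θ i` of `H` such that, for `a ∈ dom i` and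
`σ a = ρ ω`, there is an arrow in `θ i` with source `ω` that depends only on `a` and `ω`, and all
arrows in `θ i` are of this form. It treats the bisections of `G` and of `X` on the same footing. -/
structure IsBisectionAssignment {A B ι : Type u} [TopologicalSpace A] (H : EtaleGroupoid.{u})
    (σ : A → B) (ρ : H.Obj → B) (dom : ι → Set A) (θ : ι → H.Bisection) : Prop where
  exists_subset : ∀ {a N}, N ∈ nhds a → ∃ i, a ∈ dom i ∧ dom i ⊆ N
  isOpen : ∀ i, IsOpen (dom i)
  exists_source : ∀ {i t}, t ∈ (θ i).carrier → ∃ a ∈ dom i, σ a = ρ (H.s t)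
  exists_arrow : ∀ {i a ω}, a ∈ dom i → σ a = ρ ω → ∃ t ∈ (θ i).carrier, H.s t = ω
  mem_of_mem : ∀ {i j a t}, a ∈ dom i → a ∈ dom j → σ a = ρ (H.s t) → t ∈ (θ i).carrier →
    t ∈ (θ j).carrier

namespace IsBisectionAssignment

variable {A B ι : Type u} [TopologicalSpace A] {H : EtaleGroupoid.{u}} {σ : A → B}
  {ρ : H.Obj → B} {dom : ι → Set A} {θ : ι → H.Bisection}
  (h : IsBisectionAssignment H σ ρ dom θ)
include h

theorem exists_lift (a : A) (ω : H.Obj) (e : σ a = ρ ω) :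
    ∃ t, H.s t = ω ∧ ∀ i, a ∈ dom i → t ∈ (θ i).carrier := by
  obtain ⟨i, hi, -⟩ := h.exists_subset (a := a) Filter.univ_mem
  obtain ⟨t, ht, hs⟩ := h.exists_arrow hi e
  exact ⟨t, hs, fun j hj => h.mem_of_mem hi hj (hs ▸ e) ht⟩

/-- The arrow with source `ω` in any of the bisections `θ i` with `a ∈ dom i`. -/
noncomputable def lift (a : A) (ω : H.Obj) (e : σ a = ρ ω) : H.Arr :=
  (h.exists_lift a ω e).choose

theorem s_lift (a : A) (ω : H.Obj) (e : σ a = ρ ω) : H.s (h.lift a ω e) = ω :=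
  (h.exists_lift a ω e).choose_spec.1

theorem lift_mem (a : A) (ω : H.Obj) (e : σ a = ρ ω) {i : ι} (hi : a ∈ dom i) :
    h.lift a ω e ∈ (θ i).carrier :=
  (h.exists_lift a ω e).choose_spec.2 i hi

theorem eq_lift {a : A} {i : ι} {t : H.Arr} {ω : H.Obj} (hi : a ∈ dom i)
    (ht : t ∈ (θ i).carrier) (hs : H.s t = ω) (e : σ a = ρ ω) : t = h.lift a ω e :=
  (θ i).injOn_s ht (h.lift_mem a ω e hi) (hs.trans (h.s_lift a ω e).symm)

theorem exists_eq_lift {i : ι} {t : H.Arr} (ht : t ∈ (θ i).carrier) :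
    ∃ a ∈ dom i, ∃ e, t = h.lift a (H.s t) e := by
  obtain ⟨a, ha, e⟩ := h.exists_source ht
  exact ⟨a, ha, e, h.eq_lift ha ht rfl e⟩

theorem continuous_lift : Continuous fun p : FibreProd σ ρ => h.lift p.1.1 p.1.2 p.2 := by
  refine continuous_def.2 fun O hO => isOpen_iff_mem_nhds.2 ?_
  rintro ⟨⟨a, ω⟩, e⟩ (hp : h.lift a ω e ∈ O)
  obtain ⟨i, hi, -⟩ := h.exists_subset (a := a) Filter.univ_mem
  have hN : H.s '' ((θ i).carrier ∩ O) ∈ nhds ω :=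
    (H.isLocalHomeomorph_s.isOpenMap _ ((θ i).isOpen.inter hO)).mem_nhds
      ⟨_, ⟨h.lift_mem a ω e hi, hp⟩, h.s_lift a ω e⟩
  have h1 : Prod.fst ∘ Subtype.val ⁻¹' dom i ∈ nhds (⟨(a, ω), e⟩ : FibreProd σ ρ) :=
    (continuous_fst.comp continuous_subtype_val).continuousAt ((h.isOpen i).mem_nhds hi)
  have h2 : Prod.snd ∘ Subtype.val ⁻¹' (H.s '' ((θ i).carrier ∩ O)) ∈
      nhds (⟨(a, ω), e⟩ : FibreProd σ ρ) :=
    (continuous_snd.comp continuous_subtype_val).continuousAt hN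
  filter_upwards [h1, h2]
  rintro ⟨⟨a', ω'⟩, e'⟩ (ha' : a' ∈ dom i) ⟨t, ⟨ht, htO⟩, hs⟩
  change h.lift a' ω' e' ∈ O
  have h3 : t = h.lift a' ω' e' := h.eq_lift ha' ht hs e'
  rwa [← h3]

/-- The action of `a ∈ A` on an arrow `k` of `H`. -/
noncomputable def translate (a : A) (k : H.Arr) (e : σ a = ρ (H.r k)) : H.Arr :=
  H.mul (h.lift a (H.r k) e) k (h.s_lift _ _ _)

theorem mul_eq_translate {a : A} {i : ι} {t k : H.Arr} (hi : a ∈ dom i)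
    (ht : t ∈ (θ i).carrier) (hs : H.s t = H.r k) (e : σ a = ρ (H.r k)) :
    H.mul t k hs = h.translate a k e :=
  H.mul_congr (h.eq_lift hi ht hs e) rfl _

theorem r_translate (a : A) (k : H.Arr) (e : σ a = ρ (H.r k)) :
    H.r (h.translate a k e) = H.r (h.lift a (H.r k) e) := H.r_mul _ _ _

theorem s_translate (a : A) (k : H.Arr) (e : σ a = ρ (H.r k)) :
    H.s (h.translate a k e) = H.s k := H.s_mul _ _ _

theorem lift_congr {a : A} {ω ω' : H.Obj} (hω : ω = ω') (e : σ a = ρ ω) :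
    h.lift a ω e = h.lift a ω' (hω ▸ e) := by subst hω; rfl

theorem translate_mul (a : A) (k l : H.Arr) (e : σ a = ρ (H.r k)) (e' : H.s k = H.r l) :
    H.mul (h.translate a k e) l ((h.s_translate a k e).trans e') =
      h.translate a (H.mul k l e') (e.trans (congrArg ρ (H.r_mul k l e').symm)) := by
  change H.mul (H.mul (h.lift a (H.r k) e) k (h.s_lift _ _ _)) l _ = _
  rw [H.mul_assoc _ _ _ (h.s_lift _ _ _) e']
  exact H.mul_congr (h.lift_congr (H.r_mul _ _ _).symm _) rfl _

theorem continuous_translate : Continuous fun p : FibreProd σ (fun k : H.Arr => ρ (H.r k)) =>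
    h.translate p.1.1 p.1.2 p.2 := by
  have h1 : Continuous fun p : FibreProd σ (fun k : H.Arr => ρ (H.r k)) =>
      h.lift p.1.1 (H.r p.1.2) p.2 :=
    h.continuous_lift.comp (f := fun p : FibreProd σ (fun k : H.Arr => ρ (H.r k)) =>
      (⟨(p.1.1, H.r p.1.2), p.2⟩ : FibreProd σ ρ))
      (Continuous.subtype_mk ((continuous_fst.comp continuous_subtype_val).prodMk
        (H.isLocalHomeomorph_r.continuous.comp (continuous_snd.comp continuous_subtype_val))) _)
  exact H.continuous_mul.comp (Continuous.subtype_mk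
    (h1.prodMk (continuous_snd.comp continuous_subtype_val))
      fun p => h.s_lift p.1.1 (H.r p.1.2) p.2)

theorem isOpenMap_translate : IsOpenMap fun p : FibreProd σ (fun k : H.Arr => ρ (H.r k)) =>
    h.translate p.1.1 p.1.2 p.2 := by
  intro U hU
  rw [isOpen_iff_mem_nhds]
  rintro _ ⟨⟨⟨a, k⟩, e⟩, hp, rfl⟩
  obtain ⟨T, hT, rfl⟩ := isOpen_induced_iff.1 hU
  obtain ⟨V, N, hV, hN, haV, hkN, hVN⟩ := isOpen_prod_iff.1 hT a k hp
  obtain ⟨i, hi, hiV⟩ := h.exists_subset (hV.mem_nhds haV)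
  refine Filter.mem_of_superset ((H.isOpen_setMul (θ i).isOpen hN).mem_nhds
    ⟨_, k, h.s_lift _ _ _, h.lift_mem a (H.r k) e hi, hkN, rfl⟩) ?_
  rintro _ ⟨t, n, e', ht, hn, rfl⟩
  obtain ⟨a', ha', e''⟩ := h.exists_source ht
  exact ⟨⟨(a', n), e''.trans (congrArg ρ e')⟩, hVN ⟨hiV ha', hn⟩,
    (h.mul_eq_translate ha' ht e' _).symm⟩

end IsBisectionAssignment

namespace BisectionMap

open EtaleGroupoid.Bisection GroupoidCorrespondence.Bisection

variable {G : EtaleGroupoid.{u}} {X : GroupoidCorrespondence G G} {H : EtaleGroupoid.{u}}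
  {ϑ : BisectionMap G X H} {R : Opens G.Obj}

namespace IsMultiplicativeCovering

variable (hϑ : ϑ.IsMultiplicativeCovering R) {ρ : C(H.Obj, G.Obj)} (hρ : ϑ.HasBaseMap ρ)
include hϑ hρ

theorem mem_map_mul_unit {V : G.Bisection} {U : Opens G.Obj} {t : H.Arr} :
    t ∈ (ϑ (.inl (V.mul (unit U)))).carrier ↔ t ∈ (ϑ (.inl V)).carrier ∧ ρ (H.s t) ∈ U := by
  rw [← hϑ.mul_GG, hρ, mem_mul_unit]
  rfl

theorem mem_map_unit_mul {V : G.Bisection} {U : Opens G.Obj} {t : H.Arr} :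
    t ∈ (ϑ (.inl ((unit U).mul V))).carrier ↔ t ∈ (ϑ (.inl V)).carrier ∧ ρ (H.r t) ∈ U := by
  rw [← hϑ.mul_GG, hρ, mem_unit_mul]
  rfl

theorem mem_map_rightMul_unit {V : X.Bisection} {U : Opens G.Obj} {t : H.Arr} :
    t ∈ (ϑ (.inr (rightMul V (unit U)))).carrier ↔
      t ∈ (ϑ (.inr V)).carrier ∧ ρ (H.s t) ∈ U := by
  rw [← hϑ.mul_XG, hρ, mem_mul_unit]
  rfl

theorem mem_map_unit_leftMul {V : X.Bisection} {U : Opens G.Obj} {t : H.Arr} :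
    t ∈ (ϑ (.inr (leftMul (unit U) V))).carrier ↔
      t ∈ (ϑ (.inr V)).carrier ∧ ρ (H.r t) ∈ U := by
  rw [← hϑ.mul_GX, hρ, mem_unit_mul]
  rfl

theorem isBisectionAssignment_inl : IsBisectionAssignment H G.s ρ
    (fun V : G.Bisection => V.carrier) (fun V => ϑ (.inl V)) where
  exists_subset := G.exists_bisection
  isOpen V := V.isOpen
  exists_source {V t} ht := by
    have h1 : V.mul (unit V.source) = V := by
      ext g
      rw [mem_mul_unit]
      exact ⟨fun h => h.1, fun h => ⟨h, g, h, rfl⟩⟩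
    rw [← h1, hϑ.mem_map_mul_unit hρ] at ht
    exact ht.2
  exists_arrow {V a ω} ha e := by
    have h1 : H.one ω ∈ (ϑ (.inl (V.inv.mul V))).carrier := by
      rw [V.inv_mul_self, hρ]
      exact one_mem_unit.2 ⟨a, ha, e⟩
    rw [← hϑ.mul_GG] at h1
    obtain ⟨b, t, e', hb, ht, h1⟩ := h1
    exact ⟨t, ht, by rw [← H.s_mul b t e', h1, H.s_one]⟩
  mem_of_mem {V W a t} hV hW e ht := by
    let U : Opens G.Obj := ⟨_, G.isLocalHomeomorph_s.isOpenMap _ (V.isOpen.inter W.isOpen)⟩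
    have h1 : V.mul (unit U) = W.mul (unit U) := by
      ext g
      rw [mem_mul_unit, mem_mul_unit]
      constructor
      · rintro ⟨hg, g', ⟨hV', hW'⟩, hs⟩
        exact ⟨V.injOn_s hV' hg hs ▸ hW', g', ⟨hV', hW'⟩, hs⟩
      · rintro ⟨hg, g', ⟨hV', hW'⟩, hs⟩
        exact ⟨W.injOn_s hW' hg hs ▸ hV', g', ⟨hV', hW'⟩, hs⟩
    have h2 := (hϑ.mem_map_mul_unit hρ (U := U)).2 ⟨ht, a, ⟨hV, hW⟩, e⟩
    rw [h1] at h2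
    exact ((hϑ.mem_map_mul_unit hρ).1 h2).1

theorem isBisectionAssignment_inr : IsBisectionAssignment H X.right.anchor ρ
    (fun V : X.Bisection => V.carrier) (fun V => ϑ (.inr V)) where
  exists_subset := X.exists_bisection
  isOpen V := V.isOpen
  exists_source {V t} ht := by
    have h1 : rightMul V (unit V.source) = V := by
      ext g
      rw [mem_rightMul_unit]
      exact ⟨fun h => h.1, fun h => ⟨h, g, h, rfl⟩⟩
    rw [← h1, hϑ.mem_map_rightMul_unit hρ] at ht
    exact ht.2
  exists_arrow {V a ω} ha e := by
    have h1 : H.one ω ∈ (ϑ (.inl (GroupoidCorrespondence.Bisection.bracket V V))).carrier := by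
      rw [V.bracket_self, hρ]
      exact one_mem_unit.2 ⟨a, ha, e⟩
    rw [← hϑ.bracket] at h1
    obtain ⟨b, t, e', hb, ht, h1⟩ := h1
    exact ⟨t, ht, by rw [← H.s_mul b t e', h1, H.s_one]⟩
  mem_of_mem {V W a t} hV hW e ht := by
    let U : Opens G.Obj := ⟨_, X.etale.isOpenMap _ (V.isOpen.inter W.isOpen)⟩
    have h1 : rightMul V (unit U) = rightMul W (unit U) := by
      ext g
      rw [mem_rightMul_unit, mem_rightMul_unit]
      constructor
      · rintro ⟨hg, g', ⟨hV', hW'⟩, hs⟩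
        exact ⟨V.injOn_s hV' hg hs ▸ hW', g', ⟨hV', hW'⟩, hs⟩
      · rintro ⟨hg, g', ⟨hV', hW'⟩, hs⟩
        exact ⟨W.injOn_s hW' hg hs ▸ hV', g', ⟨hV', hW'⟩, hs⟩
    have h2 := (hϑ.mem_map_rightMul_unit hρ (U := U)).2 ⟨ht, a, ⟨hV, hW⟩, e⟩
    rw [h1] at h2
    exact ((hϑ.mem_map_rightMul_unit hρ).1 h2).1

/-- Otherwise `r(g)` has a neighbourhood `U` whose preimage `ϱ⁻¹(U)` does not contain the range of
the arrow. But the arrow belongs to `ϑ_{UV} = ϱ⁻¹(U) ϑ_V` for any bisection `V` around `g`. -/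
theorem base_r_lift (g : G.Arr) (ω : H.Obj) (e : G.s g = ρ ω) :
    ρ (H.r ((hϑ.isBisectionAssignment_inl hρ).lift g ω e)) = G.r g := by
  by_contra hne
  obtain ⟨A, B, hA, hB, hpA, hqB, hd⟩ := t2_separation hne
  obtain ⟨V, hV⟩ := G.exists_bisection_mem g
  have h1 : g ∈ ((unit ⟨B, hB⟩).mul V).carrier := mem_unit_mul.2 ⟨hV, hqB⟩
  have h2 := (hϑ.isBisectionAssignment_inl hρ).lift_mem g ω e h1
  exact disjoint_left.1 hd hpA ((hϑ.mem_map_unit_mul hρ).1 h2).2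

theorem base_r_liftX (x : X.Carrier) (ω : H.Obj) (e : X.right.anchor x = ρ ω) :
    ρ (H.r ((hϑ.isBisectionAssignment_inr hρ).lift x ω e)) = X.left.anchor x := by
  by_contra hne
  obtain ⟨A, B, hA, hB, hpA, hqB, hd⟩ := t2_separation hne
  obtain ⟨V, hV⟩ := X.exists_bisection_mem x
  have h1 : x ∈ (leftMul (unit ⟨B, hB⟩) V).carrier := mem_unit_leftMul.2 ⟨hV, hqB⟩
  have h2 := (hϑ.isBisectionAssignment_inr hρ).lift_mem x ω e h1
  exact disjoint_left.1 hd hpA ((hϑ.mem_map_unit_leftMul hρ).1 h2).2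

end IsMultiplicativeCovering

end BisectionMap

/-! ### The action described by a map on bisections -/

/-- Multiplicativity `θ₁ θ₂ = θ₃` on bisections around `a₁`, `a₂`, `a₃` gives
`a₁ · (a₂ · k) = a₃ · k`. -/
theorem IsBisectionAssignment.translate_translate {A₁ A₂ A₃ B ι₁ ι₂ ι₃ : Type u}
    [TopologicalSpace A₁] [TopologicalSpace A₂] [TopologicalSpace A₃] {H : EtaleGroupoid.{u}}
    {σ₁ : A₁ → B} {σ₂ : A₂ → B} {σ₃ : A₃ → B} {ρ : H.Obj → B}
    {dom₁ : ι₁ → Set A₁} {dom₂ : ι₂ → Set A₂} {dom₃ : ι₃ → Set A₃} {θ₁ : ι₁ → H.Bisection}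
    {θ₂ : ι₂ → H.Bisection} {θ₃ : ι₃ → H.Bisection}
    (h₁ : IsBisectionAssignment H σ₁ ρ dom₁ θ₁) (h₂ : IsBisectionAssignment H σ₂ ρ dom₂ θ₂)
    (h₃ : IsBisectionAssignment H σ₃ ρ dom₃ θ₃) {a₁ : A₁} {a₂ : A₂} {a₃ : A₃} {i₁ : ι₁} {i₂ : ι₂}
    {i₃ : ι₃} (ha₁ : a₁ ∈ dom₁ i₁) (ha₂ : a₂ ∈ dom₂ i₂) (ha₃ : a₃ ∈ dom₃ i₃)
    (hθ : (θ₁ i₁).mul (θ₂ i₂) = θ₃ i₃) {k : H.Arr} (e₂ : σ₂ a₂ = ρ (H.r k))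
    (e₁ : σ₁ a₁ = ρ (H.r (h₂.translate a₂ k e₂))) (e₃ : σ₃ a₃ = ρ (H.r k)) :
    h₁.translate a₁ (h₂.translate a₂ k e₂) e₁ = h₃.translate a₃ k e₃ := by
  have e : H.s (h₁.lift a₁ _ e₁) = H.r (h₂.lift a₂ (H.r k) e₂) :=
    (h₁.s_lift _ _ _).trans (h₂.r_translate _ _ _)
  have hm : H.mul (h₁.lift a₁ _ e₁) (h₂.lift a₂ (H.r k) e₂) e ∈ (θ₃ i₃).carrier := by
    rw [← hθ]
    exact ⟨_, _, e, h₁.lift_mem _ _ _ ha₁, h₂.lift_mem _ _ _ ha₂, rfl⟩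
  rw [← h₃.mul_eq_translate ha₃ hm ((H.s_mul _ _ _).trans (h₂.s_lift _ _ _)) e₃]
  exact (H.mul_assoc _ _ _ e (h₂.s_lift _ _ _)).symm

namespace BisectionMap.IsMultiplicativeCovering

open EtaleGroupoid.Bisection GroupoidCorrespondence.Bisection

variable {G : EtaleGroupoid.{u}} {X : GroupoidCorrespondence G G} {H : EtaleGroupoid.{u}}
  {ϑ : BisectionMap G X H} {R : Opens G.Obj} (hϑ : ϑ.IsMultiplicativeCovering R)
  {ρ : C(H.Obj, G.Obj)} (hρ : ϑ.HasBaseMap ρ)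
include hϑ hρ

/-- The action of `G` on the arrow space of `H`. -/
noncomputable def leftAction : LeftAction G H.Arr where
  anchor h := ρ (H.r h)
  act g h e := (hϑ.isBisectionAssignment_inl hρ).translate g h e
  continuous_anchor := ρ.continuous.comp H.isLocalHomeomorph_r.continuous
  continuous_act := (hϑ.isBisectionAssignment_inl hρ).continuous_translate
  anchor_act g h e :=
    (congrArg ρ ((hϑ.isBisectionAssignment_inl hρ).r_translate g h e)).trans
      (hϑ.base_r_lift hρ _ _ _)
  mul_act g g' h e₁ e₂ := by
    obtain ⟨V, hV⟩ := G.exists_bisection_mem g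
    obtain ⟨W, hW⟩ := G.exists_bisection_mem g'
    have hVW : G.mul g g' e₁ ∈ (V.mul W).carrier := ⟨g, g', e₁, hV, hW, rfl⟩
    have hG := hϑ.isBisectionAssignment_inl hρ
    exact (hG.translate_translate hG hG hV hW hVW (hϑ.mul_GG V W) _ _ _).symm
  one_act h := by
    have h1 : H.one (H.r h) ∈ (ϑ (.inl (unit ⊤))).carrier := by
      rw [hϑ.map_units]
      exact one_mem_unit.2 trivial
    rw [← (hϑ.isBisectionAssignment_inl hρ).mul_eq_translate (i := unit ⊤)
      (one_mem_unit.2 trivial) h1 (H.s_one _) (G.s_one _), H.one_mul]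

/-- An arrow whose range is the range of an arrow in `ϑ_W` for a bisection `W` of `X` belongs to
`X · H`. -/
theorem exists_translate_eq {W : X.Bisection} {h : H.Arr}
    (hh : H.r h ∈ H.r '' (ϑ (.inr W)).carrier) : ∃ x ∈ W.carrier, ∃ k e,
      (hϑ.isBisectionAssignment_inr hρ).translate x k e = h := by
  obtain ⟨t, ht, hr⟩ := hh
  obtain ⟨x, hx, e, -⟩ := (hϑ.isBisectionAssignment_inr hρ).exists_eq_lift ht
  have hk : H.r (H.mul (H.inv t) h ((H.s_inv t).trans hr)) = H.s t :=
    (H.r_mul _ _ _).trans (H.r_inv t)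
  have e' : X.right.anchor x = ρ (H.r (H.mul (H.inv t) h ((H.s_inv t).trans hr))) := by
    rw [hk]; exact e
  refine ⟨x, hx, _, e', ?_⟩
  rw [← (hϑ.isBisectionAssignment_inr hρ).mul_eq_translate hx ht hk.symm e',
    H.mul_inv_cancel_left t h hr]

/-- If `t y = t' y'` with `t ∈ ϑ_V`, `t' ∈ ϑ_W`, then `t⁻¹ t'` belongs to `ϑ_{⟨V|W⟩}`, so that it
acts as an arrow `g ∈ ⟨V|W⟩`. Comparing sources and ranges shows that `g = ⟨x|x'⟩`. -/
theorem translate_eq_iff (x x' : X.Carrier) (y y' : H.Arr)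
    (e : X.right.anchor x = (hϑ.leftAction hρ).anchor y)
    (e' : X.right.anchor x' = (hϑ.leftAction hρ).anchor y') :
    (hϑ.isBisectionAssignment_inr hρ).translate x y e =
      (hϑ.isBisectionAssignment_inr hρ).translate x' y' e' ↔
    ∃ (g : G.Arr) (h₁ : X.right.anchor x = G.r g) (h₂ : G.s g = (hϑ.leftAction hρ).anchor y'),
      x' = X.right.act x g h₁ ∧ y = (hϑ.leftAction hρ).act g y' h₂ := by
  have hG := hϑ.isBisectionAssignment_inl hρ
  have hX := hϑ.isBisectionAssignment_inr hρ
  obtain ⟨V, hV⟩ := X.exists_bisection_mem x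
  constructor
  · intro h
    obtain ⟨W, hW⟩ := X.exists_bisection_mem x'
    have ht := hX.lift_mem x _ e hV
    have hs := hX.s_lift x _ e
    have ht' := hX.lift_mem x' _ e' hW
    have hs' := hX.s_lift x' _ e'
    set t := hX.lift x _ e
    set t' := hX.lift x' _ e'
    replace h : H.mul t y hs = H.mul t' y' hs' := h
    have hr : H.r t = H.r t' := by rw [← H.r_mul t y hs, h, H.r_mul]
    have hsr : H.s (H.inv t) = H.r t' := (H.s_inv t).trans hr
    have hk : H.mul (H.inv t) t' hsr ∈
        (ϑ (.inl (GroupoidCorrespondence.Bisection.bracket V W))).carrier := by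
      rw [← hϑ.bracket]
      refine ⟨_, _, hsr, ?_, ht', rfl⟩
      change H.inv (H.inv t) ∈ (ϑ (.inr V)).carrier
      rwa [H.inv_inv]
    have hks : H.s (H.mul (H.inv t) t' hsr) = H.r y' := (H.s_mul _ _ _).trans hs'
    obtain ⟨g, hg, e₁, h1⟩ := hG.exists_eq_lift hk
    have e₂ : G.s g = ρ (H.r y') := by rw [e₁, hks]
    have h2 : ρ (H.r (H.mul (H.inv t) t' hsr)) = G.r g := by
      rw [h1]
      exact hϑ.base_r_lift hρ _ _ _
    rw [H.r_mul, H.r_inv, hs] at h2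
    have h3 : y = hG.translate g y' e₂ := by
      rw [← hG.mul_eq_translate hg hk hks, H.mul_assoc _ _ _ hsr hs',
        ← H.inv_mul_cancel_left t y hs]
      exact H.mul_congr rfl h _
    obtain ⟨v, hv, w, hw, e₃, h4⟩ := hg
    obtain rfl : v = x := V.injOn_s hv hV (e₃.trans (h2.symm.trans e.symm))
    refine ⟨g, e₃, e₂, ?_, h3⟩
    rw [h4]
    refine W.injOn_s hW hw ?_
    rw [← h4, X.right.anchor_act]
    exact e'.trans e₂.symm
  · rintro ⟨g, h₁, h₂, rfl, rfl⟩
    obtain ⟨W, hW⟩ := G.exists_bisection_mem g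
    have hVW : X.right.act x g h₁ ∈ (rightMul V W).carrier := ⟨x, g, h₁, hV, hW, rfl⟩
    exact hX.translate_translate hG hX hV hW hVW (hϑ.mul_XG V W) _ _ _

theorem exists_closure_subset (hcl : ϑ.ClosureCondition) (x : X.Carrier) :
    ∃ V ∈ nhds x, closure {z | ∃ x ∈ V, ∃ y e,
      (hϑ.isBisectionAssignment_inr hρ).translate x y e = z} ⊆
      {z | ∃ x y e, (hϑ.isBisectionAssignment_inr hρ).translate x y e = z} := by
  have hX := hϑ.isBisectionAssignment_inr hρ
  obtain ⟨C, -, hC, hCx⟩ := X.etale.exists_isCompact_mem_nhds (x := x) Filter.univ_mem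
  obtain ⟨U, hxU, hUC⟩ := X.exists_bisection hCx
  refine ⟨U.carrier, U.isOpen.mem_nhds hxU, fun h hh => ?_⟩
  have h1 : H.r h ∈ closure (H.r '' (ϑ (.inr U)).carrier) := by
    refine closure_mono ?_ (image_closure_subset_closure_image H.isLocalHomeomorph_r.continuous
      (mem_image_of_mem H.r hh))
    rintro _ ⟨_, ⟨x, hx, y, e, rfl⟩, rfl⟩
    exact ⟨_, hX.lift_mem x _ e hx, (hX.r_translate x y e).symm⟩
  obtain ⟨W, hW⟩ := mem_iUnion.1 (hcl U ⟨C, hC, hUC⟩ h1)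
  obtain ⟨x, -, k, e, h2⟩ := hϑ.exists_translate_eq hρ hW
  exact ⟨x, k, e, h2⟩

/-- The `(G, X, R)`-action on the arrow space of `H` described by `ϑ`. -/
noncomputable def action (hcl : ϑ.ClosureCondition) : CorrespondenceAction G X R H.Arr where
  toLeftAction := hϑ.leftAction hρ
  xact x h e := (hϑ.isBisectionAssignment_inr hρ).translate x h e
  continuous_xact := (hϑ.isBisectionAssignment_inr hρ).continuous_translate
  isOpenMap_xact := (hϑ.isBisectionAssignment_inr hρ).isOpenMap_translate
  anchor_xact x h e :=
    (congrArg ρ ((hϑ.isBisectionAssignment_inr hρ).r_translate x h e)).trans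
      (hϑ.base_r_liftX hρ _ _ _)
  act_xact g x h e₁ e₂ := by
    obtain ⟨V, hV⟩ := G.exists_bisection_mem g
    obtain ⟨W, hW⟩ := X.exists_bisection_mem x
    have hVW : X.left.act g x e₁ ∈ (leftMul V W).carrier := ⟨g, x, e₁, hV, hW, rfl⟩
    exact (hϑ.isBisectionAssignment_inl hρ).translate_translate (hϑ.isBisectionAssignment_inr hρ)
      (hϑ.isBisectionAssignment_inr hρ) hV hW hVW (hϑ.mul_GX V W) _ _ _
  xact_eq_iff := hϑ.translate_eq_iff hρ
  covers h hh := by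
    have h1 : H.one (H.r h) ∈ (ϑ (.inl (unit R))).carrier := by
      rw [hρ]
      exact one_mem_unit.2 hh
    obtain ⟨W, hW⟩ := mem_iUnion.1 (hϑ.covering ⟨_, h1, H.r_one _⟩)
    obtain ⟨x, -, k, e, h2⟩ := hϑ.exists_translate_eq hρ hW
    exact ⟨x, k, e, h2⟩
  isClosed_of_isCompact C hC := X.isClosed_of_closure_subset
    (hϑ.isBisectionAssignment_inr hρ).isOpenMap_translate (hϑ.translate_eq_iff hρ)
    (hϑ.exists_closure_subset hρ hcl) hC

theorem action_isTranslationInvariant (hcl : ϑ.ClosureCondition) :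
    (hϑ.action hρ hcl).IsTranslationInvariant where
  anchor_mul h k e := congrArg ρ (H.r_mul h k e)
  s_act g h e := (hϑ.isBisectionAssignment_inl hρ).s_translate g h e
  s_xact x h e := (hϑ.isBisectionAssignment_inr hρ).s_translate x h e
  act_mul g h k e₁ e₂ := (hϑ.isBisectionAssignment_inl hρ).translate_mul g h k e₁ e₂
  xact_mul x h k e₁ e₂ := (hϑ.isBisectionAssignment_inr hρ).translate_mul x h k e₁ e₂

theorem describes_action (hcl : ϑ.ClosureCondition) : ϑ.Describes (hϑ.action hρ hcl) := by
  have hG := hϑ.isBisectionAssignment_inl hρ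
  have hX := hϑ.isBisectionAssignment_inr hρ
  refine ⟨fun V h k => ⟨?_, ?_⟩, fun V h k => ⟨?_, ?_⟩⟩
  · rintro ⟨t, ht, e, rfl⟩
    obtain ⟨g, hg, e', -⟩ := hG.exists_eq_lift ht
    rw [e] at e'
    exact ⟨g, hg, e', (hG.mul_eq_translate hg ht e e').symm⟩
  · rintro ⟨g, hg, e, rfl⟩
    exact ⟨_, hG.lift_mem _ _ e hg, hG.s_lift _ _ _, rfl⟩
  · rintro ⟨t, ht, e, rfl⟩
    obtain ⟨g, hg, e', -⟩ := hX.exists_eq_lift ht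
    rw [e] at e'
    exact ⟨g, hg, e', (hX.mul_eq_translate hg ht e e').symm⟩
  · rintro ⟨g, hg, e, rfl⟩
    exact ⟨_, hX.lift_mem _ _ e hg, hX.s_lift _ _ _, rfl⟩

end BisectionMap.IsMultiplicativeCovering

/-! ### Proper base maps and the closure condition -/

/-- Suppose that arrows `t ∈ ϑ_U` have ranges converging to `ω`. They act by points `x ∈ U` with
`s(x) = ϱ(s(t))`. By compactness, these converge along an ultrafilter, and so do the sources of
the arrows because `ϱ` is proper. Then the arrows converge in `ϑ_W` for a bisection `W` around the
limit of the points `x`. -/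
theorem BisectionMap.IsMultiplicativeCovering.closureCondition_of_isProperMap
    {G : EtaleGroupoid.{u}} {X : GroupoidCorrespondence G G} {H : EtaleGroupoid.{u}}
    {ϑ : BisectionMap G X H} {R : Opens G.Obj} (hϑ : ϑ.IsMultiplicativeCovering R)
    {ρ : C(H.Obj, G.Obj)} (hρ : ϑ.HasBaseMap ρ) (hp : IsProperMap ρ) : ϑ.ClosureCondition := by
  have hX := hϑ.isBisectionAssignment_inr hρ
  rintro U ⟨C, hC, hUC⟩ ω hω
  obtain ⟨u, huT, huω⟩ := mem_closure_iff_ultrafilter.1 hω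
  have : (Filter.comap H.r u ⊓ Filter.principal (ϑ (.inr U)).carrier).NeBot :=
    Filter.comap_inf_principal_neBot_of_image_mem u.neBot huT
  let v := Ultrafilter.of (Filter.comap H.r u ⊓ Filter.principal (ϑ (.inr U)).carrier)
  have hv : (v : Filter H.Arr) ≤ _ := Ultrafilter.of_le _
  have hvT : (ϑ (.inr U)).carrier ∈ (v : Filter H.Arr) :=
    hv (Filter.mem_inf_of_right (Filter.mem_principal_self _))
  have hvω : Filter.Tendsto H.r v (nhds ω) :=
    ((Filter.map_mono (hv.trans inf_le_left)).trans Filter.map_comap_le).trans huω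
  obtain ⟨t₀, ht₀⟩ := v.nonempty_of_mem hvT
  obtain ⟨x₀, -, -⟩ := hX.exists_source ht₀
  have : Nonempty X.Carrier := ⟨x₀⟩
  have hsrc : ∀ t ∈ (ϑ (.inr U)).carrier, ∃ x, x ∈ U.carrier ∧ X.right.anchor x = ρ (H.s t) :=
    fun t ht => hX.exists_source ht
  choose! x hxU hxs using hsrc
  obtain ⟨x₁, hx₁, hvx⟩ := isCompact_iff_ultrafilter_le_nhds.1 hC (v.map x) (by
    rw [Filter.le_principal_iff, Ultrafilter.mem_coe, Ultrafilter.mem_map]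
    exact Filter.mem_of_superset hvT fun t ht => hUC (hxU t ht))
  obtain ⟨ω₁, hω₁, hvs⟩ := isCompact_iff_ultrafilter_le_nhds.1
    (hp.isCompact_preimage (hC.image X.right.continuous_anchor)) (v.map H.s) (by
    rw [Filter.le_principal_iff, Ultrafilter.mem_coe, Ultrafilter.mem_map]
    exact Filter.mem_of_superset hvT fun t ht => ⟨x t, hUC (hxU t ht), hxs t ht⟩)
  replace hvx : Filter.Tendsto x v (nhds x₁) := hvx
  replace hvs : Filter.Tendsto H.s v (nhds ω₁) := hvs
  have e : X.right.anchor x₁ = ρ ω₁ := by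
    refine tendsto_nhds_unique_of_eventuallyEq
      ((X.right.continuous_anchor.tendsto x₁).comp hvx) ((ρ.continuous.tendsto ω₁).comp hvs) ?_
    filter_upwards [hvT] with t ht using hxs t ht
  obtain ⟨W, hW⟩ := X.exists_bisection_mem x₁
  have hvt : (v : Filter H.Arr) ≤ nhds (hX.lift x₁ ω₁ e) := by
    intro N hN
    obtain ⟨O, hON, hO, htO⟩ := mem_nhds_iff.1 hN
    have h1 : H.s '' ((ϑ (.inr W)).carrier ∩ O) ∈ nhds ω₁ :=
      (H.isLocalHomeomorph_s.isOpenMap _ ((ϑ (.inr W)).isOpen.inter hO)).mem_nhds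
        ⟨_, ⟨hX.lift_mem _ _ e hW, htO⟩, hX.s_lift _ _ e⟩
    filter_upwards [hvT, hvx (W.isOpen.mem_nhds hW), hvs h1]
    rintro t ht htW ⟨t', ⟨ht'W, ht'O⟩, hs⟩
    have h2 := hX.mem_of_mem (hxU t ht) htW (hxs t ht) ht
    exact hON ((ϑ (.inr W)).injOn_s ht'W h2 hs ▸ ht'O)
  have hr : ω = H.r (hX.lift x₁ ω₁ e) := tendsto_nhds_unique hvω
    ((H.isLocalHomeomorph_r.continuous.tendsto _).mono_left hvt)
  exact mem_iUnion.2 ⟨W, _, hX.lift_mem _ _ e hW, hr.symm⟩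

/-! ### Invariant maps and naturality of the groupoid model -/

section Invariant

variable {G : EtaleGroupoid.{u}} {X : GroupoidCorrespondence G G} {R : Opens G.Obj}

/-- A map is invariant under a groupoid action. -/
def LeftAction.IsInvariantMap {M : EtaleGroupoid.{u}} {Y B : Type u} [TopologicalSpace Y]
    (a : LeftAction M Y) (f : Y → B) : Prop :=
  ∀ g y e, f (a.act g y e) = f y

namespace CorrespondenceAction

variable {Y : Type u} [TopologicalSpace Y] (c : CorrespondenceAction G X R Y)

/-- A map is invariant under a `(G, X, R)`-action. -/
def IsInvariantMap {B : Type u} (f : Y → B) : Prop :=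
  c.toLeftAction.IsInvariantMap f ∧ ∀ x y e, f (c.xact x y e) = f y

/-- The `(G, X, R)`-action on the first factor of `Y ×_{f,B,g} K` for an invariant map `f`. -/
def pullback {B K : Type u} [TopologicalSpace K] {f : Y → B} (hf : c.IsInvariantMap f)
    (g : K → B) : CorrespondenceAction G X R (FibreProd f g) where
  anchor p := c.anchor p.1.1
  act γ p e := ⟨(c.act γ p.1.1 e, p.1.2), (hf.1 _ _ _).trans p.2⟩
  continuous_anchor := c.continuous_anchor.comp (continuous_fst.comp continuous_subtype_val)
  continuous_act := by
    refine Continuous.subtype_mk (Continuous.prodMk ?_ (continuous_snd.comp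
      (continuous_subtype_val.comp (continuous_snd.comp continuous_subtype_val)))) _
    exact c.continuous_act.comp (Continuous.subtype_mk ((continuous_fst.comp
      continuous_subtype_val).prodMk (continuous_fst.comp
        (continuous_subtype_val.comp (continuous_snd.comp continuous_subtype_val))))
          fun p => p.2)
  anchor_act γ p e := c.anchor_act γ p.1.1 e
  mul_act γ δ p e₁ e₂ := Subtype.ext (Prod.ext (c.mul_act γ δ p.1.1 e₁ e₂) rfl)
  one_act p := Subtype.ext (Prod.ext (c.one_act p.1.1) rfl)
  xact x p e := ⟨(c.xact x p.1.1 e, p.1.2), (hf.2 _ _ _).trans p.2⟩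
  continuous_xact := by
    refine Continuous.subtype_mk (Continuous.prodMk ?_ (continuous_snd.comp
      (continuous_subtype_val.comp (continuous_snd.comp continuous_subtype_val)))) _
    exact c.continuous_xact.comp (Continuous.subtype_mk ((continuous_fst.comp
      continuous_subtype_val).prodMk (continuous_fst.comp
        (continuous_subtype_val.comp (continuous_snd.comp continuous_subtype_val))))
          fun p => p.2)
  isOpenMap_xact := by
    -- the multiplication map is a base change of the open multiplication map for `Y`
    let Φ : FibreProd X.right.anchor c.anchor → Y := fun p => c.xact p.1.1 p.1.2 p.2
    let pr : FibreProd f g → Y := fun q => q.1.1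
    let j : FibreProd Φ pr → FibreProd X.right.anchor fun p : FibreProd f g => c.anchor p.1.1 :=
      fun z => ⟨(z.1.1.1.1, ⟨(z.1.1.1.2, z.1.2.1.2),
        (hf.2 _ _ z.1.1.2).symm.trans ((congrArg f z.2).trans z.1.2.2)⟩), z.1.1.2⟩
    have hj : Continuous j := by
      refine Continuous.subtype_mk (Continuous.prodMk (by fun_prop)
        (Continuous.subtype_mk (by fun_prop) _)) _
    intro U hU
    convert FibreProd.isOpenMap_snd c.isOpenMap_xact
      (show Continuous pr from continuous_fst.comp continuous_subtype_val) _ (hU.preimage hj)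
      using 1
    ext q
    constructor
    · rintro ⟨⟨⟨x, p⟩, e⟩, hp, rfl⟩
      exact ⟨⟨(⟨(x, p.1.1), e⟩, ⟨(c.xact x p.1.1 e, p.1.2), _⟩), rfl⟩, hp, rfl⟩
    · rintro ⟨⟨⟨⟨⟨x, y⟩, e⟩, ⟨⟨y', k⟩, e'⟩⟩, h⟩, hp, rfl⟩
      exact ⟨_, hp, Subtype.ext (Prod.ext h rfl)⟩
  anchor_xact x p e := c.anchor_xact x p.1.1 e
  act_xact γ x p e₁ e₂ := Subtype.ext (Prod.ext (c.act_xact γ x p.1.1 e₁ e₂) rfl)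
  xact_eq_iff x x' p p' e e' := by
    simp only [Subtype.ext_iff, Prod.ext_iff, c.xact_eq_iff]
    constructor
    · rintro ⟨⟨γ, h₁, h₂, h₃, h₄⟩, h₅⟩
      exact ⟨γ, h₁, h₂, h₃, h₄, h₅⟩
    · rintro ⟨γ, h₁, h₂, h₃, h₄, h₅⟩
      exact ⟨⟨γ, h₁, h₂, h₃, h₄⟩, h₅⟩
  covers p hp := by
    obtain ⟨x, y, e, h⟩ := c.covers p.1.1 hp
    exact ⟨x, ⟨(y, p.1.2), (hf.2 x y e).symm.trans ((congrArg f h).trans p.2)⟩, e,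
      Subtype.ext (Prod.ext h rfl)⟩
  isClosed_of_isCompact C hC := by
    convert (c.isClosed_of_isCompact C hC).preimage
      (show Continuous fun q : FibreProd f g => q.1.1 from
        continuous_fst.comp continuous_subtype_val) using 1
    ext p
    constructor
    · rintro ⟨x, q, e, hx, rfl⟩
      exact ⟨x, q.1.1, e, hx, rfl⟩
    · rintro ⟨x, y, e, hx, h⟩
      exact ⟨x, ⟨(y, p.1.2), (hf.2 x y e).symm.trans ((congrArg f h).trans p.2)⟩, e, hx,
        Subtype.ext (Prod.ext h rfl)⟩

theorem pullback_image {B K : Type u} [TopologicalSpace K] {f : Y → B}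
    (hf : c.IsInvariantMap f) (g : K → B) :
    (c.pullback hf g).image = (fun p : FibreProd f g => p.1.1) ⁻¹' c.image := by
  ext p
  constructor
  · rintro ⟨x, q, e, rfl⟩
    exact ⟨x, q.1.1, e, rfl⟩
  · rintro ⟨x, y, e, h⟩
    exact ⟨x, ⟨(y, p.1.2), (hf.2 x y e).symm.trans ((congrArg f h).trans p.2)⟩, e,
      Subtype.ext (Prod.ext h rfl)⟩

theorem isEquivariant_fst {B K : Type u} [TopologicalSpace K] {f : Y → B}
    (hf : c.IsInvariantMap f) (g : K → B) :
    (c.pullback hf g).IsEquivariant c fun p => p.1.1 :=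
  ⟨⟨fun _ => rfl, fun _ _ _ => rfl, fun _ _ _ => rfl⟩, (c.pullback_image hf g).symm⟩

end CorrespondenceAction

namespace GroupoidModel

variable (m : GroupoidModel G X R) {Y : Type u} [TopologicalSpace Y]
  (c : CorrespondenceAction G X R Y)

theorem fst_act_pullback {B K : Type u} [TopologicalSpace K] {f : Y → B}
    (hf : c.IsInvariantMap f) (g : K → B) :
    ∃ h : ∀ p : FibreProd f g, (m.equiv _ c).anchor p.1.1 = (m.equiv _ (c.pullback hf g)).anchor p,
      ∀ γ p e, ((m.equiv _ (c.pullback hf g)).act γ p e).1.1 =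
        (m.equiv _ c).act γ p.1.1 (e.trans (h p).symm) :=
  (m.natural _ _ _ _ _ (continuous_fst.comp continuous_subtype_val)).1 (c.isEquivariant_fst hf g)

theorem isInvariantMap_const : c.IsInvariantMap fun _ : Y => PUnit.unit.{u + 1} :=
  ⟨fun _ _ _ => rfl, fun _ _ _ => rfl⟩

/-- The embeddings `y ↦ (y, k)` are equivariant, so the model acts on `Y × K` by acting on the
first factor. -/
theorem snd_act_pullback_const {K : Type u} [TopologicalSpace K]
    (γ : m.M.Arr) (p : FibreProd (fun _ : Y => PUnit.unit.{u + 1}) fun _ : K => PUnit.unit)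
    (e : m.M.s γ = (m.equiv _ (c.pullback (isInvariantMap_const c) _)).anchor p) :
    ((m.equiv _ (c.pullback (isInvariantMap_const c) _)).act γ p e).1.2 = p.1.2 := by
  obtain ⟨⟨y, k⟩, -⟩ := p
  let i : Y → FibreProd (fun _ : Y => PUnit.unit.{u + 1}) fun _ : K => PUnit.unit :=
    fun y => ⟨(y, k), rfl⟩
  have hi : Continuous i := Continuous.subtype_mk (by fun_prop) _
  have hic : c.IsEquivariant (c.pullback (isInvariantMap_const c) fun _ : K => PUnit.unit) i := by
    refine ⟨⟨fun _ => rfl, fun _ _ _ => rfl, fun _ _ _ => rfl⟩, ?_⟩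
    rw [c.pullback_image]
    rfl
  obtain ⟨h, h'⟩ := (m.natural _ _ _ _ i hi).1 hic
  exact (congrArg (fun q => q.1.2) (h' γ y (e.trans (h y)))).symm

/-- A continuous map is invariant for a `(G, X, R)`-action if and only if it is invariant for the
corresponding action of the model: both mean that its graph is equivariant. -/
theorem isInvariantMap_iff {K : Type u} [TopologicalSpace K] {f : Y → K} (hf : Continuous f) :
    c.IsInvariantMap f ↔ (m.equiv _ c).IsInvariantMap f := by
  let Γ : Y → FibreProd (fun _ : Y => PUnit.unit.{u + 1}) fun _ : K => PUnit.unit :=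
    fun y => ⟨(y, f y), rfl⟩
  have hΓ : Continuous Γ := Continuous.subtype_mk (by fun_prop) _
  have hn := m.natural _ _ c (c.pullback (isInvariantMap_const c) fun _ : K => PUnit.unit) Γ hΓ
  constructor
  · intro h
    have hc : c.IsEquivariant (c.pullback (isInvariantMap_const c) fun _ : K => PUnit.unit) Γ := by
      refine ⟨⟨fun _ => rfl, fun γ y e => Subtype.ext (Prod.ext rfl (h.1 γ y e)),
        fun x y e => Subtype.ext (Prod.ext rfl (h.2 x y e))⟩, ?_⟩
      rw [c.pullback_image]
      rfl
    obtain ⟨h₁, h₂⟩ := hn.1 hc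
    intro γ y e
    exact (congrArg (fun q => q.1.2) (h₂ γ y e)).trans (m.snd_act_pullback_const c γ (Γ y) _)
  · intro h
    obtain ⟨h₁, h₂⟩ := m.fst_act_pullback c (isInvariantMap_const c) fun _ : K => PUnit.unit
    obtain ⟨⟨h₀, h₃, h₄⟩, -⟩ := hn.2 ⟨fun y => (h₁ (Γ y)).symm, fun γ y e => Subtype.ext (Prod.ext
      (h₂ γ (Γ y) (e.trans (h₁ (Γ y)))).symm
      ((h γ y e).trans (m.snd_act_pullback_const c γ (Γ y) (e.trans (h₁ (Γ y)))).symm))⟩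
    exact ⟨fun γ y e => congrArg (fun q => q.1.2) (h₃ γ y e),
      fun x y e => congrArg (fun q => q.1.2) (h₄ x y e)⟩

end GroupoidModel

/-- An action on the arrow space of `H` commutes with the right translation action of `H`. -/
structure LeftAction.IsTranslationInvariant {M H : EtaleGroupoid.{u}} (a : LeftAction M H.Arr) :
    Prop where
  anchor_mul : ∀ h k e, a.anchor (H.mul h k e) = a.anchor h
  s_act : ∀ m h e, H.s (a.act m h e) = H.s h
  act_mul : ∀ m h k (e₁ : M.s m = a.anchor h) (e₂ : H.s h = H.r k),
    H.mul (a.act m h e₁) k ((s_act m h e₁).trans e₂) =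
      a.act m (H.mul h k e₂) (e₁.trans (anchor_mul h k e₂).symm)

/-- The source map `s : H → H⁰` is invariant for both actions or for neither, and then
commuting with right translations means that the multiplication map `H ×_{s,r} H → H` is
equivariant for the action on the first factor. -/
theorem GroupoidModel.isTranslationInvariant_iff (m : GroupoidModel G X R) {H : EtaleGroupoid.{u}}
    (c : CorrespondenceAction G X R H.Arr) :
    c.IsTranslationInvariant ↔ (m.equiv _ c).IsTranslationInvariant := by
  have hs := m.isInvariantMap_iff c H.isLocalHomeomorph_s.continuous
  let μ : FibreProd H.s H.r → H.Arr := fun p => H.mul p.1.1 p.1.2 p.2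
  have hμ : Continuous μ := H.continuous_mul
  -- the second coordinate projection of the pullback is invariant
  have hsnd : ∀ (hf : c.IsInvariantMap H.s) γ p e,
      ((m.equiv _ (c.pullback hf H.r)).act γ p e).1.2 = p.1.2 := fun hf =>
    (m.isInvariantMap_iff (c.pullback hf H.r) (continuous_snd.comp continuous_subtype_val)).1
      ⟨fun _ _ _ => rfl, fun _ _ _ => rfl⟩
  constructor
  · intro hc
    have hf : c.IsInvariantMap H.s := ⟨hc.s_act, hc.s_xact⟩
    obtain ⟨h₁, h₂⟩ := m.fst_act_pullback c hf H.r
    have he : (c.pullback hf H.r).IsEquivariant c μ := by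
      refine ⟨⟨fun p => hc.anchor_mul _ _ p.2, fun γ p e => hc.act_mul γ p.1.1 p.1.2 e p.2,
        fun x p e => hc.xact_mul x p.1.1 p.1.2 e p.2⟩, ?_⟩
      rw [c.pullback_image]
      ext ⟨⟨h, k⟩, e⟩
      constructor
      -- if `h k = x · l`, then `h = x · (l k⁻¹)`
      · rintro ⟨x, l, e', hl : c.xact x l e' = H.mul h k e⟩
        have hsl : H.s l = H.r (H.inv k) := by
          rw [← hc.s_xact x l e', hl, H.s_mul, H.r_inv]
        refine ⟨x, H.mul l (H.inv k) hsl, e'.trans (hc.anchor_mul _ _ hsl).symm, ?_⟩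
        rw [← hc.xact_mul x l _ e' hsl, H.mul_congr hl rfl]
        exact H.mul_inv_cancel_right h k e
      · rintro ⟨x, l, e', hl : c.xact x l e' = h⟩
        subst hl
        exact ⟨x, H.mul l k ((hc.s_xact _ _ _).symm.trans e), _,
          (hc.xact_mul x l k e' ((hc.s_xact _ _ _).symm.trans e)).symm⟩
    obtain ⟨h₃, h₄⟩ := (m.natural _ _ _ _ μ hμ).1 he
    refine ⟨fun h k e => ?_, hs.1 hf, fun γ h k e₁ e₂ => ?_⟩
    · exact (h₃ ⟨(h, k), e⟩).trans (h₁ ⟨(h, k), e⟩).symm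
    · refine Eq.trans ?_ (h₄ γ ⟨(h, k), e₂⟩ (e₁.trans (h₁ ⟨(h, k), e₂⟩)))
      exact H.mul_congr (h₂ γ ⟨(h, k), e₂⟩ _).symm (hsnd hf γ ⟨(h, k), e₂⟩ _).symm _
  · intro ha
    have hf : c.IsInvariantMap H.s := hs.2 ha.s_act
    obtain ⟨h₁, h₂⟩ := m.fst_act_pullback c hf H.r
    obtain ⟨⟨h₃, h₄, h₅⟩, -⟩ := (m.natural _ _ (c.pullback hf H.r) c μ hμ).2
      ⟨fun p => (ha.anchor_mul _ _ p.2).trans (h₁ p), fun γ p e =>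
        (H.mul_congr (h₂ γ p e) (hsnd hf γ p e) _).trans (ha.act_mul γ _ _ _ _)⟩
    exact ⟨fun h k e => h₃ ⟨(h, k), e⟩, hf.1, hf.2, fun γ h k e₁ e₂ => h₄ γ ⟨(h, k), e₂⟩ e₁,
      fun x h k e₁ e₂ => h₅ x ⟨(h, k), e₂⟩ e₁⟩

end Invariant

/-! ### Translation of ultrafilters -/

namespace IsLocalHomeomorph

variable {A B Y : Type u} [TopologicalSpace A] [TopologicalSpace B] {σ : A → B} {π : Y → B}
  (hσ : IsLocalHomeomorph σ) (act : ∀ a y, σ a = π y → Y)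

/-- The partial map `y ↦ v · y` for `v ∈ V` with `σ v = π y`, where `σ` is injective on `V`. It is
extended by the identity map. -/
noncomputable def sectionMap (σ : A → B) (act : ∀ a y, σ a = π y → Y) (V : Set A) (y : Y) : Y :=
  open Classical in
  if h : ∃ v ∈ V, σ v = π y then act h.choose y h.choose_spec.2 else y

/-- The translate `a · u` of an ultrafilter `u` on `Y` along which `π` converges to `σ a`. It is the
image of `u` under the map `y ↦ v · y`, `v ∈ V`, `σ v = π y`, for a small neighbourhood `V` of
`a`. -/
noncomputable def translate (a : A) (u : Ultrafilter Y) : Ultrafilter Y :=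
  u.map (sectionMap σ act (hσ.exists_isOpen_injOn (x := a) Filter.univ_mem).choose)

include hσ in
theorem eventually_exists {a : A} {u : Ultrafilter Y} (hu : Filter.Tendsto π u (nhds (σ a)))
    {V : Set A} (hV : V ∈ nhds a) : ∀ᶠ y in (u : Filter Y), ∃ v ∈ V, σ v = π y :=
  hu (hσ.isOpenMap.image_mem_nhds hV)

variable {act}

/-- The translate may be computed with any neighbourhood on which `σ` is injective. -/
theorem mem_translate_iff {a : A} {u : Ultrafilter Y} (hu : Filter.Tendsto π u (nhds (σ a)))
    {V : Set A} (hV : V ∈ nhds a) (hVi : InjOn σ V) {S : Set Y} :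
    S ∈ hσ.translate act a u ↔ ∀ᶠ y in (u : Filter Y), ∀ v ∈ V, ∀ e, act v y e ∈ S := by
  obtain ⟨-, hWo, haW, hWi⟩ := (hσ.exists_isOpen_injOn (x := a) Filter.univ_mem).choose_spec
  rw [translate, Ultrafilter.mem_map]
  refine Filter.eventually_congr ?_
  filter_upwards [hσ.eventually_exists hu (Filter.inter_mem hV (hWo.mem_nhds haW))]
  rintro y ⟨v, ⟨hv, hvW⟩, e⟩
  have h : ∃ v ∈ (hσ.exists_isOpen_injOn (x := a) Filter.univ_mem).choose, σ v = π y :=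
    ⟨v, hvW, e⟩
  have hv' : h.choose = v := hWi h.choose_spec.1 hvW (h.choose_spec.2.trans e.symm)
  have h1 : ∀ v' (e' : σ v' = π y), v' = v → act v' y e' = act v y e := by
    rintro v' e' rfl
    rfl
  simp only [sectionMap, dif_pos h]
  rw [h1 _ _ hv']
  exact ⟨fun hS v' hv' e' => (h1 v' e' (hVi hv' hv (e'.trans e.symm))).symm ▸ hS,
    fun hS => hS v hv e⟩

theorem mem_translate {a : A} {u : Ultrafilter Y} (hu : Filter.Tendsto π u (nhds (σ a)))
    {V : Set A} (hV : V ∈ nhds a) {S : Set Y}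
    (hS : ∀ᶠ y in (u : Filter Y), ∀ v ∈ V, ∀ e, act v y e ∈ S) :
    S ∈ hσ.translate act a u := by
  obtain ⟨W, hWV, hWo, haW, hWi⟩ := hσ.exists_isOpen_injOn hV
  rw [hσ.mem_translate_iff hu (hWo.mem_nhds haW) hWi]
  exact hS.mono fun y hy v hv => hy v (hWV hv)

theorem image_mem_translate {a : A} {u : Ultrafilter Y} (hu : Filter.Tendsto π u (nhds (σ a)))
    {V : Set A} (hV : V ∈ nhds a) {S : Set Y} (hS : S ∈ u) :
    {z | ∃ v ∈ V, ∃ y ∈ S, ∃ e, act v y e = z} ∈ hσ.translate act a u := by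
  refine hσ.mem_translate hu hV ?_
  filter_upwards [hS] with y hy v hv e using ⟨v, hv, y, hy, e, rfl⟩

theorem tendsto_translate {C : Type u} [TopologicalSpace C] {τ : A → C} {π' : Y → C}
    (hτ : Continuous τ) (h : ∀ a y e, π' (act a y e) = τ a) {a : A} {u : Ultrafilter Y}
    (hu : Filter.Tendsto π u (nhds (σ a))) :
    Filter.Tendsto π' (hσ.translate act a u) (nhds (τ a)) := by
  intro N hN
  refine hσ.mem_translate hu (hτ.continuousAt hN) (Filter.Eventually.of_forall ?_)
  intro y v hv e
  rw [mem_preimage, h]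
  exact hv

theorem translate_pure {a : A} {y : Y} (e : σ a = π y) :
    hσ.translate act a (pure y) = pure (act a y e) := by
  refine Ultrafilter.coe_le_coe.1 fun S hS => ?_
  obtain ⟨V, -, hVo, hV, hVi⟩ := hσ.exists_isOpen_injOn (x := a) Filter.univ_mem
  have hu : Filter.Tendsto π (pure y : Ultrafilter Y) (nhds (σ a)) := by
    rw [e]
    exact tendsto_pure_nhds π y
  refine hσ.mem_translate hu (hVo.mem_nhds hV) ?_
  rw [Ultrafilter.coe_pure, Filter.eventually_pure]
  intro v hv e'
  obtain rfl := hVi hv hV (e'.trans e.symm)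
  exact hS

/-- If `v · (v₂ · y) = v₃ · y` with `v₃ ∈ V₃` for `v`, `v₂` close to `a`, `a₂`, then
`a · (a₂ · u) = a₃ · u`. -/
theorem translate_translate {A₂ A₃ : Type u} [TopologicalSpace A₂] [TopologicalSpace A₃]
    {σ₂ : A₂ → B} {σ₃ : A₃ → B} (hσ₂ : IsLocalHomeomorph σ₂) (hσ₃ : IsLocalHomeomorph σ₃)
    {act₂ : ∀ a y, σ₂ a = π y → Y} {act₃ : ∀ a y, σ₃ a = π y → Y} {a : A} {a₂ : A₂} {a₃ : A₃}
    {u : Ultrafilter Y} (h₁ : Filter.Tendsto π (hσ₂.translate act₂ a₂ u) (nhds (σ a)))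
    (h₂ : Filter.Tendsto π u (nhds (σ₂ a₂))) (h₃ : Filter.Tendsto π u (nhds (σ₃ a₃)))
    {V : Set A} {V₂ : Set A₂} {V₃ : Set A₃} (hV : V ∈ nhds a) (hV₂ : V₂ ∈ nhds a₂)
    (hV₃ : V₃ ∈ nhds a₃) (hi : InjOn σ₃ V₃)
    (h : ∀ v ∈ V, ∀ v₂ ∈ V₂, ∀ y e₂ e, ∃ v₃ ∈ V₃, ∃ e₃,
      act v (act₂ v₂ y e₂) e = act₃ v₃ y e₃) :
    hσ.translate act a (hσ₂.translate act₂ a₂ u) = hσ₃.translate act₃ a₃ u := by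
  refine Ultrafilter.coe_le_coe.1 fun S hS => ?_
  refine hσ.mem_translate h₁ hV (hσ₂.mem_translate h₂ hV₂ ?_)
  filter_upwards [(hσ₃.mem_translate_iff h₃ hV₃ hi).1 hS]
  intro y hy v₂ hv₂ e₂ v hv e
  obtain ⟨v₃, hv₃, e₃, h4⟩ := h v hv v₂ hv₂ y e₂ e
  rw [h4]
  exact hy v₃ hv₃ e₃

/-- If an ultrafilter contains the set of all `k · y` with `y ∈ S` and `k` in a compact set `K`,
then it is the translate by some `a ∈ K` of an ultrafilter that contains `S`. -/
theorem exists_eq_translate {V K S : Set _} (hV : IsOpen V) (hVi : InjOn σ V) (hK : IsCompact K)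
    (hKV : K ⊆ V) {w : Ultrafilter Y} (hw : {z | ∃ k ∈ K, ∃ y ∈ S, ∃ e, act k y e = z} ∈ w) :
    ∃ a ∈ K, ∃ u : Ultrafilter Y, S ∈ u ∧ Filter.Tendsto π u (nhds (σ a)) ∧
      hσ.translate act a u = w := by
  obtain ⟨z₀, k₀, -, y₀, -, -⟩ := w.nonempty_of_mem hw
  have : Nonempty A := ⟨k₀⟩
  have : Nonempty Y := ⟨y₀⟩
  have hw' : ∀ z ∈ {z | ∃ k ∈ K, ∃ y ∈ S, ∃ e, act k y e = z},
      ∃ k y, k ∈ K ∧ y ∈ S ∧ ∃ e, act k y e = z := by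
    rintro z ⟨k, hk, y, hy, h⟩
    exact ⟨k, y, hk, hy, h⟩
  choose! k y hk hy e h using hw'
  obtain ⟨a, ha, hka⟩ := isCompact_iff_ultrafilter_le_nhds.1 hK (w.map k) (by
    rw [Filter.le_principal_iff, Ultrafilter.mem_coe, Ultrafilter.mem_map]
    exact Filter.mem_of_superset hw hk)
  have hu : Filter.Tendsto π (w.map y) (nhds (σ a)) := by
    have h1 : Filter.Tendsto (σ ∘ k) w (nhds (σ a)) := (hσ.continuous.tendsto a).comp hka
    refine Filter.tendsto_map' (h1.congr' ?_)
    filter_upwards [hw] with z hz using e z hz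
  refine ⟨a, ha, w.map y, Ultrafilter.mem_map.2 (Filter.mem_of_superset hw hy), hu,
    Ultrafilter.coe_le_coe.1 ?_⟩
  intro T hT
  refine hσ.mem_translate hu (hV.mem_nhds (hKV ha)) ?_
  change ∀ᶠ z in (w : Filter Y), ∀ v ∈ V, ∀ e, act v (y z) e ∈ T
  filter_upwards [hw, hT] with z hz hzT v hv e'
  have hvk : k z = v := hVi (hKV (hk z hz)) hv ((e z hz).trans e'.symm)
  subst hvk
  exact (h z hz).symm ▸ hzT

theorem isOpen_setOf_mem_translate (S : Set Y) {T : Type u} [TopologicalSpace T] {f : T → A}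
    {φ : T → Ultrafilter Y} (hf : Continuous f) (hφ : Continuous φ)
    (h : ∀ t, Filter.Tendsto π (φ t) (nhds (σ (f t)))) :
    IsOpen {t | S ∈ hσ.translate act (f t) (φ t)} := by
  rw [isOpen_iff_mem_nhds]
  intro t ht
  obtain ⟨V, -, hVo, hV, hVi⟩ := hσ.exists_isOpen_injOn (x := f t) Filter.univ_mem
  have h1 := (hσ.mem_translate_iff (h t) (hVo.mem_nhds hV) hVi).1 ht
  filter_upwards [hf.continuousAt (hVo.mem_nhds hV),
    ((ultrafilter_isOpen_basic _).preimage hφ).mem_nhds h1] with t' ht' h2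
  exact hσ.mem_translate (h t') (hVo.mem_nhds ht') h2

theorem continuous_translate {T : Type u} [TopologicalSpace T] {f : T → A}
    {φ : T → Ultrafilter Y} (hf : Continuous f) (hφ : Continuous φ)
    (h : ∀ t, Filter.Tendsto π (φ t) (nhds (σ (f t)))) :
    Continuous fun t => hσ.translate act (f t) (φ t) := by
  refine ultrafilterBasis_is_basis.continuous_iff.2 ?_
  rintro _ ⟨S, rfl⟩
  exact hσ.isOpen_setOf_mem_translate S hf hφ h

end IsLocalHomeomorph

/-! ### The action on convergent ultrafilters -/

namespace CorrespondenceAction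

variable {G : EtaleGroupoid.{u}} {X : GroupoidCorrespondence G G} {R : Opens G.Obj}
  {Y : Type u} [TopologicalSpace Y] (c : CorrespondenceAction G X R Y)

/-- The space of ultrafilters on the set `Y` along which the anchor map converges, with the subspace
topology of the Stone–Čech compactification of the discrete space `Y`. -/
abbrev ConvUltrafilter : Type u :=
  {v : Ultrafilter Y // ∃ b, Filter.Tendsto c.anchor v (nhds b)}

namespace ConvUltrafilter

variable {c}

/-- The limit of the anchor map along a convergent ultrafilter. -/
noncomputable def limit (v : c.ConvUltrafilter) : G.Obj := v.2.choose

theorem tendsto_limit (v : c.ConvUltrafilter) :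
    Filter.Tendsto c.anchor v.1 (nhds v.limit) := v.2.choose_spec

theorem limit_eq {v : c.ConvUltrafilter} {b : G.Obj}
    (h : Filter.Tendsto c.anchor v.1 (nhds b)) : v.limit = b :=
  tendsto_nhds_unique v.tendsto_limit h

theorem tendsto_of_eq {v : c.ConvUltrafilter} {b : G.Obj} (h : b = v.limit) :
    Filter.Tendsto c.anchor v.1 (nhds b) := h ▸ v.tendsto_limit

/-- Ultrafilters that contain the preimage of a closed neighbourhood have their limit in it. -/
theorem continuous_limit : Continuous (limit : c.ConvUltrafilter → G.Obj) := by
  refine continuous_def.2 fun U hU => isOpen_iff_mem_nhds.2 fun v hv => ?_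
  obtain ⟨K, hK, hKc, hKU⟩ := exists_mem_nhds_isClosed_subset (hU.mem_nhds hv)
  have h1 : IsOpen {w : c.ConvUltrafilter | c.anchor ⁻¹' K ∈ w.1} :=
    (ultrafilter_isOpen_basic _).preimage continuous_subtype_val
  filter_upwards [h1.mem_nhds (v.tendsto_limit hK)] with w hw
  exact hKU (hKc.mem_of_tendsto w.tendsto_limit hw)

/-- Ultrafilters on `Y` converge in the compact space of all ultrafilters, and the limit of
ultrafilters whose limits in `G⁰` converge is again convergent. -/
theorem isProperMap_limit : IsProperMap (limit : c.ConvUltrafilter → G.Obj) := by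
  refine isProperMap_iff_ultrafilter.2 ⟨continuous_limit, fun W b hW => ?_⟩
  obtain ⟨v, -, hv⟩ := isCompact_iff_ultrafilter_le_nhds.1 isCompact_univ
    (W.map Subtype.val) (by simp)
  have hvb : Filter.Tendsto c.anchor v (nhds b) := by
    intro N hN
    obtain ⟨U, hUN, hU, hbU⟩ := mem_nhds_iff.1 hN
    refine Filter.mem_of_superset (x := c.anchor ⁻¹' U) ?_ (preimage_mono hUN)
    by_contra h
    have h1 := hv ((ultrafilter_isClosed_basic (c.anchor ⁻¹' U)).isOpen_compl.mem_nhds h)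
    obtain ⟨w, hw, hwU⟩ := W.nonempty_of_mem (Filter.inter_mem h1 (hW (hU.mem_nhds hbU)))
    exact hw (w.tendsto_limit (hU.mem_nhds hwU))
  refine ⟨⟨v, b, hvb⟩, limit_eq hvb, ?_⟩
  rw [nhds_induced, ← Filter.map_le_iff_le_comap]
  exact hv

/-- The action of `G` on convergent ultrafilters. -/
noncomputable def leftAction : LeftAction G c.ConvUltrafilter where
  anchor := limit
  act g v e := ⟨G.isLocalHomeomorph_s.translate c.act g v.1, G.r g,
    G.isLocalHomeomorph_s.tendsto_translate G.isLocalHomeomorph_r.continuous c.anchor_act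
      (tendsto_of_eq e)⟩
  continuous_anchor := continuous_limit
  continuous_act := Continuous.subtype_mk (G.isLocalHomeomorph_s.continuous_translate
    (f := fun p : FibreProd G.s limit => p.1.1) (φ := fun p => p.1.2.1)
    (by fun_prop) (by fun_prop) fun p => tendsto_of_eq p.2) _
  anchor_act g v e := limit_eq (G.isLocalHomeomorph_s.tendsto_translate
    G.isLocalHomeomorph_r.continuous c.anchor_act (tendsto_of_eq e))
  mul_act g h v e₁ e₂ := by
    obtain ⟨V, hV⟩ := G.exists_bisection_mem g
    obtain ⟨W, hW⟩ := G.exists_bisection_mem h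
    refine Subtype.ext (Eq.symm ?_)
    refine G.isLocalHomeomorph_s.translate_translate G.isLocalHomeomorph_s
      G.isLocalHomeomorph_s (V₃ := (V.mul W).carrier)
      (e₁ ▸ G.isLocalHomeomorph_s.tendsto_translate
        G.isLocalHomeomorph_r.continuous c.anchor_act (tendsto_of_eq e₂))
      (tendsto_of_eq e₂) (tendsto_of_eq ((G.s_mul _ _ _).trans e₂)) (V.isOpen.mem_nhds hV)
      (W.isOpen.mem_nhds hW) ((V.mul W).isOpen.mem_nhds ⟨g, h, e₁, hV, hW, rfl⟩)
      (V.mul W).injOn_s ?_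
    intro a ha b hb y e₃ e₄
    have e₅ := e₄.trans (c.anchor_act b y e₃)
    exact ⟨G.mul a b e₅, ⟨a, b, e₅, ha, hb, rfl⟩, (G.s_mul a b e₅).trans e₃,
      (c.mul_act a b y e₅ e₃).symm⟩
  one_act v := by
    refine Subtype.ext (Ultrafilter.coe_le_coe.1 fun S hS => ?_)
    refine G.isLocalHomeomorph_s.mem_translate (tendsto_of_eq (G.s_one _))
      (G.isOpenMap_one.isOpen_range.mem_nhds ⟨_, rfl⟩) ?_
    filter_upwards [hS]
    rintro y hy _ ⟨ω, rfl⟩ e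
    rwa [c.one_act']

/-- The multiplication `X ×_{s,G⁰} Ŷ → Ŷ` for the space `Ŷ` of convergent ultrafilters. -/
noncomputable def xact (x : X.Carrier) (v : c.ConvUltrafilter) (e : X.right.anchor x = v.limit) :
    c.ConvUltrafilter :=
  ⟨X.etale.translate c.xact x v.1, X.left.anchor x,
    X.etale.tendsto_translate X.left.continuous_anchor c.anchor_xact (tendsto_of_eq e)⟩

theorem limit_xact (x : X.Carrier) (v : c.ConvUltrafilter) (e : X.right.anchor x = v.limit) :
    (xact x v e).limit = X.left.anchor x :=
  limit_eq (X.etale.tendsto_translate X.left.continuous_anchor c.anchor_xact (tendsto_of_eq e))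

theorem exists_xact_eq {V : X.Bisection} {K : Set X.Carrier} {S : Set Y} (hK : IsCompact K)
    (hKV : K ⊆ V.carrier) {w : c.ConvUltrafilter}
    (hw : {z | ∃ k ∈ K, ∃ y ∈ S, ∃ e, c.xact k y e = z} ∈ w.1) :
    ∃ x ∈ K, ∃ v : c.ConvUltrafilter, S ∈ v.1 ∧ ∃ e, xact x v e = w := by
  obtain ⟨x, hx, v, hS, hv, h⟩ := X.etale.exists_eq_translate V.isOpen V.injOn_s hK hKV hw
  exact ⟨x, hx, ⟨v, _, hv⟩, hS, (limit_eq (v := ⟨v, _, hv⟩) hv).symm, Subtype.ext h⟩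

theorem continuous_xact : Continuous fun p : FibreProd X.right.anchor
    (limit : c.ConvUltrafilter → G.Obj) => xact p.1.1 p.1.2 p.2 :=
  Continuous.subtype_mk (X.etale.continuous_translate
    (f := fun p : FibreProd X.right.anchor (limit : c.ConvUltrafilter → G.Obj) => p.1.1)
    (φ := fun p => p.1.2.1) (by fun_prop) (by fun_prop) fun p => tendsto_of_eq p.2) _

theorem isOpenMap_xact : IsOpenMap fun p : FibreProd X.right.anchor
    (limit : c.ConvUltrafilter → G.Obj) => xact p.1.1 p.1.2 p.2 := by
  intro U hU
  rw [isOpen_iff_mem_nhds]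
  rintro _ ⟨⟨⟨x, v⟩, e⟩, hp, rfl⟩
  obtain ⟨T, hT, rfl⟩ := isOpen_induced_iff.1 hU
  obtain ⟨A, N, hA, hN, hxA, hvN, hAN⟩ := isOpen_prod_iff.1 hT x v hp
  obtain ⟨N', hN', rfl⟩ := isOpen_induced_iff.1 hN
  obtain ⟨_, ⟨S, rfl⟩, hvS, hSN⟩ :=
    ultrafilterBasis_is_basis.exists_subset_of_mem_open (a := v.1) hvN hN'
  obtain ⟨V, hxV, hVA⟩ := X.exists_bisection (hA.mem_nhds hxA)
  obtain ⟨K, hKV, hK, hxK⟩ := X.etale.exists_isCompact_mem_nhds (V.isOpen.mem_nhds hxV)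
  have h1 : IsOpen {w : c.ConvUltrafilter |
      {z | ∃ k ∈ K, ∃ y ∈ S, ∃ e, c.xact k y e = z} ∈ w.1} :=
    (ultrafilter_isOpen_basic _).preimage continuous_subtype_val
  filter_upwards [h1.mem_nhds (X.etale.image_mem_translate (tendsto_of_eq e) hxK hvS)] with w hw
  obtain ⟨x', hx', v', hv', e', h2⟩ := exists_xact_eq hK hKV hw
  exact ⟨⟨(x', v'), e'⟩, hAN ⟨hVA (hKV hx'), hSN hv'⟩, h2⟩

theorem act_xact (g : G.Arr) (x : X.Carrier) (v : c.ConvUltrafilter)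
    (e₁ : G.s g = X.left.anchor x) (e₂ : X.right.anchor x = v.limit) :
    leftAction.act g (xact x v e₂) (e₁.trans (limit_xact x v e₂).symm) =
      xact (X.left.act g x e₁) v ((X.right_anchor_left g x e₁).trans e₂) := by
  obtain ⟨V, hV⟩ := G.exists_bisection_mem g
  obtain ⟨W, hW⟩ := X.exists_bisection_mem x
  refine Subtype.ext ?_
  refine G.isLocalHomeomorph_s.translate_translate X.etale X.etale
    (V₃ := (GroupoidCorrespondence.Bisection.leftMul V W).carrier)
    (tendsto_of_eq (v := xact x v e₂) (e₁.trans (limit_xact x v e₂).symm))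
    (tendsto_of_eq e₂) (tendsto_of_eq ((X.right_anchor_left g x e₁).trans e₂))
    (V.isOpen.mem_nhds hV) (W.isOpen.mem_nhds hW)
    ((GroupoidCorrespondence.Bisection.leftMul V W).isOpen.mem_nhds ⟨g, x, e₁, hV, hW, rfl⟩)
    (GroupoidCorrespondence.Bisection.leftMul V W).injOn_s ?_
  intro a ha b hb y e₃ e₄
  have e₅ := e₄.trans (c.anchor_xact b y e₃)
  exact ⟨X.left.act a b e₅, ⟨a, b, e₅, ha, hb, rfl⟩, (X.right_anchor_left a b e₅).trans e₃,
    c.act_xact a b y e₅ e₃⟩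

theorem xact_act (x : X.Carrier) (g : G.Arr) (v : c.ConvUltrafilter)
    (e₁ : X.right.anchor x = G.r g) (e₂ : G.s g = v.limit) :
    xact x (leftAction.act g v e₂) (e₁.trans (leftAction.anchor_act g v e₂).symm) =
      xact (X.right.act x g e₁) v ((X.right.anchor_act x g e₁).trans e₂) := by
  obtain ⟨V, hV⟩ := X.exists_bisection_mem x
  obtain ⟨W, hW⟩ := G.exists_bisection_mem g
  refine Subtype.ext ?_
  refine X.etale.translate_translate G.isLocalHomeomorph_s X.etale
    (V₃ := (GroupoidCorrespondence.Bisection.rightMul V W).carrier)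
    (tendsto_of_eq (v := leftAction.act g v e₂) (e₁.trans (leftAction.anchor_act g v e₂).symm))
    (tendsto_of_eq e₂) (tendsto_of_eq ((X.right.anchor_act x g e₁).trans e₂))
    (V.isOpen.mem_nhds hV) (W.isOpen.mem_nhds hW)
    ((GroupoidCorrespondence.Bisection.rightMul V W).isOpen.mem_nhds ⟨x, g, e₁, hV, hW, rfl⟩)
    (GroupoidCorrespondence.Bisection.rightMul V W).injOn_s ?_
  intro a ha b hb y e₃ e₄
  have e₅ := e₄.trans (c.anchor_act b y e₃)
  exact ⟨X.right.act a b e₅, ⟨a, b, e₅, ha, hb, rfl⟩, (X.right.anchor_act a b e₅).trans e₃,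
    c.xact_act a b y e₅ e₃⟩

/-- Multiplication by `x` is injective: it is the image under an injective partial map. -/
theorem xact_left_cancel {x : X.Carrier} {v v' : c.ConvUltrafilter}
    {e : X.right.anchor x = v.limit} {e' : X.right.anchor x = v'.limit}
    (h : xact x v e = xact x v' e') : v = v' := by
  obtain ⟨V, hV⟩ := X.exists_bisection_mem x
  refine (Subtype.ext (Ultrafilter.coe_le_coe.1 fun S hS => ?_)).symm
  have h1 := X.etale.image_mem_translate (act := c.xact) (tendsto_of_eq e)
    (V.isOpen.mem_nhds hV) hS
  have h2 : X.etale.translate c.xact x v.1 = X.etale.translate c.xact x v'.1 :=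
    congrArg Subtype.val h
  rw [h2, X.etale.mem_translate_iff (tendsto_of_eq e') (V.isOpen.mem_nhds hV) V.injOn_s] at h1
  filter_upwards [h1, X.etale.eventually_exists (tendsto_of_eq e') (V.isOpen.mem_nhds hV)]
  rintro y hy ⟨a, ha, e₁⟩
  obtain ⟨b, hb, z, hz, e₂, h3⟩ := hy a ha e₁
  obtain ⟨g, e₃, e₄, h4, h5⟩ := (c.xact_eq_iff _ _ _ _ _ _).1 h3
  -- `b · z = a · y` with `a, b ∈ V` forces `a = b` and `y = z`
  obtain rfl := V.injOn_proj hb ha (GroupoidCorrespondence.proj_eq_iff.2 ⟨g, e₃, h4.symm⟩)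
  obtain rfl := X.free _ _ _ h4.symm
  rw [c.one_act'] at h5
  exact h5 ▸ hz

/-- Since `X/G` is Hausdorff, the orbit of `x` is determined by `x · v`. -/
theorem proj_eq_of_xact_eq {x x' : X.Carrier} {v v' : c.ConvUltrafilter}
    {e : X.right.anchor x = v.limit} {e' : X.right.anchor x' = v'.limit}
    (h : xact x v e = xact x' v' e') : X.right.proj x = X.right.proj x' := by
  by_contra hne
  obtain ⟨P, P', hP, hP', hxP, hxP', hd⟩ := t2_separation hne
  have h1 := X.etale.image_mem_translate (act := c.xact) (tendsto_of_eq e)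
    ((hP.preimage X.continuous_proj).mem_nhds hxP) Filter.univ_mem
  have h2 := X.etale.image_mem_translate (act := c.xact) (tendsto_of_eq e')
    ((hP'.preimage X.continuous_proj).mem_nhds hxP') Filter.univ_mem
  have h3 : X.etale.translate c.xact x v.1 = X.etale.translate c.xact x' v'.1 :=
    congrArg Subtype.val h
  rw [h3] at h1
  obtain ⟨_, ⟨a, ha, y, -, e₁, rfl⟩, b, hb, z, -, e₂, h4⟩ :=
    Ultrafilter.nonempty_of_mem (Filter.inter_mem h1 h2)
  obtain ⟨g, e₃, -, h5, -⟩ := (c.xact_eq_iff _ _ _ _ _ _).1 h4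
  have h6 : X.right.proj b = X.right.proj a :=
    GroupoidCorrespondence.proj_eq_iff.2 ⟨g, e₃, h5.symm⟩
  exact disjoint_left.1 hd ha (h6 ▸ hb)

theorem xact_eq_iff (x x' : X.Carrier) (v v' : c.ConvUltrafilter)
    (e : X.right.anchor x = v.limit) (e' : X.right.anchor x' = v'.limit) :
    xact x v e = xact x' v' e' ↔ ∃ (g : G.Arr) (h₁ : X.right.anchor x = G.r g)
      (h₂ : G.s g = v'.limit), x' = X.right.act x g h₁ ∧ v = leftAction.act g v' h₂ := by
  constructor
  · intro h
    obtain ⟨g, h₁, rfl⟩ := GroupoidCorrespondence.proj_eq_iff.1 (proj_eq_of_xact_eq h)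
    have h₂ := (X.right.anchor_act x g h₁).symm.trans e'
    exact ⟨g, h₁, h₂, rfl, xact_left_cancel (h.trans (xact_act x g v' h₁ h₂).symm)⟩
  · rintro ⟨g, h₁, h₂, rfl, rfl⟩
    exact xact_act x g v' h₁ h₂

/-- The `(G, X, R)`-action on convergent ultrafilters. The space `X · Ŷ` contains all ultrafilters
that contain `K · Y` for some compact subset `K` of a bisection of `X`. -/
noncomputable def action (hX : X.RegularOn R) : CorrespondenceAction G X R c.ConvUltrafilter where
  toLeftAction := leftAction
  xact := xact
  continuous_xact := continuous_xact
  isOpenMap_xact := isOpenMap_xact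
  anchor_xact := limit_xact
  act_xact := act_xact
  xact_eq_iff := xact_eq_iff
  covers w hw := by
    -- a compact neighbourhood `B` of the limit has a compact preimage in `X/G`
    obtain ⟨B, hB, hBR, hBc⟩ := local_compact_nhds (R.isOpen.mem_nhds hw)
    have hD : IsCompact (X.rStar ⁻¹' B) := by
      have h1 := (hX.1.isCompact_preimage (Topology.IsInducing.subtypeVal.isCompact_preimage_iff
        (by rwa [Subtype.range_coe]) |>.2 hBc)).image continuous_subtype_val
      convert h1 using 1
      ext z
      constructor
      · intro hz
        exact ⟨⟨z, hBR hz⟩, hz, rfl⟩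
      · rintro ⟨z, hz, rfl⟩
        exact hz
    have hcov : ∀ x : X.Carrier, ∃ K ∈ nhds x, IsCompact K ∧ ∃ V : X.Bisection,
        K ⊆ V.carrier := by
      intro x
      obtain ⟨V, hV⟩ := X.exists_bisection_mem x
      obtain ⟨K, hKV, hK, hxK⟩ := X.etale.exists_isCompact_mem_nhds (V.isOpen.mem_nhds hV)
      exact ⟨K, hxK, hK, V, hKV⟩
    obtain ⟨F, hF, hFK, hFD⟩ := X.exists_finite_cover hcov hD
    have h2 : c.anchor ⁻¹' B ⊆ ⋃ K ∈ F, {z | ∃ k ∈ K, ∃ y ∈ univ, ∃ e, c.xact k y e = z} := by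
      intro z hz
      obtain ⟨x, y, e, rfl⟩ := c.covers z (hBR hz)
      have h3 : X.right.proj x ∈ X.rStar ⁻¹' B := by
        rw [mem_preimage, c.anchor_xact] at hz
        exact hz
      obtain ⟨K, hK, x', hx', h4⟩ := by simpa only [mem_iUnion, exists_prop] using hFD h3
      obtain ⟨k, ek, rfl⟩ := GroupoidCorrespondence.proj_eq_iff.1 h4
      have e1 : G.s k = c.anchor y := (X.right.anchor_act x' k ek).symm.trans e
      exact mem_biUnion hK ⟨x', hx', c.act k y e1, trivial, _, c.xact_act x' k y ek e1⟩
    have h5 := Filter.mem_of_superset (x := c.anchor ⁻¹' B) (w.tendsto_limit hB) h2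
    obtain ⟨K, hK, h6⟩ := (Ultrafilter.finite_biUnion_mem_iff hF).1 h5
    obtain ⟨hKc, V, hKV⟩ := hFK K hK
    obtain ⟨x, -, v, -, e, h7⟩ := exists_xact_eq hKc hKV h6
    exact ⟨x, v, e, h7⟩
  isClosed_of_isCompact C hC := by
    refine X.isClosed_of_closure_subset isOpenMap_xact xact_eq_iff (fun x => ?_) hC
    obtain ⟨V, hV⟩ := X.exists_bisection_mem x
    obtain ⟨K, hKV, hK, hxK⟩ := X.etale.exists_isCompact_mem_nhds (V.isOpen.mem_nhds hV)
    refine ⟨interior K, interior_mem_nhds.2 hxK, ?_⟩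
    -- the ultrafilters that contain `K · Y` form a closed set between `K° · Ŷ` and `X · Ŷ`
    have h1 : IsClosed {w : c.ConvUltrafilter |
        {z | ∃ k ∈ K, ∃ y ∈ univ, ∃ e, c.xact k y e = z} ∈ w.1} :=
      (ultrafilter_isClosed_basic _).preimage continuous_subtype_val
    refine (closure_minimal ?_ h1).trans ?_
    · rintro _ ⟨x, hx, v, e, rfl⟩
      exact X.etale.image_mem_translate (tendsto_of_eq e) (mem_interior_iff_mem_nhds.1 hx)
        Filter.univ_mem
    · intro w hw
      obtain ⟨x, -, v, -, e, h7⟩ := exists_xact_eq hK hKV hw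
      exact ⟨x, v, e, h7⟩

end ConvUltrafilter

end CorrespondenceAction

/-! ### Properness of the object space of the groupoid model -/

/-- The set `Y` with the discrete topology. -/
def DiscreteCopy (Y : Type u) : Type u := Y

instance (Y : Type u) : TopologicalSpace (DiscreteCopy Y) := ⊥

instance (Y : Type u) : DiscreteTopology (DiscreteCopy Y) := ⟨rfl⟩

theorem IsLocalHomeomorph.discreteTopology_fibreProd {A B Y : Type u} [TopologicalSpace A]
    [TopologicalSpace B] [TopologicalSpace Y] [DiscreteTopology Y] {σ : A → B}
    (hσ : IsLocalHomeomorph σ) (π : Y → B) : DiscreteTopology (FibreProd σ π) := by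
  refine discreteTopology_iff_isOpen_singleton.2 fun p => ?_
  obtain ⟨⟨a, y⟩, e⟩ := p
  obtain ⟨V, -, hVo, hV, hVi⟩ := hσ.exists_isOpen_injOn (x := a) Filter.univ_mem
  convert (hVo.prod (isOpen_discrete {y})).preimage continuous_subtype_val using 1
  ext ⟨⟨a', y'⟩, e'⟩
  constructor
  · intro h
    cases h
    exact ⟨hV, rfl⟩
  · rintro ⟨h, h' : y' = y⟩
    subst h'
    obtain rfl := hVi hV h (e.trans e'.symm)
    rfl

namespace CorrespondenceAction

variable {G : EtaleGroupoid.{u}} {X : GroupoidCorrespondence G G} {R : Opens G.Obj}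
  {Y : Type u} [TopologicalSpace Y] (c : CorrespondenceAction G X R Y)

/-- The same action on `Y` with the discrete topology. It is continuous and open because the source
maps of `G` and `X` are étale. -/
def discrete : CorrespondenceAction G X R (DiscreteCopy Y) where
  anchor := c.anchor
  act := c.act
  continuous_anchor := continuous_of_discreteTopology
  continuous_act :=
    have := G.isLocalHomeomorph_s.discreteTopology_fibreProd (Y := DiscreteCopy Y) c.anchor
    continuous_of_discreteTopology
  anchor_act := c.anchor_act
  mul_act := c.mul_act
  one_act := c.one_act
  xact := c.xact
  continuous_xact :=
    have := X.etale.discreteTopology_fibreProd (Y := DiscreteCopy Y) c.anchor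
    continuous_of_discreteTopology
  isOpenMap_xact _ _ := isOpen_discrete _
  anchor_xact := c.anchor_xact
  act_xact := c.act_xact
  xact_eq_iff := c.xact_eq_iff
  covers := c.covers
  isClosed_of_isCompact _ _ := isClosed_discrete _

theorem isEquivariant_discrete :
    c.discrete.IsEquivariant c fun y : DiscreteCopy Y => (y : Y) :=
  ⟨⟨fun _ => rfl, fun _ _ _ => rfl, fun _ _ _ => rfl⟩, rfl⟩

/-- The principal ultrafilter of a point. -/
def principal (y : DiscreteCopy Y) : c.ConvUltrafilter :=
  ⟨(pure y : Ultrafilter Y), c.anchor y, tendsto_pure_nhds c.anchor y⟩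

theorem isEquivariant_principal (hX : X.RegularOn R) :
    c.discrete.IsEquivariant (ConvUltrafilter.action (c := c) hX) c.principal := by
  refine ⟨⟨fun y => ConvUltrafilter.limit_eq (tendsto_pure_nhds c.anchor y), fun g y e => ?_,
    fun x y e => ?_⟩, ?_⟩
  · exact Subtype.ext (G.isLocalHomeomorph_s.translate_pure e).symm
  · exact Subtype.ext (X.etale.translate_pure e).symm
  · ext y
    constructor
    · rintro ⟨x, v, e, h⟩
      have h1 := X.etale.image_mem_translate (act := c.xact) (ConvUltrafilter.tendsto_of_eq e)
        Filter.univ_mem Filter.univ_mem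
      have h2 : X.etale.translate c.xact x v.1 = (pure y : Ultrafilter Y) :=
        congrArg Subtype.val h
      rw [h2] at h1
      obtain ⟨x', -, y', -, h3⟩ := (Ultrafilter.mem_pure (α := Y)).1 h1
      exact ⟨x', y', h3⟩
    · rintro ⟨x, y', e, h⟩
      exact ⟨x, c.principal y',
        e.trans (ConvUltrafilter.limit_eq (tendsto_pure_nhds c.anchor y')).symm,
        Subtype.ext ((X.etale.translate_pure e).trans (congrArg pure h))⟩

end CorrespondenceAction

/-- The action of a groupoid on its object space. -/
def EtaleGroupoid.objAction (M : EtaleGroupoid.{u}) : LeftAction M M.Obj where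
  anchor := id
  act g _ _ := M.r g
  continuous_anchor := continuous_id
  continuous_act := M.isLocalHomeomorph_r.continuous.comp
    (continuous_fst.comp continuous_subtype_val)
  anchor_act _ _ _ := rfl
  mul_act g h _ _ _ := M.r_mul g h _
  one_act y := M.r_one y

namespace GroupoidModel

variable {G : EtaleGroupoid.{u}} {X : GroupoidCorrespondence G G} {R : Opens G.Obj}
  (m : GroupoidModel G X R)

/-- The universal `(G, X, R)`-action, on the object space of the model. -/
def universalAction : CorrespondenceAction G X R m.M.Obj := (m.equiv _).symm m.M.objAction

theorem equiv_universalAction : m.equiv _ m.universalAction = m.M.objAction :=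
  Equiv.apply_symm_apply _ _

/-- The anchor map `Y → M⁰` of an `M`-action is `M`-equivariant, so it is a map over `G⁰`. -/
theorem universalAction_anchor {Y : Type u} [TopologicalSpace Y]
    (c : CorrespondenceAction G X R Y) (y : Y) :
    m.universalAction.anchor ((m.equiv Y c).anchor y) = c.anchor y := by
  have h1 : (m.equiv Y c).IsEquivariant (m.equiv _ m.universalAction) (m.equiv Y c).anchor := by
    rw [equiv_universalAction]
    exact ⟨fun _ => rfl, (m.equiv Y c).anchor_act⟩
  obtain ⟨⟨h, -⟩, -⟩ := (m.natural _ _ _ _ _ (m.equiv Y c).continuous_anchor).2 h1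
  exact h y

theorem anchor_of_isEquivariant {Y₁ Y₂ : Type u} [TopologicalSpace Y₁] [TopologicalSpace Y₂]
    {c₁ : CorrespondenceAction G X R Y₁} {c₂ : CorrespondenceAction G X R Y₂} {f : Y₁ → Y₂}
    (hf : Continuous f) (h : c₁.IsEquivariant c₂ f) (y : Y₁) :
    (m.equiv _ c₂).anchor (f y) = (m.equiv _ c₁).anchor y :=
  ((m.natural _ _ _ _ f hf).1 h).1 y

/-- The anchor map of the universal action is proper if `X` is regular on `R`. The convergent
ultrafilters on `M⁰` carry an action with proper anchor map. Its canonical map to `M⁰` is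
surjective because it maps principal ultrafilters to the corresponding points. -/
theorem isProperMap_universalAction_anchor (hX : X.RegularOn R) :
    IsProperMap m.universalAction.anchor := by
  set c := m.universalAction with hc
  let d := CorrespondenceAction.ConvUltrafilter.action (c := c) hX
  have h1 : m.universalAction.anchor ∘ (m.equiv _ d).anchor = d.anchor :=
    funext fun v => m.universalAction_anchor d v
  refine isProperMap_of_comp_of_surj (m.equiv _ d).continuous_anchor c.continuous_anchor
    (h1 ▸ CorrespondenceAction.ConvUltrafilter.isProperMap_limit) fun y => ?_
  have h2 := m.anchor_of_isEquivariant continuous_of_discreteTopology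
    (c.isEquivariant_principal hX) y
  have h3 := m.anchor_of_isEquivariant continuous_of_discreteTopology c.isEquivariant_discrete y
  rw [hc, equiv_universalAction] at h3
  exact ⟨_, h2.trans h3.symm⟩

variable {H : EtaleGroupoid.{u}}

theorem isTranslationInvariant_actionOfActor (a : Actor m.M H) :
    (m.actionOfActor a).IsTranslationInvariant := by
  rw [m.isTranslationInvariant_iff, actionOfActor, Equiv.apply_symm_apply]
  exact ⟨a.anchor_mul, a.s_act, a.act_mul⟩

theorem actionOfActor_injective :
    Function.Injective (m.actionOfActor : Actor m.M H → CorrespondenceAction G X R H.Arr) := by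
  intro a b h
  have h1 : a.toLeftAction = b.toLeftAction := (m.equiv H.Arr).symm.injective h
  cases a
  cases b
  cases h1
  rfl

theorem exists_actor {c : CorrespondenceAction G X R H.Arr} (hc : c.IsTranslationInvariant) :
    ∃ a : Actor m.M H, m.actionOfActor a = c := by
  have h := (m.isTranslationInvariant_iff c).1 hc
  exact ⟨⟨m.equiv _ c, h.anchor_mul, h.s_act, h.act_mul⟩, Equiv.symm_apply_apply _ _⟩

/-- The bijection between actors and maps on bisections. -/
noncomputable def actorEquiv : Actor m.M H ≃
    {ϑ : BisectionMap G X H // ϑ.IsMultiplicativeCovering R ∧ ϑ.ClosureCondition} :=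
  Equiv.ofBijective (fun a => ⟨(m.isTranslationInvariant_actionOfActor a).bisectionMap,
    (m.isTranslationInvariant_actionOfActor a).isMultiplicativeCovering,
    (m.isTranslationInvariant_actionOfActor a).closureCondition⟩) <| by
  constructor
  · intro a b h
    have h1 := (m.isTranslationInvariant_actionOfActor a).describes
    rw [show (m.isTranslationInvariant_actionOfActor a).bisectionMap = _ from
      congrArg Subtype.val h] at h1
    exact m.actionOfActor_injective
      (h1.unique_action (m.isTranslationInvariant_actionOfActor b).describes)
  · rintro ⟨ϑ, hϑ, hcl⟩
    obtain ⟨ρ, hρ, -⟩ := hϑ.existsUnique_baseMap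
    obtain ⟨a, ha⟩ := m.exists_actor (hϑ.action_isTranslationInvariant hρ hcl)
    have h1 := hϑ.describes_action hρ hcl
    rw [← ha] at h1
    exact ⟨a, Subtype.ext ((m.isTranslationInvariant_actionOfActor a).describes.unique h1)⟩

theorem describes_actorEquiv (a : Actor m.M H) :
    (m.actorEquiv a).1.Describes (m.actionOfActor a) :=
  (m.isTranslationInvariant_actionOfActor a).describes

theorem isProper_iff (hX : X.RegularOn R) (a : Actor m.M H) :
    a.IsProper ↔ IsProperMap (m.actionOfActor a).base := by
  have h1 : (m.actionOfActor a).base = m.universalAction.anchor ∘ fun ω => a.anchor (H.one ω) := by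
    funext ω
    have h2 := m.universalAction_anchor (m.actionOfActor a) (H.one ω)
    rw [actionOfActor, Equiv.apply_symm_apply] at h2
    exact h2.symm
  rw [h1]
  exact ⟨(m.isProperMap_universalAction_anchor hX).comp, isProperMap_of_comp_of_t2
    (a.continuous_anchor.comp H.continuous_one) m.universalAction.continuous_anchor⟩

end GroupoidModel

theorem mainTheorem2 (G H : EtaleGroupoid.{u}) (R : TopologicalSpace.Opens G.Obj)
    (hR : G.IsInvariant (R : Set G.Obj)) (X : GroupoidCorrespondence G G) (hX : X.RegularOn R)
    (m : GroupoidModel G X R) :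
    -- actors are equivalent to maps on bisections with the six conditions
    (∃ Θ : Actor m.M H ≃
        {ϑ : BisectionMap G X H // ϑ.IsMultiplicativeCovering R ∧ ϑ.ClosureCondition},
      (∀ (a : Actor m.M H) (ϑ : BisectionMap G X H),
        ϑ.Describes (m.actionOfActor a) ↔ ϑ = (Θ a).1) ∧
      -- the map `ϱ` of an actor, and properness
      ∀ a : Actor m.M H, ∃ ρ : C(H.Obj, G.Obj),
        (∀ h : H.Arr, (m.actionOfActor a).anchor h = ρ (H.r h)) ∧
        (Θ a).1.HasBaseMap ρ ∧
        (a.IsProper ↔ IsProperMap ρ)) ∧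
    -- if `ϱ` is proper, then the closure condition is redundant
    (∀ ϑ : BisectionMap G X H, ϑ.IsMultiplicativeCovering R →
      (∃! ρ : C(H.Obj, G.Obj), ϑ.HasBaseMap ρ) ∧
      ∀ ρ : C(H.Obj, G.Obj), ϑ.HasBaseMap ρ → IsProperMap ρ → ϑ.ClosureCondition) := by
  refine ⟨⟨m.actorEquiv, fun a ϑ => ⟨fun h => h.unique (m.describes_actorEquiv a), ?_⟩,
    fun a => ⟨⟨_, (m.actionOfActor a).continuous_base⟩, ?_, ?_, m.isProper_iff hX a⟩⟩,
    fun ϑ hϑ => ⟨hϑ.existsUnique_baseMap, fun ρ hρ hp => hϑ.closureCondition_of_isProperMap hρ hp⟩⟩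
  · rintro rfl
    exact m.describes_actorEquiv a
  · exact (m.isTranslationInvariant_actionOfActor a).anchor_eq
  · exact (m.isTranslationInvariant_actionOfActor a).hasBaseMap
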